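/- Let $f:\mathbb R^2\to\mathbb R$ be $C^\infty$, $2\pi$-periodic in $y$, even in $x$ and even in $y$, with $f(x,y)=0$ for $|x|>R$ (for some $R>0$) and $\int_{\mathbb R}\int_0^{2\pi} f\,dy\,dx>0$. For $j\in\mathbb Z$ put $$f_j(x)=\int_0^{2\pi}e^{-ijy}f(x,y)\,dy,\qquad \tilde f_j(\xi)=\int_{\mathbb R}e^{-i\xi x}f_j(x)\,dx .$$ **Notation.** For real $\beta\in(0,\tfrac12)$ and small $\mu>0$ let $\omega^2=(1-\beta)^2-\mu^2$, $\gamma(\mu,\beta)=\omega^2/(4\pi)$, $k_0=\sqrt{1-2\beta-\mu^2}$, $k_{-1}=\mu$ and $k_m=\sqrt{(\beta+m)^2-\omega^2}$ for $m\ne0,-1$; let $$G_0(x)=\frac{i}{2k_0}e^{ik_0|x|},\qquad G_m(x)=\frac1{2k_m}e^{-k_m|x|}\quad(m\neq0),$$ $H_{-1}=G_{-1}-\frac1{2\mu}$ and $H_n=G_n$ for $n\ne-1$. Let $\mathcal A$ be the Banach space of sequences $\mathbf A=(A_m)_{m\in\mathbb Z}$ in $C([-R,R];\mathbb C)$, with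 norm $\big(\sum_m\sup|A_m|^2\big)^{1/2}$, each component being extended by $0$ outside $[-R,R]$, and let $$(\hat T\mathbf A)_m=2\gamma\sum_{n\in\mathbb Z}(H_n*A_n)\,f_{m-n},\qquad (\mathbf g^{(2)})_m=f_{m+1},\qquad \mathbf Y=(1-\varepsilon\hat T)^{-1}\mathbf g^{(2)},$$ $$F(\varepsilon,\mu,\beta)=\int Y_{-1}(x)\,dx,\qquad R(\varepsilon,\mu,\beta)=\int Y_0(x)\,e^{ik_0x}\,dx .$$ **Theorem.** Suppose that $\kappa_0=\sqrt{1-2\beta_{00}}\in(0,1)$ satisfies $\tilde f_1(\kappa_0)=0$ and $\tilde f_1'(\kappa_0)\neq0$, and put $\nu_{00}=\frac{(1-\beta_{00})^2}{4\pi}\tilde f_0(0)$. Then there are $\varepsilon_0,\delta>0$ and real analytic functions $\beta_{tr},\nu_{tr}:(-\varepsilon_0,\varepsilon_0)\to\mathbb R$ with $$\beta_{tr}(\varepsilon)=\beta_{00}+O(\varepsilon),\qquad \nu_{tr}(\varepsilon)=\nu_{00}+O(\varepsilon)\qquad(\varepsilon\to0)$$ such that for every $\varepsilon\in(0,\varepsilon_0)$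 the following holds. 1. $0<\beta_{tr}(\varepsilon)<\frac12$ and $\nu_{tr}(\varepsilon)>0$. With $\beta=\beta_{tr}(\varepsilon)$ and $\mu=\varepsilon\nu_{tr}(\varepsilon)$, the operator $\hat T$ is bounded on $\mathcal A$, $\mathbf g^{(2)}\in\mathcal A$, $1-\varepsilon\hat T$ is invertible, and $(\beta,\nu)=(\beta_{tr}(\varepsilon),\nu_{tr}(\varepsilon))$ solves the system $$\nu=\gamma(\varepsilon\nu,\beta)\,F(\varepsilon,\varepsilon\nu,\beta),\qquad R(\varepsilon,\varepsilon\nu,\beta)=0;$$ there is no other real solution $(\beta,\nu)$ of this system with $|\beta-\beta_{00}|<\delta$, $|\nu-\nu_{00}|<\delta$. 2. For these values of $\beta$ and $\mu$ the series $$\Psi(x,y)=\sum_{m\in\mathbb Z}e^{i(\beta+m)y}\,(G_m*Y_m)(x)$$ converges absolutely, and $\Psi$ is a finite energy solution of $$-\Delta\Psi=\omega^2(1+\varepsilon f)\Psi\ \text{ in }\Pi=\mathbb R\times(0,2\pi),\qquad \Psi(x,2\pi)=e^{2\pi i\beta}\Psi(x,0),\quad \Psi_y(x,2\pi)=e^{2\pi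 i\beta}\Psi_y(x,0),$$ with $\omega^2=(1-\beta_{tr}(\varepsilon))^2-\varepsilon^2\nu_{tr}(\varepsilon)^2$. That is, $\Psi$ belongs to the completion of the space of test functions (smooth functions on $\overline\Pi$ satisfying the boundary conditions and vanishing for large $|x|$) in the norm $\|\Psi\|_{L^2(\Pi)}+\|\nabla\Psi\|_{L^2(\Pi)}$, and for all test functions $\Phi$ $$\int_\Pi\nabla\Psi\cdot\nabla\overline\Phi\,dx\,dy=\omega^2\int_\Pi(1+\varepsilon f)\,\Psi\,\overline\Phi\,dx\,dy .$$ Moreover $\Psi$ is $C^\infty$ on $\mathbb R^2$, satisfies $\Psi(x,y+2\pi)=e^{2\pi i\beta}\Psi(x,y)$ and the equation pointwise on $\mathbb R^2$. 3. $\Psi$ is an embedded trapped mode: $\Psi\not\equiv0$, $|\Psi(x,y)|\le Ce^{-c|x|}$ for some $C,c>0$ (depending on $\varepsilon$), and $\beta^2<\omega^2<(1-\beta)^2$, so that $\omega^2$ lies inside the continuous spectrum $[\beta^2,\infty)$. -/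

import Mathlib

open Set Filter Topology MeasureTheory Asymptotics
open scoped ContDiff

namespace RayleighBloch

noncomputable section

/-! ### Fourier coefficients of the perturbation -/

/-- The Fourier coefficient `f_j(x) = ∫_0^{2π} e^{-ijy} f(x,y) dy`. -/
def fourierCoef (f : ℝ × ℝ → ℝ) (j : ℤ) (x : ℝ) : ℂ :=
  ∫ y in (0 : ℝ)..(2 * Real.pi), Complex.exp (-(Complex.I * (j : ℂ) * (y : ℂ))) * (f (x, y) : ℂ)

/-- Its Fourier transform `f̃_j(ξ) = ∫ e^{-iξx} f_j(x) dx`. -/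
def fourierCoefHat (f : ℝ × ℝ → ℝ) (j : ℤ) (ξ : ℝ) : ℂ :=
  ∫ x : ℝ, Complex.exp (-(Complex.I * (ξ : ℂ) * (x : ℂ))) * fourierCoef f j x

/-- The standing assumptions on the perturbation `f`: it is smooth, `2π`-periodic in `y`, vanishes
for `|x| > R`, has positive volume over a period, and is even in each variable. -/
structure IsPerturbation (f : ℝ × ℝ → ℝ) (R : ℝ) : Prop where
  smooth : ContDiff ℝ ∞ f
  periodic : ∀ x y : ℝ, f (x, y + 2 * Real.pi) = f (x, y)
  vanishes : ∀ x y : ℝ, R < |x| → f (x, y) = 0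
  volume_pos : 0 < ∫ x : ℝ, ∫ y in (0 : ℝ)..(2 * Real.pi), f (x, y)
  even_x : ∀ x y : ℝ, f (-x, y) = f (x, y)
  even_y : ∀ x y : ℝ, f (x, -y) = f (x, y)

/-! ### Spectral parameters and Green functions

The frequency is `ω² = (1 - β)² - μ²`, just below the second cut-off `(1 - β)²`. -/

/-- `ω²`. -/
def omegaSq (μ β : ℝ) : ℝ := (1 - β) ^ 2 - μ ^ 2

/-- `γ = ω² / (4π)`. -/
def gam (μ β : ℝ) : ℝ := omegaSq μ β / (4 * Real.pi)

/-- The wave numbers: `k_0 = √(ω² - β²) = √(1 - 2β - μ²)` for the propagating mode,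
`k_{-1} = μ`, and `k_m = √((β+m)² - ω²)` for the other evanescent modes. -/
def waveNumber (μ β : ℝ) (m : ℤ) : ℝ :=
  if m = 0 then √(1 - 2 * β - μ ^ 2)
  else if m = -1 then μ
  else √((β + m) ^ 2 - omegaSq μ β)

/-- The Green functions: outgoing for `m = 0`, exponentially decaying for `m ≠ 0`. -/
def green (μ β : ℝ) (m : ℤ) (x : ℝ) : ℂ :=
  if m = 0 then
    Complex.I / (2 * (waveNumber μ β 0 : ℂ)) *
      Complex.exp (Complex.I * (waveNumber μ β 0 : ℂ) * (|x| : ℝ))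
  else ((Real.exp (-(waveNumber μ β m * |x|)) / (2 * waveNumber μ β m) : ℝ) : ℂ)

/-- The regularized kernels: `H_{-1} = G_{-1} - 1/(2μ)` and `H_n = G_n` for `n ≠ -1`. -/
def greenReg (μ β : ℝ) (n : ℤ) (x : ℝ) : ℂ :=
  if n = -1 then (((Real.exp (-(μ * |x|)) - 1) / (2 * μ) : ℝ) : ℂ) else green μ β n x

/-! ### The Banach space of vectors and the operator `T̂` -/

/-- The space `𝒜` of vectors `(A_m)_{m ∈ ℤ}`, `A_m ∈ C[-R,R]`, with norm
`(∑ (sup |A_m|)²)^{1/2}`. A component is understood to be `0` outside `[-R,R]`. -/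
abbrev VecSpace (R : ℝ) := lp (fun _ : ℤ => C(Set.Icc (-R) R, ℂ)) 2

/-- Extension of a component by `0` outside `[-R,R]`. -/
def zeroExt {R : ℝ} (a : C(Set.Icc (-R) R, ℂ)) (x : ℝ) : ℂ :=
  if h : x ∈ Set.Icc (-R) R then a ⟨x, h⟩ else 0

/-- The convolution `(h * a)(x) = ∫ h(x-ξ) a(ξ) dξ`. -/
def conv {R : ℝ} (h : ℝ → ℂ) (a : C(Set.Icc (-R) R, ℂ)) (x : ℝ) : ℂ :=
  ∫ ξ : ℝ, h (x - ξ) * zeroExt a ξ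

/-- `T` is the operator `(T̂ A)_m = 2γ ∑_n (H_n * A_n) f_{m-n}` on `𝒜`. -/
def IsThat (f : ℝ × ℝ → ℝ) (R μ β : ℝ) (T : VecSpace R →L[ℂ] VecSpace R) : Prop :=
  ∀ (A : VecSpace R) (m : ℤ) (x : Set.Icc (-R) R),
    HasSum (fun n : ℤ => 2 * (gam μ β : ℂ) *
      (conv (greenReg μ β n) (A n) (x : ℝ) * fourierCoef f (m - n) (x : ℝ))) (T A m x)

/-- `Y = (1 - ε T̂)⁻¹ g⁽²⁾`, where `(g⁽²⁾)_m = f_{m+1}`; this includes that `T̂` is a bounded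
operator on `𝒜`, that `g⁽²⁾` belongs to `𝒜` and that `1 - ε T̂` is invertible. -/
def IsResolventVector (f : ℝ × ℝ → ℝ) (R ε μ β : ℝ) (Y : VecSpace R) : Prop :=
  ∃ (T : VecSpace R →L[ℂ] VecSpace R) (g : VecSpace R),
    IsThat f R μ β T ∧
    (∀ (m : ℤ) (x : Set.Icc (-R) R), g m x = fourierCoef f (m + 1) (x : ℝ)) ∧
    IsUnit (1 - (ε : ℂ) • T) ∧
    Y = Ring.inverse (1 - (ε : ℂ) • T) g

/-- The average `⟨Y_{-1}⟩ = ∫ Y_{-1}`, which is `F(ε, μ, β)` when `Y = (1 - ε T̂)⁻¹ g⁽²⁾`. -/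
def averageF {R : ℝ} (Y : VecSpace R) : ℂ := ∫ ξ : ℝ, zeroExt (Y (-1)) ξ

/-- The radiation amplitude `∫ Y_0(x) e^{i k_0 x} dx`, which is `R(ε, μ, β)` when
`Y = (1 - ε T̂)⁻¹ g⁽²⁾`. -/
def radiation {R : ℝ} (μ β : ℝ) (Y : VecSpace R) : ℂ :=
  ∫ ξ : ℝ, zeroExt (Y 0) ξ * Complex.exp (Complex.I * (waveNumber μ β 0 : ℂ) * (ξ : ℂ))

/-- The system that determines the trapped mode: `ν = γ F` and `R = 0` at `μ = εν`. -/
def TrappingSystem {R : ℝ} (ε ν β : ℝ) (Y : VecSpace R) : Prop :=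
  (ν : ℂ) = (gam (ε * ν) β : ℂ) * averageF Y ∧ radiation (ε * ν) β Y = 0

/-- The `m`-th term `e^{i(β+m)y} (G_m * Y_m)(x)` of the mode. -/
def modeTerm {R : ℝ} (μ β : ℝ) (Y : VecSpace R) (p : ℝ × ℝ) (m : ℤ) : ℂ :=
  Complex.exp (Complex.I * ((β : ℂ) + (m : ℂ)) * (p.2 : ℂ)) * conv (green μ β m) (Y m) p.1

/-- `Ψ(x,y) = ∑_m e^{i(β+m)y} (G_m * Y_m)(x)`. -/
def mode {R : ℝ} (μ β : ℝ) (Y : VecSpace R) (p : ℝ × ℝ) : ℂ := ∑' m : ℤ, modeTerm μ β Y p m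

/-! ### The quasiperiodic Helmholtz problem in the strip -/

/-- The strip `Π = ℝ × (0, 2π)`. -/
def strip : Set (ℝ × ℝ) := Set.univ ×ˢ Set.Ioo (0 : ℝ) (2 * Real.pi)

/-- `∂u/∂x`. -/
def dx (u : ℝ × ℝ → ℂ) (p : ℝ × ℝ) : ℂ := deriv (fun t : ℝ => u (t, p.2)) p.1

/-- `∂u/∂y`. -/
def dy (u : ℝ × ℝ → ℂ) (p : ℝ × ℝ) : ℂ := deriv (fun t : ℝ => u (p.1, t)) p.2

/-- The quasiperiodic boundary conditions `u(x,2π) = e^{2πiβ} u(x,0)`,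
`u_y(x,2π) = e^{2πiβ} u_y(x,0)`. -/
def BoundaryCond (β : ℝ) (u : ℝ × ℝ → ℂ) : Prop :=
  ∀ x : ℝ,
    u (x, 2 * Real.pi) = Complex.exp (2 * (Real.pi : ℂ) * Complex.I * (β : ℂ)) * u (x, 0) ∧
    dy u (x, 2 * Real.pi) = Complex.exp (2 * (Real.pi : ℂ) * Complex.I * (β : ℂ)) * dy u (x, 0)

/-- Test functions: smooth up to the boundary of the strip, satisfying the boundary conditions,
and vanishing in the strip for large `|x|`. -/
structure IsTest (β : ℝ) (Φ : ℝ × ℝ → ℂ) : Prop where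
  smooth : ContDiff ℝ ∞ Φ
  boundary : BoundaryCond β Φ
  vanishes : ∃ M : ℝ, ∀ x y : ℝ, M < |x| → y ∈ Set.Icc (0 : ℝ) (2 * Real.pi) → Φ (x, y) = 0

/-- `u`, with gradient `(ux, uy)`, belongs to `H₁^β(Π)`, the completion of the test functions in
the norm `‖u‖_{L²(Π)} + ‖∇u‖_{L²(Π)}`. -/
structure MemEnergySpace (β : ℝ) (u ux uy : ℝ × ℝ → ℂ) : Prop where
  memLp : MemLp u 2 (volume.restrict strip)
  memLp_x : MemLp ux 2 (volume.restrict strip)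
  memLp_y : MemLp uy 2 (volume.restrict strip)
  approx : ∃ Φ : ℕ → ℝ × ℝ → ℂ, (∀ n, IsTest β (Φ n)) ∧
    Tendsto (fun n => eLpNorm (Φ n - u) 2 (volume.restrict strip)) atTop (𝓝 0) ∧
    Tendsto (fun n => eLpNorm (dx (Φ n) - ux) 2 (volume.restrict strip)) atTop (𝓝 0) ∧
    Tendsto (fun n => eLpNorm (dy (Φ n) - uy) 2 (volume.restrict strip)) atTop (𝓝 0)

/-- `Ψ` is a finite energy solution of `-ΔΨ = ω²(1 + εf)Ψ` in the strip with the quasiperiodic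
boundary conditions: it belongs to the energy space and satisfies the integral identity against
all test functions. Moreover `Ψ` is smooth and quasiperiodic in the whole plane and satisfies the
equation classically. -/
structure IsFiniteEnergySolution (f : ℝ × ℝ → ℝ) (ε ω2 β : ℝ) (Ψ : ℝ × ℝ → ℂ) : Prop where
  smooth : ContDiff ℝ ∞ Ψ
  quasiperiodic : ∀ x y : ℝ,
    Ψ (x, y + 2 * Real.pi) = Complex.exp (2 * (Real.pi : ℂ) * Complex.I * (β : ℂ)) * Ψ (x, y)
  boundary : BoundaryCond β Ψ
  helmholtz : ∀ p : ℝ × ℝ,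
    -(dx (dx Ψ) p + dy (dy Ψ) p) = (ω2 : ℂ) * (1 + (ε : ℂ) * (f p : ℂ)) * Ψ p
  energy : MemEnergySpace β Ψ (dx Ψ) (dy Ψ)
  weak : ∀ Φ : ℝ × ℝ → ℂ, IsTest β Φ →
    ∫ p in strip, (dx Ψ p * (starRingEnd ℂ) (dx Φ p) + dy Ψ p * (starRingEnd ℂ) (dy Φ p)) =
      (ω2 : ℂ) * ∫ p in strip, (1 + (ε : ℂ) * (f p : ℂ)) * Ψ p * (starRingEnd ℂ) (Φ p)

end

end RayleighBloch

namespace RayleighBloch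

noncomputable section

/-! Let `u_m` be the Fourier coefficients of the sought mode and `Y_m` those of `ω²εfΨ`. The
Helmholtz problem reads `u_m = G_m * Y_m` with `Y_m = 2γε ∑_n f_{m-n} (G_n * Y_n)`, since `2γ · 2π =
ω²`. Just below the second cut-off `G_{-1}` has the singular constant part `1/(2μ)`, which
contributes the rank-one term `(εγ/μ) (∫ Y_{-1}) f_{m+1}`. With `μ = εν` and the normalisation `ν =
γ ∫ Y_{-1}` this term is exactly `g⁽²⁾`, and what remains is the regular equation `(1 - εT̂)Y =
g⁽²⁾`. The mode decays once the propagating component `u_0` vanishes for `|x| > R`; by evenness in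
`x` the left and right amplitudes agree, so this is the single equation `R = 0`.

The obstacle is that `F` and `R` are complex while the unknowns `(β, ν)` are two real numbers.
Evenness removes it. Replace `G_0` by its real part `-sin(k_0|x|)/(2k_0)`. The reduced operator then
commutes with conjugation and with reflection in `x`, so its solution is real and even. The
discarded kernel `i cos(k_0(x-ξ))/(2k_0)` acts on an even vector through the integral `∫ cos(k_0 ξ)
Y_0`, which is the radiation amplitude. Hence on non-radiating even vectors the two operators
coincide (`kernelOp_full_eq`), and the trapping system is equivalent, near the bifurcation point, to
two real equations for the reduced solution (`reducedMap_eq_zero`, `exists_modeData`).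

These equations are analytic in `(ε, ν, β)` at `ε = 0`. To see this, the kernels for all `m` are
treated as one element of the Banach algebra `Kern` of bounded continuous functions on `ℤ × ℝ`, with
`|x|` truncated at `2R`; the wave numbers come from a quadratic equation in that algebra
(`exists_evanescentKern`, `exists_kernels`). At `ε = 0` the solution is `g⁽²⁾` itself, and the
system is `ν = γ(0,β) f̃_0(0)`, `f̃_1(√(1-2β)) = 0`. Its Jacobian is triangular and is invertible
because the zero of `f̃_1` is simple, so the implicit function theorem yields the branch and its
local uniqueness (`exists_reduced_branch`).

Conversely, a solution gives a mode. Convolution with `G_m` gains one power of `1 + |m|` and the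
`f_j` decay rapidly, so `Y_m` decays rapidly in `m`; the equation `u_m'' = k_m² u_m - Y_m` then
gives smoothness in `x`. All components except `m = 0` decay at least like `e^{-μ|x|}`, and `u_0`
has compact support. If the mode vanished, so would `Y_{-1}`, contradicting `ν = γ ∫ Y_{-1} > 0`. -/

theorem summable_inv_one_add_abs_sq : Summable fun n : ℤ => 1 / (1 + |(n : ℝ)|) ^ 2 := by
  have h : Summable fun n : ℤ => 1 / |(n : ℝ)| ^ (2 : ℕ) :=
    (Real.summable_one_div_int_pow (p := 2)).2 (by norm_num) |>.congr fun n => by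
      rw [sq_abs]
  refine h.of_norm_bounded_eventually ?_
  rw [Filter.eventually_cofinite]
  refine (Set.finite_singleton (0 : ℤ)).subset fun n hn => ?_
  by_contra h0
  apply hn
  have : 0 < |(n : ℝ)| := abs_pos.2 (by exact_mod_cast h0)
  rw [Real.norm_of_nonneg (by positivity)]
  gcongr
  linarith

/-! ### Smooth functions, periodic in `y` and supported in `|x| ≤ R` -/

/-- Smooth functions that are `2π`-periodic in `y` and vanish for `|x| > R`. -/
structure IsStripFunction (f : ℝ × ℝ → ℝ) (R : ℝ) : Prop where
  smooth : ContDiff ℝ ∞ f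
  periodic : ∀ x y : ℝ, f (x, y + 2 * Real.pi) = f (x, y)
  vanishes : ∀ x y : ℝ, R < |x| → f (x, y) = 0

theorem IsPerturbation.isStripFunction {f : ℝ × ℝ → ℝ} {R : ℝ} (hf : IsPerturbation f R) :
    IsStripFunction f R := ⟨hf.smooth, hf.periodic, hf.vanishes⟩

namespace IsStripFunction

variable {f : ℝ × ℝ → ℝ} {R : ℝ}

theorem exists_bound (hf : IsStripFunction f R) : ∃ C, 0 ≤ C ∧ ∀ p, |f p| ≤ C := by
  have hK : IsCompact (Icc (-R) R ×ˢ Icc (0 : ℝ) (2 * Real.pi)) := isCompact_Icc.prod isCompact_Icc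
  obtain ⟨C, hC⟩ := hK.exists_bound_of_continuousOn hf.smooth.continuous.continuousOn
  refine ⟨max C 0, le_max_right _ _, ?_⟩
  rintro ⟨x, y⟩
  by_cases hx : R < |x|
  · simp [hf.vanishes x y hx]
  have hper : Function.Periodic (fun y => f (x, y)) (2 * Real.pi) := fun y => hf.periodic x y
  obtain ⟨y', hy', h⟩ := hper.exists_mem_Ico₀ Real.two_pi_pos y
  have h' : f (x, y) = f (x, y') := h
  rw [h']
  refine le_max_of_le_left (hC (x, y') ⟨?_, hy'.1, hy'.2.le⟩)
  exact abs_le.1 (not_lt.1 hx)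

theorem partial_fst (hf : IsStripFunction f R) :
    IsStripFunction (fun p => fderiv ℝ f p (1, 0)) R where
  smooth := (hf.smooth.fderiv_right (by simp)).clm_apply contDiff_const
  periodic x y := by
    have h : (fun p : ℝ × ℝ => f (p + (0, 2 * Real.pi))) = f := by
      ext ⟨a, b⟩; simpa using hf.periodic a b
    have := fderiv_comp_add_right (𝕜 := ℝ) (f := f) (x := (x, y)) ((0 : ℝ), 2 * Real.pi)
    rw [h] at this
    simp [this]
  vanishes x y hx := by
    have : f =ᶠ[𝓝 (x, y)] fun _ => 0 := by
      have : ∀ᶠ p : ℝ × ℝ in 𝓝 (x, y), R < |p.1| :=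
        (continuous_abs.comp continuous_fst).continuousAt.eventually_const_lt hx
      filter_upwards [this] with p hp using hf.vanishes p.1 p.2 hp
    rw [this.fderiv_eq]; simp

theorem partial_snd (hf : IsStripFunction f R) :
    IsStripFunction (fun p => fderiv ℝ f p (0, 1)) R where
  smooth := (hf.smooth.fderiv_right (by simp)).clm_apply contDiff_const
  periodic x y := by
    have h : (fun p : ℝ × ℝ => f (p + (0, 2 * Real.pi))) = f := by
      ext ⟨a, b⟩; simpa using hf.periodic a b
    have := fderiv_comp_add_right (𝕜 := ℝ) (f := f) (x := (x, y)) ((0 : ℝ), 2 * Real.pi)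
    rw [h] at this
    simp [this]
  vanishes x y hx := by
    have : f =ᶠ[𝓝 (x, y)] fun _ => 0 := by
      have : ∀ᶠ p : ℝ × ℝ in 𝓝 (x, y), R < |p.1| :=
        (continuous_abs.comp continuous_fst).continuousAt.eventually_const_lt hx
      filter_upwards [this] with p hp using hf.vanishes p.1 p.2 hp
    rw [this.fderiv_eq]; simp

theorem hasDerivAt_fst (hf : IsStripFunction f R) (x y : ℝ) :
    HasDerivAt (fun t => f (t, y)) (fderiv ℝ f (x, y) (1, 0)) x := by
  have h : HasFDerivAt f (fderiv ℝ f (x, y)) (x, y) :=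
    (hf.smooth.differentiable (by simp) _).hasFDerivAt
  exact h.comp_hasDerivAt x ((hasDerivAt_id x).prodMk (hasDerivAt_const x y))

theorem hasDerivAt_snd (hf : IsStripFunction f R) (x y : ℝ) :
    HasDerivAt (fun t => f (x, t)) (fderiv ℝ f (x, y) (0, 1)) y := by
  have h : HasFDerivAt f (fderiv ℝ f (x, y)) (x, y) :=
    (hf.smooth.differentiable (by simp) _).hasFDerivAt
  exact h.comp_hasDerivAt y ((hasDerivAt_const y x).prodMk (hasDerivAt_id y))

theorem continuous_integrand (hf : IsStripFunction f R) (j : ℤ) :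
    Continuous fun p : ℝ × ℝ => Complex.exp (-(Complex.I * (j : ℂ) * (p.2 : ℂ))) * (f p : ℂ) := by
  have := hf.smooth.continuous
  fun_prop

theorem norm_fourierPhase (j : ℤ) (y : ℝ) :
    ‖Complex.exp (-(Complex.I * (j : ℂ) * (y : ℂ)))‖ = 1 := by
  rw [Complex.norm_exp]; simp

theorem norm_fourierCoef_le {C : ℝ} (hC : ∀ p, |f p| ≤ C) (j : ℤ) (x : ℝ) :
    ‖fourierCoef f j x‖ ≤ C * (2 * Real.pi) := by
  have := intervalIntegral.norm_integral_le_of_norm_le_const (a := 0) (b := 2 * Real.pi) (C := C)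
    (f := fun y => Complex.exp (-(Complex.I * (j : ℂ) * (y : ℂ))) * (f (x, y) : ℂ))
    (fun y _ => by rw [norm_mul, norm_fourierPhase, one_mul]; simpa using hC (x, y))
  simpa [fourierCoef, abs_of_pos Real.pi_pos] using this

theorem hasDerivAt_fourierCoef (hf : IsStripFunction f R) (j : ℤ) (x : ℝ) :
    HasDerivAt (fourierCoef f j) (fourierCoef (fun p => fderiv ℝ f p (1, 0)) j x) x := by
  obtain ⟨C, hC0, hC⟩ := hf.partial_fst.exists_bound
  have key := intervalIntegral.hasDerivAt_integral_of_dominated_loc_of_deriv_le (μ := volume)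
    (a := 0) (b := 2 * Real.pi) (s := univ) (x₀ := x) (bound := fun _ => C) (𝕜 := ℝ)
    (F := fun x y => Complex.exp (-(Complex.I * (j : ℂ) * (y : ℂ))) * (f (x, y) : ℂ))
    (F' := fun x y => Complex.exp (-(Complex.I * (j : ℂ) * (y : ℂ))) *
      ((fderiv ℝ f (x, y) (1, 0) : ℝ) : ℂ)) univ_mem
    (.of_forall fun x => ((hf.continuous_integrand j).comp
      (Continuous.prodMk_right x)).aestronglyMeasurable)
    (((hf.continuous_integrand j).comp (Continuous.prodMk_right x)).intervalIntegrable _ _)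
    ((hf.partial_fst.continuous_integrand j).comp
      (Continuous.prodMk_right x)).aestronglyMeasurable
    (.of_forall fun y _ x _ => by
      rw [norm_mul, norm_fourierPhase, one_mul]; simpa using hC (x, y))
    (by simp) (.of_forall fun y _ x _ => ((hf.hasDerivAt_fst x y).ofReal_comp).const_mul _)
  exact key.2

/-- Integration by parts in `y`; the boundary terms cancel by periodicity. This is the source of all
decay in the index. -/
theorem fourierCoef_partial_snd (hf : IsStripFunction f R) (j : ℤ) (x : ℝ) :
    fourierCoef (fun p => fderiv ℝ f p (0, 1)) j x =
      Complex.I * (j : ℂ) * fourierCoef f j x := by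
  have hu : ∀ y : ℝ, HasDerivAt (fun y : ℝ => Complex.exp (-(Complex.I * (j : ℂ) * (y : ℂ))))
      (Complex.exp (-(Complex.I * (j : ℂ) * (y : ℂ))) * -(Complex.I * (j : ℂ))) y := by
    intro y
    have h : HasDerivAt (fun z : ℂ => Complex.exp (-(Complex.I * (j : ℂ) * z)))
        (Complex.exp (-(Complex.I * (j : ℂ) * y)) * -(Complex.I * (j : ℂ))) y := by
      have := (((hasDerivAt_id (y : ℂ)).const_mul (Complex.I * (j : ℂ))).neg).cexp
      simpa using this
    exact h.comp_ofReal
  have hcont := (hf.partial_snd.smooth.continuous.comp (Continuous.prodMk_right x))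
  have key := intervalIntegral.integral_mul_deriv_eq_deriv_mul (a := 0) (b := 2 * Real.pi)
    (u := fun y : ℝ => Complex.exp (-(Complex.I * (j : ℂ) * (y : ℂ))))
    (v := fun y : ℝ => (f (x, y) : ℂ)) (fun y _ => hu y)
    (fun y _ => (hf.hasDerivAt_snd x y).ofReal_comp)
    (Continuous.intervalIntegrable (by fun_prop) _ _)
    (Continuous.intervalIntegrable (Complex.continuous_ofReal.comp hcont) _ _)
  have hper : Complex.exp (-(Complex.I * (j : ℂ) * ((2 * Real.pi : ℝ) : ℂ))) = 1 := by
    rw [Complex.exp_eq_one_iff]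
    exact ⟨-j, by push_cast; ring⟩
  have h0 : f (x, 2 * Real.pi) = f (x, 0) := by simpa using hf.periodic x 0
  rw [hper, h0] at key
  simp only [Complex.ofReal_zero, mul_zero, neg_zero, Complex.exp_zero, one_mul, sub_self,
    zero_sub] at key
  unfold fourierCoef
  refine key.trans ?_
  rw [← intervalIntegral.integral_neg, ← intervalIntegral.integral_const_mul]
  congr 1; ext y; ring

/-- Each power of `|j|` is traded for one derivative in `y`. The induction runs over all strip
functions at once because `∂f/∂y` is again one. -/
theorem rapid_fourierCoef (N : ℕ) : ∀ {f : ℝ × ℝ → ℝ}, IsStripFunction f R →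
    ∃ C, ∀ (j : ℤ) (x : ℝ), (1 + |(j : ℝ)|) ^ N * ‖fourierCoef f j x‖ ≤ C := by
  induction N with
  | zero =>
    intro f hf
    obtain ⟨C, -, hC⟩ := hf.exists_bound
    exact ⟨C * (2 * Real.pi), fun j x => by simpa using norm_fourierCoef_le hC j x⟩
  | succ N ih =>
    intro f hf
    obtain ⟨C₁, h₁⟩ := ih hf
    obtain ⟨C₂, h₂⟩ := ih hf.partial_snd
    refine ⟨C₁ + C₂, fun j x => ?_⟩
    have h₂' := h₂ j x
    rw [hf.fourierCoef_partial_snd, norm_mul, norm_mul, Complex.norm_I, one_mul,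
      Complex.norm_intCast] at h₂'
    calc _ = (1 + |(j : ℝ)|) ^ N * ‖fourierCoef f j x‖ +
        (1 + |(j : ℝ)|) ^ N * (|(j : ℝ)| * ‖fourierCoef f j x‖) := by ring
      _ ≤ _ := add_le_add (h₁ j x) h₂'

theorem fourierCoef_eq_zero (hf : IsStripFunction f R) {x : ℝ} (hx : R ≤ |x|) (j : ℤ) :
    fourierCoef f j x = 0 := by
  have h0 : ∀ x : ℝ, R < |x| → fourierCoef f j x = 0 := fun x hx => by
    simp [fourierCoef, hf.vanishes x _ hx]
  have hc : Continuous (fourierCoef f j) :=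
    continuous_iff_continuousAt.2 fun x => (hf.hasDerivAt_fourierCoef j x).continuousAt
  rcases le_total 0 x with h | h
  · have hcl : closure (Ioi x) ⊆ {t | fourierCoef f j t = 0} := by
      refine closure_minimal (fun t ht => h0 t ?_) (isClosed_eq hc continuous_const)
      have ht : x < t := ht
      rw [abs_of_nonneg h] at hx
      rw [abs_of_pos (h.trans_lt ht)]; linarith
    exact hcl (by simp)
  · have hcl : closure (Iio x) ⊆ {t | fourierCoef f j t = 0} := by
      refine closure_minimal (fun t ht => h0 t ?_) (isClosed_eq hc continuous_const)
      have ht : t < x := ht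
      rw [abs_of_nonpos h] at hx
      rw [abs_of_neg (ht.trans_le h)]; linarith
    exact hcl (by simp)

/-- The slice of `f` at fixed `x` is lifted to the circle; quadratic decay of its coefficients gives
absolute, hence pointwise, convergence. The factor `2π` reflects the unnormalised coefficients. -/
theorem hasSum_fourierCoef (hf : IsStripFunction f R) (x y : ℝ) :
    HasSum (fun j : ℤ => fourierCoef f j x * Complex.exp (Complex.I * (j : ℂ) * (y : ℂ)))
      (2 * Real.pi * (f (x, y) : ℂ)) := by
  have : Fact (0 < 2 * Real.pi) := ⟨Real.two_pi_pos⟩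
  have hper : Function.Periodic (fun y => (f (x, y) : ℂ)) (2 * Real.pi) :=
    fun y => by simp [hf.periodic x y]
  have hc : Continuous (fun y => (f (x, y) : ℂ)) :=
    Complex.continuous_ofReal.comp (hf.smooth.continuous.comp (Continuous.prodMk_right x))
  let F : C(AddCircle (2 * Real.pi), ℂ) := ⟨hper.lift, continuous_coinduced_dom.2 hc⟩
  have hF : ∀ j : ℤ, fourierCoeff F j = (1 / (2 * Real.pi) : ℂ) * fourierCoef f j x := by
    intro j
    rw [fourierCoeff_eq_intervalIntegral _ _ 0, fourierCoef, zero_add, Complex.real_smul]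
    congr 1
    · push_cast; rfl
    · refine intervalIntegral.integral_congr fun t _ => ?_
      simp only [smul_eq_mul]
      congr 1
      rw [fourier_coe_apply]
      congr 1
      push_cast
      field_simp
  obtain ⟨C, hC⟩ := rapid_fourierCoef 2 hf
  have hsum : Summable (fourierCoeff F) := by
    refine Summable.of_norm_bounded (g := fun j : ℤ => (|1 / (2 * Real.pi)| * C) *
      (1 / (1 + |(j : ℝ)|) ^ 2)) (summable_inv_one_add_abs_sq.mul_left _) fun j => ?_
    rw [hF, norm_mul, mul_assoc]
    have h1 : ‖(1 / (2 * Real.pi) : ℂ)‖ = |1 / (2 * Real.pi)| := by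
      rw [← Real.norm_eq_abs, ← Complex.norm_real]; push_cast; rfl
    rw [h1]
    gcongr
    rw [mul_one_div, le_div_iff₀ (by positivity), mul_comm]
    exact hC j x
  have := has_pointwise_sum_fourier_series_of_summable hsum (y : AddCircle (2 * Real.pi))
  have h2 := this.mul_left (2 * Real.pi : ℂ)
  have hpi : (Real.pi : ℂ) ≠ 0 := by exact_mod_cast Real.pi_ne_zero
  convert! h2 using 1
  ext j
  rw [hF, fourier_coe_apply, smul_eq_mul]
  have : (2 * Real.pi * Complex.I * j * y / ((2 * Real.pi : ℝ) : ℂ)) =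
      Complex.I * (j : ℂ) * (y : ℂ) := by
    push_cast; field_simp
  rw [this]; field_simp

end IsStripFunction

end

end RayleighBloch

namespace RayleighBloch

noncomputable section

/-! ### Rapidly decreasing families of functions on the line -/

/-- Families decaying faster than any power of the index, with the weight `e^{-c|x|}`. -/
def RapidFam (c : ℝ) (a : ℤ → ℝ → ℂ) : Prop :=
  ∀ N : ℕ, ∃ C, 0 ≤ C ∧ ∀ (m : ℤ) (x : ℝ),
    (1 + |(m : ℝ)|) ^ N * ‖a m x‖ ≤ C * Real.exp (-(c * |x|))

/-- Families whose derivatives up to the given order are rapidly decreasing. -/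
def SmoothFam (c : ℝ) : ℕ → (ℤ → ℝ → ℂ) → Prop
  | 0, a => RapidFam c a ∧ ∀ m, Continuous (a m)
  | j + 1, a => RapidFam c a ∧ (∀ m, Differentiable ℝ (a m)) ∧
      SmoothFam c j fun m => deriv (a m)

/-- The convolution `∑_n φ_{m-n} a_n` in the index. -/
def indexConv (φ a : ℤ → ℝ → ℂ) (m : ℤ) (x : ℝ) : ℂ := ∑' n : ℤ, φ (m - n) x * a n x

/-- Submultiplicativity of the weight `1 + |m|` lets convolution in the index preserve polynomial
decay of every order. -/
theorem one_add_abs_le_mul (m n : ℤ) :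
    1 + |(m : ℝ)| ≤ (1 + |((m - n : ℤ) : ℝ)|) * (1 + |(n : ℝ)|) := by
  have h : |(m : ℝ)| ≤ |((m - n : ℤ) : ℝ)| + |(n : ℝ)| := by
    have := abs_add_le ((m - n : ℤ) : ℝ) (n : ℝ)
    simpa using this
  nlinarith [abs_nonneg ((m - n : ℤ) : ℝ), abs_nonneg (n : ℝ),
    mul_nonneg (abs_nonneg ((m - n : ℤ) : ℝ)) (abs_nonneg (n : ℝ))]

namespace RapidFam

variable {c : ℝ} {a b φ : ℤ → ℝ → ℂ}

theorem norm_le (ha : RapidFam c a) (N : ℕ) : ∃ C, 0 ≤ C ∧ ∀ (m : ℤ) (x : ℝ),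
    ‖a m x‖ ≤ C * Real.exp (-(c * |x|)) * (1 / (1 + |(m : ℝ)|) ^ N) := by
  obtain ⟨C, hC0, hC⟩ := ha N
  refine ⟨C, hC0, fun m x => ?_⟩
  rw [mul_one_div, le_div_iff₀ (by positivity), mul_comm]
  exact hC m x

theorem norm_le_summable (ha : RapidFam c a) (hc : 0 ≤ c) : ∃ C, 0 ≤ C ∧ ∀ (m : ℤ) (x : ℝ),
    ‖a m x‖ ≤ C * (1 / (1 + |(m : ℝ)|) ^ 2) := by
  obtain ⟨C, hC0, hC⟩ := ha.norm_le 2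
  refine ⟨C, hC0, fun m x => (hC m x).trans ?_⟩
  gcongr
  refine mul_le_of_le_one_right hC0 (Real.exp_le_one_iff.2 ?_)
  have := mul_nonneg hc (abs_nonneg x)
  linarith

theorem add (ha : RapidFam c a) (hb : RapidFam c b) : RapidFam c fun m x => a m x + b m x := by
  intro N
  obtain ⟨C, hC0, hC⟩ := ha N
  obtain ⟨D, hD0, hD⟩ := hb N
  refine ⟨C + D, add_nonneg hC0 hD0, fun m x => ?_⟩
  calc _ ≤ (1 + |(m : ℝ)|) ^ N * (‖a m x‖ + ‖b m x‖) := by gcongr; exact norm_add_le _ _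
    _ ≤ _ := by rw [mul_add, add_mul]; exact add_le_add (hC m x) (hD m x)

theorem mul_poly (ha : RapidFam c a) {σ : ℤ → ℂ} {K : ℝ} {d : ℕ}
    (hσ : ∀ m, ‖σ m‖ ≤ K * (1 + |(m : ℝ)|) ^ d) : RapidFam c fun m x => σ m * a m x := by
  intro N
  obtain ⟨C, hC0, hC⟩ := ha (N + d)
  refine ⟨|K| * C, by positivity, fun m x => ?_⟩
  calc _ ≤ (1 + |(m : ℝ)|) ^ N * (|K| * (1 + |(m : ℝ)|) ^ d * ‖a m x‖) := by
        rw [norm_mul]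
        gcongr
        exact (hσ m).trans (by gcongr; exact le_abs_self K)
    _ = |K| * ((1 + |(m : ℝ)|) ^ (N + d) * ‖a m x‖) := by ring
    _ ≤ |K| * (C * Real.exp (-(c * |x|))) := mul_le_mul_of_nonneg_left (hC m x) (abs_nonneg K)
    _ = _ := by ring

theorem exists_bound_indexConv_term (hφ : RapidFam 0 φ) (ha : RapidFam c a) (N : ℕ) :
    ∃ C, 0 ≤ C ∧ ∀ (m n : ℤ) (x : ℝ), (1 + |(m : ℝ)|) ^ N * ‖φ (m - n) x * a n x‖ ≤
      C * Real.exp (-(c * |x|)) * (1 / (1 + |(n : ℝ)|) ^ 2) := by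
  obtain ⟨C, hC0, hC⟩ := hφ N
  -- `N` powers pay for the weight in `m`; the two extra ones make the sum over `n` converge.
  obtain ⟨D, hD0, hD⟩ := ha (N + 2)
  refine ⟨C * D, by positivity, fun m n x => ?_⟩
  have h1 : (1 + |((m - n : ℤ) : ℝ)|) ^ N * ‖φ (m - n) x‖ ≤ C := by simpa using hC (m - n) x
  have h2 : (1 + |(n : ℝ)|) ^ N * ‖a n x‖ ≤
      D * Real.exp (-(c * |x|)) * (1 / (1 + |(n : ℝ)|) ^ 2) := by
    rw [mul_one_div, le_div_iff₀ (by positivity)]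
    have := hD n x
    rw [pow_add] at this
    linarith
  calc _ ≤ ((1 + |((m - n : ℤ) : ℝ)|) * (1 + |(n : ℝ)|)) ^ N * ‖φ (m - n) x * a n x‖ := by
        gcongr; exact one_add_abs_le_mul m n
    _ = ((1 + |((m - n : ℤ) : ℝ)|) ^ N * ‖φ (m - n) x‖) * ((1 + |(n : ℝ)|) ^ N * ‖a n x‖) := by
        rw [norm_mul, mul_pow]; ring
    _ ≤ C * (D * Real.exp (-(c * |x|)) * (1 / (1 + |(n : ℝ)|) ^ 2)) := by gcongr
    _ = _ := by ring

theorem summable_norm_indexConv (hφ : RapidFam 0 φ) (ha : RapidFam c a) (m : ℤ) (x : ℝ) :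
    Summable fun n => ‖φ (m - n) x * a n x‖ := by
  obtain ⟨C, hC0, hC⟩ := exists_bound_indexConv_term hφ ha 0
  refine Summable.of_nonneg_of_le (fun _ => norm_nonneg _) (fun n => ?_)
    (summable_inv_one_add_abs_sq.mul_left (C * Real.exp (-(c * |x|))))
  simpa using hC m n x

theorem indexConv (hφ : RapidFam 0 φ) (ha : RapidFam c a) : RapidFam c (indexConv φ a) := by
  intro N
  obtain ⟨C, hC0, hC⟩ := exists_bound_indexConv_term hφ ha N
  have hS : 0 ≤ ∑' n : ℤ, 1 / (1 + |(n : ℝ)|) ^ 2 := tsum_nonneg fun n => by positivity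
  refine ⟨C * ∑' n : ℤ, 1 / (1 + |(n : ℝ)|) ^ 2, by positivity, fun m x => ?_⟩
  have hs := summable_norm_indexConv hφ ha m x
  calc _ ≤ (1 + |(m : ℝ)|) ^ N * ∑' n, ‖φ (m - n) x * a n x‖ := by
        gcongr; exact norm_tsum_le_tsum_norm hs
    _ = ∑' n, (1 + |(m : ℝ)|) ^ N * ‖φ (m - n) x * a n x‖ := tsum_mul_left.symm
    _ ≤ ∑' n : ℤ, C * Real.exp (-(c * |x|)) * (1 / (1 + |(n : ℝ)|) ^ 2) :=
        (hs.mul_left _).tsum_le_tsum (fun n => hC m n x)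
          (summable_inv_one_add_abs_sq.mul_left _)
    _ = _ := by rw [tsum_mul_left]; ring

end RapidFam

namespace SmoothFam

variable {c : ℝ} {a b φ : ℤ → ℝ → ℂ} {j : ℕ}

theorem rapid (ha : SmoothFam c j a) : RapidFam c a := by
  cases j <;> exact ha.1

theorem of_succ (ha : SmoothFam c (j + 1) a) : SmoothFam c j a := by
  induction j generalizing a with
  | zero => exact ⟨ha.1, fun m => (ha.2.1 m).continuous⟩
  | succ j ih => exact ⟨ha.1, ha.2.1, ih ha.2.2⟩

theorem mk_succ {a' : ℤ → ℝ → ℂ} (ha : RapidFam c a) (h : ∀ m x, HasDerivAt (a m) (a' m x) x)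
    (ha' : SmoothFam c j a') : SmoothFam c (j + 1) a := by
  refine ⟨ha, fun m x => (h m x).differentiableAt, ?_⟩
  have : (fun m => deriv (a m)) = a' := by ext m x; exact (h m x).deriv
  rwa [this]

theorem add (ha : SmoothFam c j a) (hb : SmoothFam c j b) :
    SmoothFam c j fun m x => a m x + b m x := by
  induction j generalizing a b with
  | zero => exact ⟨ha.1.add hb.1, fun m => (ha.2 m).add (hb.2 m)⟩
  | succ j ih =>
    exact mk_succ (ha.1.add hb.1)
      (fun m x => (ha.2.1 m x).hasDerivAt.add (hb.2.1 m x).hasDerivAt) (ih ha.2.2 hb.2.2)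

theorem mul_poly (ha : SmoothFam c j a) {σ : ℤ → ℂ} {K : ℝ} {d : ℕ}
    (hσ : ∀ m, ‖σ m‖ ≤ K * (1 + |(m : ℝ)|) ^ d) : SmoothFam c j fun m x => σ m * a m x := by
  induction j generalizing a with
  | zero => exact ⟨ha.1.mul_poly hσ, fun m => continuous_const.mul (ha.2 m)⟩
  | succ j ih =>
    exact mk_succ (ha.1.mul_poly hσ) (fun m x => (ha.2.1 m x).hasDerivAt.const_mul _) (ih ha.2.2)

theorem const_mul (ha : SmoothFam c j a) (z : ℂ) : SmoothFam c j fun m x => z * a m x :=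
  ha.mul_poly (σ := fun _ => z) (K := ‖z‖) (d := 0) (by simp)

/-- Termwise product rule: the derivative is the sum of two index convolutions, each with one factor
differentiated, so the induction on the order treats both families together. -/
theorem indexConv (hc : 0 ≤ c) (hφ : SmoothFam 0 j φ) (ha : SmoothFam c j a) :
    SmoothFam c j (indexConv φ a) := by
  have hsum : ∀ m x, Summable fun n => φ (m - n) x * a n x := fun m x =>
    (RapidFam.summable_norm_indexConv hφ.rapid ha.rapid m x).of_norm
  have hexp : ∀ x : ℝ, Real.exp (-(c * |x|)) ≤ 1 := fun x => by
    have := mul_nonneg hc (abs_nonneg x)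
    exact Real.exp_le_one_iff.2 (by linarith)
  have bound : ∀ {φ a : ℤ → ℝ → ℂ}, RapidFam 0 φ → RapidFam c a → ∃ C, ∀ (m n : ℤ) (x : ℝ),
      ‖φ (m - n) x * a n x‖ ≤ C * (1 / (1 + |(n : ℝ)|) ^ 2) := by
    intro φ a hφ ha
    obtain ⟨C, hC0, hC⟩ := RapidFam.exists_bound_indexConv_term hφ ha 0
    refine ⟨C, fun m n x => ?_⟩
    have := hC m n x
    simp only [pow_zero, one_mul] at this
    refine this.trans ?_
    gcongr
    exact mul_le_of_le_one_right hC0 (hexp x)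
  induction j generalizing a φ with
  | zero =>
    refine ⟨hφ.1.indexConv ha.1, fun m => ?_⟩
    obtain ⟨C, hC⟩ := bound hφ.1 ha.1
    exact continuous_tsum (fun n => (hφ.2 _).mul (ha.2 n))
      (summable_inv_one_add_abs_sq.mul_left C) (fun n x => hC m n x)
  | succ j ih =>
    have h1 := ih hφ.2.2 ha.of_succ fun m x =>
      (RapidFam.summable_norm_indexConv hφ.2.2.rapid ha.rapid m x).of_norm
    have h2 := ih hφ.of_succ ha.2.2 fun m x =>
      (RapidFam.summable_norm_indexConv hφ.rapid ha.2.2.rapid m x).of_norm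
    refine mk_succ (hφ.1.indexConv ha.1) (fun m x => ?_) (h1.add h2)
    obtain ⟨C, hC⟩ := bound hφ.2.2.rapid ha.1
    obtain ⟨D, hD⟩ := bound hφ.1 ha.2.2.rapid
    have key := hasDerivAt_tsum (g := fun n x => φ (m - n) x * a n x)
      (g' := fun n x => deriv (φ (m - n)) x * a n x + φ (m - n) x * deriv (a n) x)
      ((summable_inv_one_add_abs_sq.mul_left C).add (summable_inv_one_add_abs_sq.mul_left D))
      (fun n x => (hφ.2.1 _ x).hasDerivAt.mul (ha.2.1 n x).hasDerivAt)
      (fun n x => (norm_add_le _ _).trans (add_le_add (hC m n x) (hD m n x)))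
      (hsum m 0) x
    refine key.congr_deriv ?_
    exact ((RapidFam.summable_norm_indexConv hφ.2.2.rapid ha.1 m x).of_norm).tsum_add
      (RapidFam.summable_norm_indexConv hφ.1 ha.2.2.rapid m x).of_norm

end SmoothFam

theorem IsStripFunction.smoothFam_fourierCoef {R : ℝ} (j : ℕ) :
    ∀ {f : ℝ × ℝ → ℝ}, IsStripFunction f R → SmoothFam 0 j (fourierCoef f) := by
  have hr : ∀ {f : ℝ × ℝ → ℝ}, IsStripFunction f R → RapidFam 0 (fourierCoef f) := by
    intro f hf N
    obtain ⟨C, hC⟩ := hf.rapid_fourierCoef N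
    exact ⟨C, le_trans (by positivity) (hC 0 0), fun m x => by simpa using hC m x⟩
  induction j with
  | zero =>
    intro f hf
    exact ⟨hr hf, fun m =>
      continuous_iff_continuousAt.2 fun x => (hf.hasDerivAt_fourierCoef m x).continuousAt⟩
  | succ j ih =>
    intro f hf
    exact SmoothFam.mk_succ (hr hf) hf.hasDerivAt_fourierCoef (ih hf.partial_fst)

/-! ### Synthesis of a function in the strip from its Fourier coefficients -/

/-- `∑_m e^{i(β+m)y} u_m(x)`. -/
def synthesis (β : ℝ) (u : ℤ → ℝ → ℂ) (p : ℝ × ℝ) : ℂ :=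
  ∑' m : ℤ, Complex.exp (Complex.I * ((β : ℂ) + (m : ℂ)) * (p.2 : ℂ)) * u m p.1

section Synthesis

variable {c β : ℝ} {u v : ℤ → ℝ → ℂ}

theorem norm_quasiPhase (β : ℝ) (m : ℤ) (y : ℝ) :
    ‖Complex.exp (Complex.I * ((β : ℂ) + (m : ℂ)) * (y : ℂ))‖ = 1 := by
  rw [Complex.norm_exp]; simp

theorem summable_norm_synthesis (hc : 0 ≤ c) (hu : RapidFam c u) (p : ℝ × ℝ) :
    Summable fun m : ℤ => ‖Complex.exp (Complex.I * ((β : ℂ) + (m : ℂ)) * (p.2 : ℂ)) * u m p.1‖ := by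
  obtain ⟨C, -, hC⟩ := hu.norm_le_summable hc
  refine Summable.of_nonneg_of_le (fun _ => norm_nonneg _) (fun m => ?_)
    (summable_inv_one_add_abs_sq.mul_left C)
  rw [norm_mul, norm_quasiPhase, one_mul]
  exact hC m p.1

theorem exists_norm_synthesis_le (hu : RapidFam c u) :
    ∃ C, 0 ≤ C ∧ ∀ p, ‖synthesis β u p‖ ≤ C * Real.exp (-(c * |p.1|)) := by
  obtain ⟨C, hC0, hC⟩ := hu.norm_le 2
  have hS : 0 ≤ ∑' n : ℤ, 1 / (1 + |(n : ℝ)|) ^ 2 := tsum_nonneg fun n => by positivity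
  refine ⟨C * ∑' n : ℤ, 1 / (1 + |(n : ℝ)|) ^ 2, by positivity, fun p => ?_⟩
  have hb : ∀ m : ℤ, ‖Complex.exp (Complex.I * ((β : ℂ) + (m : ℂ)) * (p.2 : ℂ)) * u m p.1‖ ≤
      C * Real.exp (-(c * |p.1|)) * (1 / (1 + |(m : ℝ)|) ^ 2) := fun m => by
    rw [norm_mul, norm_quasiPhase, one_mul]; exact hC m p.1
  have := tsum_of_norm_bounded
    ((summable_inv_one_add_abs_sq.mul_left (C * Real.exp (-(c * |p.1|)))).hasSum) hb
  rw [tsum_mul_left] at this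
  exact this.trans_eq (by ring)

theorem norm_quasiWave_le (β : ℝ) (m : ℤ) :
    ‖Complex.I * ((β : ℂ) + (m : ℂ))‖ ≤ (1 + |β|) * (1 + |(m : ℝ)|) ^ 1 := by
  rw [norm_mul, Complex.norm_I, one_mul]
  refine (norm_add_le _ _).trans ?_
  rw [Complex.norm_real, Complex.norm_intCast, Real.norm_eq_abs]
  nlinarith [abs_nonneg β, abs_nonneg (m : ℝ), mul_nonneg (abs_nonneg β) (abs_nonneg (m : ℝ))]

/-- Termwise differentiation. A `y`-derivative multiplies the `m`-th term by `i(β+m)`, which costs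
one power of the index and is absorbed by rapid decay. -/
theorem hasFDerivAt_synthesis (hc : 0 ≤ c) (hu : SmoothFam c 1 u) (p : ℝ × ℝ) :
    HasFDerivAt (synthesis β u)
      ((ContinuousLinearMap.fst ℝ ℝ ℝ).smulRight (synthesis β (fun m => deriv (u m)) p) +
        (ContinuousLinearMap.snd ℝ ℝ ℝ).smulRight
          (synthesis β (fun m x => Complex.I * ((β : ℂ) + (m : ℂ)) * u m x) p)) p := by
  obtain ⟨C, hC0, hC⟩ := hu.2.2.rapid.norm_le_summable hc
  have hr2 : RapidFam c (fun m x => Complex.I * ((β : ℂ) + (m : ℂ)) * u m x) :=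
    hu.1.mul_poly (norm_quasiWave_le β)
  obtain ⟨D, hD0, hD⟩ := hr2.norm_le_summable hc
  set e : ℤ → ℝ → ℂ := fun m y => Complex.exp (Complex.I * ((β : ℂ) + (m : ℂ)) * (y : ℂ)) with he
  have hen : ∀ m y, ‖e m y‖ = 1 := norm_quasiPhase β
  have hed : ∀ m y, HasDerivAt (e m) (e m y * (Complex.I * ((β : ℂ) + (m : ℂ)))) y := by
    intro m y
    have h : HasDerivAt (fun z : ℂ => Complex.exp (Complex.I * ((β : ℂ) + (m : ℂ)) * z))
        (e m y * (Complex.I * ((β : ℂ) + (m : ℂ)))) y := by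
      simpa using ((hasDerivAt_id (y : ℂ)).const_mul (Complex.I * ((β : ℂ) + (m : ℂ)))).cexp
    exact h.comp_ofReal
  let g' : ℤ → ℝ × ℝ → ℝ × ℝ →L[ℝ] ℂ := fun m p =>
    (ContinuousLinearMap.fst ℝ ℝ ℝ).smulRight (e m p.2 * deriv (u m) p.1) +
      (ContinuousLinearMap.snd ℝ ℝ ℝ).smulRight
        (e m p.2 * (Complex.I * ((β : ℂ) + (m : ℂ)) * u m p.1))
  have hg : ∀ m p, HasFDerivAt (fun p : ℝ × ℝ => e m p.2 * u m p.1) (g' m p) p := by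
    intro m p
    have h1 : HasFDerivAt (fun p : ℝ × ℝ => e m p.2) _ p :=
      (hed m p.2).hasFDerivAt.comp p hasFDerivAt_snd
    have h2 : HasFDerivAt (fun p : ℝ × ℝ => u m p.1) _ p :=
      (hu.2.1 m p.1).hasDerivAt.hasFDerivAt.comp p hasFDerivAt_fst
    refine (h1.mul h2).congr_fderiv ?_
    ext
    · simp [g']
    · simp [g']; ring
  have hg' : ∀ m p, ‖g' m p‖ ≤ C * (1 / (1 + |(m : ℝ)|) ^ 2) + D * (1 / (1 + |(m : ℝ)|) ^ 2) := by
    intro m p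
    refine (norm_add_le _ _).trans (add_le_add ?_ ?_)
    · rw [ContinuousLinearMap.norm_smulRight_apply, norm_mul, hen, one_mul]
      exact (mul_le_of_le_one_left (norm_nonneg _) (ContinuousLinearMap.norm_fst_le ..)).trans
        (hC m p.1)
    · rw [ContinuousLinearMap.norm_smulRight_apply, norm_mul, hen, one_mul]
      exact (mul_le_of_le_one_left (norm_nonneg _) (ContinuousLinearMap.norm_snd_le ..)).trans
        (hD m p.1)
  have hs1 := (summable_norm_synthesis (β := β) hc hu.2.2.rapid p).of_norm
  have hs2 := (summable_norm_synthesis (β := β) hc hr2 p).of_norm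
  have key := hasFDerivAt_tsum (((summable_inv_one_add_abs_sq.mul_left C).add
    (summable_inv_one_add_abs_sq.mul_left D))) hg hg'
    (summable_norm_synthesis (β := β) hc hu.1 0).of_norm p
  refine key.congr_fderiv ?_
  have hsum : HasSum (fun m => g' m p)
      ((ContinuousLinearMap.fst ℝ ℝ ℝ).smulRight (synthesis β (fun m => deriv (u m)) p) +
        (ContinuousLinearMap.snd ℝ ℝ ℝ).smulRight
          (synthesis β (fun m x => Complex.I * ((β : ℂ) + (m : ℂ)) * u m x) p)) := by
    refine HasSum.add ?_ ?_
    · exact ((ContinuousLinearMap.smulRightL ℝ (ℝ × ℝ) ℂ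
        (ContinuousLinearMap.fst ℝ ℝ ℝ)).hasSum hs1.hasSum)
    · exact ((ContinuousLinearMap.smulRightL ℝ (ℝ × ℝ) ℂ
        (ContinuousLinearMap.snd ℝ ℝ ℝ)).hasSum hs2.hasSum)
  exact hsum.tsum_eq

/-- One more order is assumed than obtained, because in the base case continuity is read off from
differentiability. -/
theorem contDiff_synthesis (hc : 0 ≤ c) (n : ℕ) :
    ∀ {u : ℤ → ℝ → ℂ}, SmoothFam c (n + 1) u → ContDiff ℝ n (synthesis β u) := by
  induction n with
  | zero =>
    intro u hu
    refine contDiff_zero.2 (continuous_iff_continuousAt.2 fun p => ?_)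
    exact (hasFDerivAt_synthesis hc hu p).continuousAt
  | succ n ih =>
    intro u hu
    have h1 : SmoothFam c 1 u := by
      clear ih
      induction n with
      | zero => exact hu.of_succ
      | succ n ih => exact ih hu.of_succ
    refine contDiff_succ_iff_hasFDerivAt.2 ⟨_, ?_, hasFDerivAt_synthesis hc h1⟩
    refine ContDiff.add ?_ ?_
    · exact (ContinuousLinearMap.smulRightL ℝ (ℝ × ℝ) ℂ
        (ContinuousLinearMap.fst ℝ ℝ ℝ)).contDiff.comp (ih hu.2.2)
    · exact (ContinuousLinearMap.smulRightL ℝ (ℝ × ℝ) ℂ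
        (ContinuousLinearMap.snd ℝ ℝ ℝ)).contDiff.comp
          (ih (hu.of_succ.mul_poly (norm_quasiWave_le β)))

theorem contDiff_infty_synthesis (hc : 0 ≤ c) (hu : ∀ j, SmoothFam c j u) :
    ContDiff ℝ ∞ (synthesis β u) :=
  contDiff_infty.2 fun n => contDiff_synthesis hc n (hu _)

theorem dx_synthesis (hc : 0 ≤ c) (hu : SmoothFam c 1 u) :
    dx (synthesis β u) = synthesis β fun m => deriv (u m) := by
  ext p
  have h := (hasFDerivAt_synthesis (β := β) hc hu p).comp_hasDerivAt p.1
    ((hasDerivAt_id p.1).prodMk (hasDerivAt_const p.1 p.2))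
  exact h.deriv.trans (by simp)

theorem dy_synthesis (hc : 0 ≤ c) (hu : SmoothFam c 1 u) :
    dy (synthesis β u) = synthesis β fun m x => Complex.I * ((β : ℂ) + (m : ℂ)) * u m x := by
  ext p
  have h := (hasFDerivAt_synthesis (β := β) hc hu p).comp_hasDerivAt p.2
    ((hasDerivAt_const p.2 p.1).prodMk (hasDerivAt_id p.2))
  exact h.deriv.trans (by simp)

theorem synthesis_quasiperiodic (x y : ℝ) :
    synthesis β u (x, y + 2 * Real.pi) =
      Complex.exp (2 * (Real.pi : ℂ) * Complex.I * (β : ℂ)) * synthesis β u (x, y) := by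
  unfold synthesis
  rw [← tsum_mul_left]
  congr 1; ext m
  have : Complex.exp (Complex.I * ((β : ℂ) + (m : ℂ)) * ((y + 2 * Real.pi : ℝ) : ℂ)) =
      Complex.exp (2 * (Real.pi : ℂ) * Complex.I * (β : ℂ)) *
        Complex.exp (Complex.I * ((β : ℂ) + (m : ℂ)) * (y : ℂ)) := by
    rw [← Complex.exp_add, Complex.exp_eq_exp_iff_exists_int]
    exact ⟨m, by push_cast; ring⟩
  simp only [this]; ring

theorem boundaryCond_synthesis (hc : 0 ≤ c) (hu : SmoothFam c 1 u) :
    BoundaryCond β (synthesis β u) := by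
  intro x
  rw [dy_synthesis hc hu]
  constructor
  · simpa using synthesis_quasiperiodic (β := β) (u := u) x 0
  · simpa using synthesis_quasiperiodic (β := β)
      (u := fun m x => Complex.I * ((β : ℂ) + (m : ℂ)) * u m x) x 0

/-- Orthogonality of the phases over one period. It recovers the coefficients from the sum, which is
how a vanishing mode is excluded. -/
theorem integral_synthesis_coeff (hc : 0 ≤ c) (hu : RapidFam c u) (m : ℤ) (x : ℝ) :
    ∫ y in (0 : ℝ)..(2 * Real.pi),
      Complex.exp (-(Complex.I * ((β : ℂ) + (m : ℂ)) * (y : ℂ))) * synthesis β u (x, y) =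
      2 * Real.pi * u m x := by
  obtain ⟨C, hC0, hC⟩ := hu.norm_le_summable hc
  have hphase : ∀ (n : ℤ) (y : ℝ), Complex.exp (-(Complex.I * ((β : ℂ) + (m : ℂ)) * (y : ℂ))) *
      Complex.exp (Complex.I * ((β : ℂ) + (n : ℂ)) * (y : ℂ)) =
        Complex.exp (Complex.I * ((n : ℂ) - m) * y) := fun n y => by
    rw [← Complex.exp_add]; congr 1; ring
  have hterm : ∀ n : ℤ, ∫ y in (0 : ℝ)..(2 * Real.pi),
      Complex.exp (Complex.I * ((n : ℂ) - m) * y) * u n x =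
        if n = m then 2 * Real.pi * u m x else 0 := by
    intro n
    rw [intervalIntegral.integral_mul_const]
    split_ifs with h
    · subst h; simp
    · have hne : Complex.I * ((n : ℂ) - m) ≠ 0 :=
        mul_ne_zero Complex.I_ne_zero (sub_ne_zero.2 (by exact_mod_cast h))
      rw [integral_exp_mul_complex hne]
      have : Complex.exp (Complex.I * ((n : ℂ) - m) * ((2 * Real.pi : ℝ) : ℂ)) = 1 := by
        rw [Complex.exp_eq_one_iff]; exact ⟨n - m, by push_cast; ring⟩
      rw [this]; simp
  have key := intervalIntegral.hasSum_integral_of_dominated_convergence (μ := volume)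
    (a := 0) (b := 2 * Real.pi)
    (F := fun (n : ℤ) (y : ℝ) => Complex.exp (Complex.I * ((n : ℂ) - m) * y) * u n x)
    (f := fun y => Complex.exp (-(Complex.I * ((β : ℂ) + (m : ℂ)) * (y : ℂ))) *
      synthesis β u (x, y))
    (fun n _ => C * (1 / (1 + |(n : ℝ)|) ^ 2))
    (fun n => Continuous.aestronglyMeasurable (by fun_prop))
    (fun n => .of_forall fun y _ => by
      rw [norm_mul]
      have : ‖Complex.exp (Complex.I * ((n : ℂ) - m) * y)‖ = 1 := by
        rw [Complex.norm_exp]; simp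
      rw [this, one_mul]; exact hC n x)
    (.of_forall fun y _ => summable_inv_one_add_abs_sq.mul_left C)
    (by simp)
    (.of_forall fun y _ => by
      have := ((summable_norm_synthesis (β := β) hc hu (x, y)).of_norm).hasSum.mul_left
        (Complex.exp (-(Complex.I * ((β : ℂ) + (m : ℂ)) * (y : ℂ))))
      simp only [← mul_assoc, hphase] at this
      exact this)
  simp only [hterm] at key
  exact key.unique (hasSum_ite_eq m _)

end Synthesis

end

end RayleighBloch

namespace RayleighBloch

noncomputable section

/-! ### Convolution with the Green function of `-d²/dx² + κ²` -/

/-- The exponential kernel `e^{-κ|x|} / (2κ)`. -/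
def expKernel (κ : ℂ) (x : ℝ) : ℂ := Complex.exp (-(κ * (|x| : ℝ))) / (2 * κ)

section Kernel

variable {κ : ℂ} {R : ℝ} {y : ℝ → ℂ}

/-- The convolution of `y` with the exponential kernel. -/
def expConv (κ : ℂ) (y : ℝ → ℂ) (x : ℝ) : ℂ := ∫ ξ : ℝ, expKernel κ (x - ξ) * y ξ

/-- The derivative of `expConv`. -/
def expConvDeriv (κ : ℂ) (y : ℝ → ℂ) (x : ℝ) : ℂ :=
  ((∫ ξ in Ioi x, Complex.exp (-(κ * (|x - ξ| : ℝ))) * y ξ) -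
    ∫ ξ in Iic x, Complex.exp (-(κ * (|x - ξ| : ℝ))) * y ξ) / 2

theorem integrable_mul_of_support (hy : Continuous y) (hR : ∀ x, R < |x| → y x = 0)
    {h : ℝ → ℂ} (hh : Continuous h) : Integrable fun ξ => h ξ * y ξ := by
  refine (hh.mul hy).integrable_of_hasCompactSupport ?_
  refine HasCompactSupport.intro (K := Icc (-R) R) isCompact_Icc fun x hx => ?_
  have : R < |x| := not_le.1 fun h => hx (abs_le.1 h)
  simp [hR x this]

theorem integral_Iic_eq (hy : Continuous y) (hR : ∀ x, R < |x| → y x = 0) {h : ℝ → ℂ}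
    (hh : Continuous h) (x : ℝ) :
    ∫ ξ in Iic x, h ξ * y ξ =
      (∫ ξ in Iic 0, h ξ * y ξ) + ∫ ξ in (0 : ℝ)..x, h ξ * y ξ := by
  have hi := integrable_mul_of_support hy hR hh
  rw [← intervalIntegral.integral_Iic_sub_Iic hi.integrableOn hi.integrableOn]
  ring

theorem integral_Ioi_eq (hy : Continuous y) (hR : ∀ x, R < |x| → y x = 0) {h : ℝ → ℂ}
    (hh : Continuous h) (x : ℝ) :
    ∫ ξ in Ioi x, h ξ * y ξ =
      (∫ ξ in Ioi 0, h ξ * y ξ) - ∫ ξ in (0 : ℝ)..x, h ξ * y ξ := by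
  have hi := integrable_mul_of_support hy hR hh
  have h1 := intervalIntegral.integral_Iic_add_Ioi (b := x) hi.integrableOn hi.integrableOn
  have h2 := intervalIntegral.integral_Iic_add_Ioi (b := 0) hi.integrableOn hi.integrableOn
  have h3 := integral_Iic_eq hy hR hh x
  linear_combination h1 - h2 - h3

theorem hasDerivAt_integral_Iic (hy : Continuous y) (hR : ∀ x, R < |x| → y x = 0) {h : ℝ → ℂ}
    (hh : Continuous h) (x : ℝ) :
    HasDerivAt (fun x => ∫ ξ in Iic x, h ξ * y ξ) (h x * y x) x := by
  rw [funext (integral_Iic_eq hy hR hh)]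
  exact ((hh.mul hy).integral_hasStrictDerivAt 0 x).hasDerivAt.const_add _

theorem hasDerivAt_integral_Ioi (hy : Continuous y) (hR : ∀ x, R < |x| → y x = 0) {h : ℝ → ℂ}
    (hh : Continuous h) (x : ℝ) :
    HasDerivAt (fun x => ∫ ξ in Ioi x, h ξ * y ξ) (-(h x * y x)) x := by
  rw [funext (integral_Ioi_eq hy hR hh)]
  exact ((hh.mul hy).integral_hasStrictDerivAt 0 x).hasDerivAt.const_sub _

theorem integral_Iic_exp_abs (x : ℝ) :
    ∫ ξ in Iic x, Complex.exp (-(κ * (|x - ξ| : ℝ))) * y ξ =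
      Complex.exp (-(κ * x)) * ∫ ξ in Iic x, Complex.exp (κ * ξ) * y ξ := by
  rw [← integral_const_mul]
  refine setIntegral_congr_fun measurableSet_Iic fun ξ hξ => ?_
  have : |x - ξ| = x - ξ := abs_of_nonneg (sub_nonneg.2 hξ)
  simp only [this]
  rw [← mul_assoc, ← Complex.exp_add]
  congr 2; push_cast; ring

theorem integral_Ioi_exp_abs (x : ℝ) :
    ∫ ξ in Ioi x, Complex.exp (-(κ * (|x - ξ| : ℝ))) * y ξ =
      Complex.exp (κ * x) * ∫ ξ in Ioi x, Complex.exp (-(κ * ξ)) * y ξ := by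
  rw [← integral_const_mul]
  refine setIntegral_congr_fun measurableSet_Ioi fun ξ hξ => ?_
  have : |x - ξ| = ξ - x := by rw [abs_sub_comm]; exact abs_of_pos (sub_pos.2 hξ)
  simp only [this]
  rw [← mul_assoc, ← Complex.exp_add]
  congr 2; push_cast; ring

/-- Splitting at `ξ = x` removes the absolute value, and the exponential factors. What depends on
`x` is then elementary functions times primitives of continuous functions, so no derivative falls on
the kink of the kernel. -/
theorem expConv_eq (hy : Continuous y) (hR : ∀ x, R < |x| → y x = 0) (x : ℝ) :
    expConv κ y x = (Complex.exp (-(κ * x)) * (∫ ξ in Iic x, Complex.exp (κ * ξ) * y ξ) +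
      Complex.exp (κ * x) * ∫ ξ in Ioi x, Complex.exp (-(κ * ξ)) * y ξ) / (2 * κ) := by
  rw [← integral_Iic_exp_abs, ← integral_Ioi_exp_abs]
  have hi := integrable_mul_of_support hy hR (h := fun ξ => Complex.exp (-(κ * (|x - ξ| : ℝ))))
    (by fun_prop)
  rw [intervalIntegral.integral_Iic_add_Ioi hi.integrableOn hi.integrableOn,
    ← integral_div]
  unfold expConv expKernel
  congr 1; ext ξ; ring

theorem expConvDeriv_eq (x : ℝ) :
    expConvDeriv κ y x = (Complex.exp (κ * x) * (∫ ξ in Ioi x, Complex.exp (-(κ * ξ)) * y ξ) -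
      Complex.exp (-(κ * x)) * ∫ ξ in Iic x, Complex.exp (κ * ξ) * y ξ) / 2 := by
  rw [← integral_Iic_exp_abs, ← integral_Ioi_exp_abs, expConvDeriv]

theorem hasDerivAt_cexp_mul (κ : ℂ) (x : ℝ) :
    HasDerivAt (fun x : ℝ => Complex.exp (κ * x)) (κ * Complex.exp (κ * x)) x := by
  have h : HasDerivAt (fun z : ℂ => Complex.exp (κ * z)) (κ * Complex.exp (κ * x)) x := by
    simpa [mul_comm] using ((hasDerivAt_id (x : ℂ)).const_mul κ).cexp
  exact h.comp_ofReal

theorem hasDerivAt_cexp_neg_mul (κ : ℂ) (x : ℝ) :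
    HasDerivAt (fun x : ℝ => Complex.exp (-(κ * x))) (-κ * Complex.exp (-(κ * x))) x := by
  simpa using hasDerivAt_cexp_mul (-κ) x

/-- The contributions of the moving endpoint from the two half-lines cancel here. -/
theorem hasDerivAt_expConv (hκ : κ ≠ 0) (hy : Continuous y) (hR : ∀ x, R < |x| → y x = 0)
    (x : ℝ) : HasDerivAt (expConv κ y) (expConvDeriv κ y x) x := by
  have h1 := hasDerivAt_integral_Iic hy hR (h := fun ξ => Complex.exp (κ * ξ)) (by fun_prop) x
  have h2 := hasDerivAt_integral_Ioi hy hR (h := fun ξ => Complex.exp (-(κ * ξ)))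
    (by fun_prop) x
  have h := (((hasDerivAt_cexp_neg_mul κ x).mul h1).add
    ((hasDerivAt_cexp_mul κ x).mul h2)).div_const (2 * κ)
  have hfun : expConv κ y = fun x : ℝ => (Complex.exp (-(κ * x)) *
      (∫ ξ in Iic x, Complex.exp (κ * ξ) * y ξ) +
      Complex.exp (κ * x) * ∫ ξ in Ioi x, Complex.exp (-(κ * ξ)) * y ξ) / (2 * κ) :=
    funext (expConv_eq hy hR)
  rw [hfun, expConvDeriv_eq]
  refine h.congr_deriv ?_
  field_simp
  ring

/-- Here the endpoint contributions add up instead, to `-y x`: the kernel is the Green function of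
`-d²/dx² + κ²`. -/
theorem hasDerivAt_expConvDeriv (hy : Continuous y) (hR : ∀ x, R < |x| → y x = 0)
    (x : ℝ) : HasDerivAt (expConvDeriv κ y) (κ ^ 2 * expConv κ y x - y x) x := by
  have h1 := hasDerivAt_integral_Iic hy hR (h := fun ξ => Complex.exp (κ * ξ)) (by fun_prop) x
  have h2 := hasDerivAt_integral_Ioi hy hR (h := fun ξ => Complex.exp (-(κ * ξ)))
    (by fun_prop) x
  have h := (((hasDerivAt_cexp_mul κ x).mul h2).sub
    ((hasDerivAt_cexp_neg_mul κ x).mul h1)).div_const 2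
  have hfun : expConvDeriv κ y = fun x : ℝ =>
      (Complex.exp (κ * x) * (∫ ξ in Ioi x, Complex.exp (-(κ * ξ)) * y ξ) -
      Complex.exp (-(κ * x)) * ∫ ξ in Iic x, Complex.exp (κ * ξ) * y ξ) / 2 :=
    funext expConvDeriv_eq
  rw [hfun, expConv_eq hy hR]
  refine h.congr_deriv ?_
  have e1 : Complex.exp (κ * x) * Complex.exp (-(κ * x)) = 1 := by
    rw [← Complex.exp_add, add_neg_cancel, Complex.exp_zero]
  field_simp
  linear_combination (-2 * y x) * e1

/-- Since `|x| ≤ |x - ξ| + R` on the support, decay in `x - ξ` becomes decay in `x` at the cost of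
the factor `e^{cR}`. -/
theorem norm_exp_abs_le {c : ℝ} (hc : 0 ≤ c) (hκ : c ≤ κ.re) {x ξ : ℝ} (hξ : |ξ| ≤ R) :
    ‖Complex.exp (-(κ * (|x - ξ| : ℝ)))‖ ≤ Real.exp (c * R) * Real.exp (-(c * |x|)) := by
  rw [Complex.norm_exp, ← Real.exp_add]
  refine Real.exp_le_exp.2 ?_
  have h1 : |x| ≤ |x - ξ| + |ξ| := by simpa using abs_add_le (x - ξ) ξ
  have h2 : c * |x - ξ| ≤ κ.re * |x - ξ| := by gcongr
  have h3 : c * |x| ≤ c * (|x - ξ| + R) := by gcongr; linarith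
  simp
  linarith

/-- Two disjoint pieces are bounded together so that one estimate serves both `expConv` (the line
and the empty set) and `expConvDeriv` (two half-lines). -/
theorem norm_setIntegral_exp_abs_le (hR0 : 0 ≤ R) (hy : Continuous y)
    (hR : ∀ x, R < |x| → y x = 0) {B D : ℝ} {x : ℝ} (hD : 0 ≤ D) (hB : ∀ ξ, ‖y ξ‖ ≤ B)
    (hx : ∀ ξ, |ξ| ≤ R → ‖Complex.exp (-(κ * (|x - ξ| : ℝ)))‖ ≤ D) (s t : Set ℝ)
    (ht : MeasurableSet t) (hst : Disjoint s t) :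
    ‖∫ ξ in s, Complex.exp (-(κ * (|x - ξ| : ℝ))) * y ξ‖ +
      ‖∫ ξ in t, Complex.exp (-(κ * (|x - ξ| : ℝ))) * y ξ‖ ≤ 2 * R * (D * B) := by
  have hi := integrable_mul_of_support hy hR (h := fun ξ => Complex.exp (-(κ * (|x - ξ| : ℝ))))
    (by fun_prop)
  set F := fun ξ => Complex.exp (-(κ * (|x - ξ| : ℝ))) * y ξ
  have hB0 : 0 ≤ B := (norm_nonneg _).trans (hB 0)
  calc _ ≤ (∫ ξ in s, ‖F ξ‖) + ∫ ξ in t, ‖F ξ‖ :=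
        add_le_add (norm_integral_le_integral_norm _) (norm_integral_le_integral_norm _)
    _ = ∫ ξ in s ∪ t, ‖F ξ‖ :=
        (setIntegral_union hst ht hi.norm.integrableOn hi.norm.integrableOn).symm
    _ ≤ ∫ ξ, ‖F ξ‖ := setIntegral_le_integral hi.norm (.of_forall fun _ => norm_nonneg _)
    _ ≤ ∫ ξ, (Icc (-R) R).indicator (fun _ => D * B) ξ := by
        refine integral_mono hi.norm ?_ fun ξ => ?_
        · exact (integrable_indicator_iff measurableSet_Icc).2 continuous_const.integrableOn_Icc
        · by_cases h : ξ ∈ Icc (-R) R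
          · rw [indicator_of_mem h]
            rw [norm_mul]
            exact mul_le_mul (hx ξ (abs_le.2 h)) (hB ξ) (norm_nonneg _) hD
          · rw [indicator_of_notMem h]
            have : R < |ξ| := not_le.1 fun h' => h (abs_le.1 h')
            simp [F, hR ξ this]
    _ = 2 * R * (D * B) := by
        rw [integral_indicator measurableSet_Icc]
        simp [← mul_two, mul_comm R 2, hR0]

theorem norm_expConv_le (hR0 : 0 ≤ R) (hκ : κ ≠ 0) (hy : Continuous y)
    (hR : ∀ x, R < |x| → y x = 0) {B D : ℝ} {x : ℝ} (hD : 0 ≤ D) (hB : ∀ ξ, ‖y ξ‖ ≤ B)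
    (hx : ∀ ξ, |ξ| ≤ R → ‖Complex.exp (-(κ * (|x - ξ| : ℝ)))‖ ≤ D) :
    ‖expConv κ y x‖ ≤ ‖κ‖⁻¹ * (R * (D * B)) := by
  have h := norm_setIntegral_exp_abs_le hR0 hy hR hD hB hx univ ∅ .empty (by simp)
  have h' : ‖∫ ξ, Complex.exp (-(κ * (|x - ξ| : ℝ))) * y ξ‖ ≤ 2 * R * (D * B) := by simpa using h
  have : expConv κ y x = (2 * κ)⁻¹ * ∫ ξ, Complex.exp (-(κ * (|x - ξ| : ℝ))) * y ξ := by
    rw [← integral_const_mul]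
    unfold expConv expKernel
    congr 1; ext ξ; ring
  rw [this, norm_mul, norm_inv, norm_mul]
  have hκ' : 0 < ‖κ‖ := norm_pos_iff.2 hκ
  calc _ ≤ (‖(2 : ℂ)‖ * ‖κ‖)⁻¹ * (2 * R * (D * B)) := by gcongr
    _ = _ := by simp; field_simp

theorem norm_expConvDeriv_le (hR0 : 0 ≤ R) (hy : Continuous y)
    (hR : ∀ x, R < |x| → y x = 0) {B D : ℝ} {x : ℝ} (hD : 0 ≤ D) (hB : ∀ ξ, ‖y ξ‖ ≤ B)
    (hx : ∀ ξ, |ξ| ≤ R → ‖Complex.exp (-(κ * (|x - ξ| : ℝ)))‖ ≤ D) :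
    ‖expConvDeriv κ y x‖ ≤ R * (D * B) := by
  have h := norm_setIntegral_exp_abs_le hR0 hy hR hD hB hx (Ioi x) (Iic x)
    measurableSet_Iic (Set.disjoint_left.2 fun a h1 h2 => absurd (mem_Ioi.1 h1) (not_lt.2 (mem_Iic.1 h2)))
  rw [expConvDeriv, norm_div]
  have h2 : ‖(2 : ℂ)‖ = 2 := by simp
  rw [h2, div_le_iff₀ (by norm_num)]
  exact (norm_sub_le _ _).trans (h.trans_eq (by ring))

end Kernel

end

end RayleighBloch

namespace RayleighBloch

noncomputable section

/-! ### Weighted shifts on `ℓ²`-spaces of vectors -/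

section WeightedShift

variable {𝕜 X : Type*} [NontriviallyNormedField 𝕜] [NormedAddCommGroup X] [NormedSpace 𝕜 X]

theorem summable_lp_two_sq (A : lp (fun _ : ℤ => X) 2) : Summable fun m => ‖A m‖ ^ 2 := by
  have := (lp.memℓp A).summable (by norm_num)
  simpa using this

theorem norm_sq_lp_two (A : lp (fun _ : ℤ => X) 2) : ‖A‖ ^ 2 = ∑' m, ‖A m‖ ^ 2 := by
  have := lp.norm_rpow_eq_tsum (p := 2) (by norm_num) A
  simpa using this

theorem memℓp_two_of_norm_le (A : lp (fun _ : ℤ => X) 2) (e : ℤ ≃ ℤ) {B : ℤ → X} {C : ℝ}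
    (h : ∀ m, ‖B m‖ ≤ C * ‖A (e m)‖) : Memℓp B 2 := by
  refine memℓp_gen ?_
  have hs : Summable fun m => C ^ 2 * ‖A (e m)‖ ^ 2 :=
    ((e.summable_iff (f := fun m => ‖A m‖ ^ 2)).2 (summable_lp_two_sq A)).mul_left _
  refine (Summable.of_nonneg_of_le (fun m => by positivity) (fun m => ?_) hs :
    Summable fun m => ‖B m‖ ^ 2).congr fun m => by simp
  rw [← mul_pow]
  gcongr
  exact h m

theorem norm_lp_two_le (A : lp (fun _ : ℤ => X) 2) (e : ℤ ≃ ℤ) {B : lp (fun _ : ℤ => X) 2} {C : ℝ}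
    (hC : 0 ≤ C) (h : ∀ m, ‖B m‖ ≤ C * ‖A (e m)‖) : ‖B‖ ≤ C * ‖A‖ := by
  refine (pow_le_pow_iff_left₀ (norm_nonneg _) (by positivity) two_ne_zero).1 ?_
  have hs : Summable fun m => C ^ 2 * ‖A (e m)‖ ^ 2 :=
    ((e.summable_iff (f := fun m => ‖A m‖ ^ 2)).2 (summable_lp_two_sq A)).mul_left _
  calc ‖B‖ ^ 2 = ∑' m, ‖B m‖ ^ 2 := norm_sq_lp_two B
    _ ≤ ∑' m, C ^ 2 * ‖A (e m)‖ ^ 2 := (summable_lp_two_sq B).tsum_le_tsum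
        (fun m => by rw [← mul_pow]; gcongr; exact h m) hs
    _ = (C * ‖A‖) ^ 2 := by
        rw [tsum_mul_left, e.tsum_eq (fun m => ‖A m‖ ^ 2), ← norm_sq_lp_two, mul_pow]

/-- The weighted shift `A ↦ (L_m A_{e(m)})_m`. -/
def weightedShift (e : ℤ ≃ ℤ) (L : ℤ → X →L[𝕜] X) (C : ℝ) (hC : ∀ m, ‖L m‖ ≤ C) :
    lp (fun _ : ℤ => X) 2 →L[𝕜] lp (fun _ : ℤ => X) 2 :=
  LinearMap.mkContinuous
    { toFun := fun A => ⟨fun m => L m (A (e m)),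
        memℓp_two_of_norm_le A e fun m => (L m).le_of_opNorm_le (hC m) _⟩
      map_add' := fun A B => by ext1; funext m; exact map_add (L m) _ _
      map_smul' := fun z A => by ext1; funext m; exact map_smul (L m) z _ }
    C fun A => norm_lp_two_le A e ((norm_nonneg _).trans (hC 0))
      fun m => (L m).le_of_opNorm_le (hC m) _

theorem weightedShift_apply (e : ℤ ≃ ℤ) (L : ℤ → X →L[𝕜] X) (C : ℝ) (hC : ∀ m, ‖L m‖ ≤ C)
    (A : lp (fun _ : ℤ => X) 2) (m : ℤ) : weightedShift e L C hC A m = L m (A (e m)) := rfl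

theorem norm_weightedShift_le (e : ℤ ≃ ℤ) (L : ℤ → X →L[𝕜] X) (C : ℝ) (hC : ∀ m, ‖L m‖ ≤ C) :
    ‖weightedShift e L C hC‖ ≤ C :=
  LinearMap.mkContinuous_norm_le _ ((norm_nonneg _).trans (hC 0)) _

end WeightedShift

theorem summable_clm_of_norm_le {V : Type*} [NormedAddCommGroup V] [NormedSpace ℂ V]
    [CompleteSpace V] {T : ℤ → V →L[ℂ] V} {b : ℤ → ℝ} (hb : Summable b) (h : ∀ j, ‖T j‖ ≤ b j) :
    Summable T := Summable.of_norm_bounded hb h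

/-! ### Extension by zero and convolution -/

section Convolution

variable {R : ℝ}

theorem zeroExt_of_mem (a : C(Icc (-R) R, ℂ)) {x : ℝ} (hx : x ∈ Icc (-R) R) :
    zeroExt a x = a ⟨x, hx⟩ := dif_pos hx

theorem zeroExt_of_notMem (a : C(Icc (-R) R, ℂ)) {x : ℝ} (hx : x ∉ Icc (-R) R) :
    zeroExt a x = 0 := dif_neg hx

theorem zeroExt_add (a b : C(Icc (-R) R, ℂ)) (x : ℝ) :
    zeroExt (a + b) x = zeroExt a x + zeroExt b x := by
  unfold zeroExt; split_ifs <;> simp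

theorem zeroExt_smul (z : ℂ) (a : C(Icc (-R) R, ℂ)) (x : ℝ) :
    zeroExt (z • a) x = z * zeroExt a x := by
  unfold zeroExt; split_ifs <;> simp

theorem norm_zeroExt_le (a : C(Icc (-R) R, ℂ)) (x : ℝ) :
    ‖zeroExt a x‖ ≤ (Icc (-R) R).indicator (fun _ => ‖a‖) x := by
  by_cases hx : x ∈ Icc (-R) R
  · rw [zeroExt_of_mem a hx, indicator_of_mem hx]; exact a.norm_coe_le_norm _
  · rw [zeroExt_of_notMem a hx, indicator_of_notMem hx]; simp

theorem norm_zeroExt_le' (a : C(Icc (-R) R, ℂ)) (x : ℝ) : ‖zeroExt a x‖ ≤ ‖a‖ :=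
  (norm_zeroExt_le a x).trans (indicator_le_self' (fun _ _ => norm_nonneg _) x)

theorem measurable_zeroExt (a : C(Icc (-R) R, ℂ)) : Measurable (zeroExt a) := by
  unfold zeroExt
  exact Measurable.dite (by fun_prop) measurable_const measurableSet_Icc

theorem integrable_indicator_const (R B : ℝ) :
    Integrable ((Icc (-R) R).indicator fun _ : ℝ => B) :=
  (integrable_indicator_iff measurableSet_Icc).2 continuous_const.integrableOn_Icc

theorem integral_indicator_const_Icc (hR : 0 ≤ R) (B : ℝ) :
    ∫ x, (Icc (-R) R).indicator (fun _ : ℝ => B) x = 2 * R * B := by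
  rw [integral_indicator measurableSet_Icc]
  simp [← mul_two, mul_comm R 2, hR]

theorem norm_mul_zeroExt_le {h : ℝ → ℂ} {B : ℝ} (hB : ∀ x, ‖h x‖ ≤ B) (a : C(Icc (-R) R, ℂ))
    (x : ℝ) : ‖h x * zeroExt a x‖ ≤ (Icc (-R) R).indicator (fun _ => B * ‖a‖) x := by
  have h0 : 0 ≤ B := (norm_nonneg _).trans (hB 0)
  rw [norm_mul]
  refine (mul_le_mul (hB x) (norm_zeroExt_le a x) (norm_nonneg _) h0).trans_eq ?_
  by_cases hx : x ∈ Icc (-R) R <;> simp [hx]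

theorem integrable_mul_zeroExt {h : ℝ → ℂ} (hh : Continuous h) {B : ℝ} (hB : ∀ x, ‖h x‖ ≤ B)
    (a : C(Icc (-R) R, ℂ)) : Integrable fun x => h x * zeroExt a x :=
  (integrable_indicator_const R (B * ‖a‖)).mono'
    (hh.measurable.mul (measurable_zeroExt a)).aestronglyMeasurable
    (.of_forall (norm_mul_zeroExt_le hB a))

theorem norm_integral_mul_zeroExt_le (hR : 0 ≤ R) {h : ℝ → ℂ} {B : ℝ} (hB : ∀ x, ‖h x‖ ≤ B)
    (a : C(Icc (-R) R, ℂ)) : ‖∫ x, h x * zeroExt a x‖ ≤ 2 * R * B * ‖a‖ := by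
  refine (norm_integral_le_of_norm_le (integrable_indicator_const R (B * ‖a‖))
    (.of_forall (norm_mul_zeroExt_le hB a))).trans_eq ?_
  rw [integral_indicator_const_Icc hR]; ring

/-- For `x` and `ξ` in `[-R, R]` the kernel is seen only at `|t| ≤ 2R`. Hence `|x|` may be replaced
by `min |x| (2R)`, which is bounded and so belongs to the Banach algebra `Kern`. -/
theorem conv_congr {h h' : ℝ → ℂ} (a : C(Icc (-R) R, ℂ)) {x : ℝ} (hx : x ∈ Icc (-R) R)
    (hh : ∀ t, |t| ≤ 2 * R → h t = h' t) : conv h a x = conv h' a x := by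
  unfold conv
  congr 1; ext ξ
  by_cases hξ : ξ ∈ Icc (-R) R
  · rw [hh]
    rw [abs_le]
    exact ⟨by linarith [hx.1, hξ.2], by linarith [hx.2, hξ.1]⟩
  · simp [zeroExt_of_notMem a hξ]

theorem continuous_conv {h : ℝ → ℂ} (hh : Continuous h) {B : ℝ} (hB : ∀ x, ‖h x‖ ≤ B)
    (a : C(Icc (-R) R, ℂ)) : Continuous (conv h a) := by
  refine continuous_of_dominated (bound := (Icc (-R) R).indicator fun _ => B * ‖a‖)
    (fun x => ?_) (fun x => .of_forall fun ξ => ?_) (integrable_indicator_const R _)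
    (.of_forall fun ξ => by fun_prop)
  · exact ((hh.comp (by fun_prop : Continuous fun ξ => x - ξ)).measurable.mul
      (measurable_zeroExt a)).aestronglyMeasurable
  · exact norm_mul_zeroExt_le (h := fun ξ => h (x - ξ)) (fun ξ => hB _) a ξ

/-- Bounded families of kernels. -/
abbrev Kern := BoundedContinuousFunction (ℤ × ℝ) ℂ

theorem continuous_kern (h : Kern) (n : ℤ) : Continuous fun t : ℝ => h (n, t) :=
  h.continuous.comp (Continuous.prodMk_right n)

theorem norm_kern_le (h : Kern) (n : ℤ) (t : ℝ) : ‖h (n, t)‖ ≤ ‖h‖ := h.norm_coe_le_norm _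

theorem integrable_conv (h : Kern) (n : ℤ) (a : C(Icc (-R) R, ℂ)) (x : ℝ) :
    Integrable fun ξ => h (n, x - ξ) * zeroExt a ξ :=
  integrable_mul_zeroExt ((continuous_kern h n).comp (by fun_prop : Continuous fun ξ => x - ξ))
    (fun ξ => norm_kern_le h n _) a

/-- Convolution with the `n`-th kernel of a family, as an operator on `C[-R,R]`. -/
def convOp (hR : 0 ≤ R) (h : Kern) (n : ℤ) : C(Icc (-R) R, ℂ) →L[ℂ] C(Icc (-R) R, ℂ) :=
  LinearMap.mkContinuous
    { toFun := fun a => ⟨fun x => conv (fun t => h (n, t)) a x,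
        (continuous_conv (continuous_kern h n) (norm_kern_le h n) a).comp continuous_subtype_val⟩
      map_add' := fun a b => by
        ext x
        simp only [conv, zeroExt_add, mul_add, ContinuousMap.coe_mk, ContinuousMap.add_apply]
        exact integral_add (integrable_conv h n a x) (integrable_conv h n b x)
      map_smul' := fun z a => by
        ext x
        simp only [conv, zeroExt_smul, ContinuousMap.coe_mk, ContinuousMap.smul_apply,
          RingHom.id_apply, smul_eq_mul]
        rw [← integral_const_mul]
        congr 1; ext ξ; ring }
    (2 * R * ‖h‖) fun a => by
      refine (ContinuousMap.norm_le _ (by positivity)).2 fun x => ?_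
      exact norm_integral_mul_zeroExt_le hR (h := fun ξ => h (n, x - ξ))
        (fun ξ => norm_kern_le h n _) a

theorem convOp_apply (hR : 0 ≤ R) (h : Kern) (n : ℤ) (a : C(Icc (-R) R, ℂ)) (x : Icc (-R) R) :
    convOp hR h n a x = conv (fun t => h (n, t)) a x := rfl

theorem norm_convOp_le (hR : 0 ≤ R) (h : Kern) (n : ℤ) : ‖convOp hR h n‖ ≤ 2 * R * ‖h‖ :=
  LinearMap.mkContinuous_norm_le _ (by positivity) _

/-! ### The operators `A ↦ (∑_n φ_{m-n} (h_n * A_n))_m` -/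

variable {φ : ℤ → C(Icc (-R) R, ℂ)}

/-- Multiplication by `φ_j` combined with the shift by `j`. -/
def shiftMul (φ : ℤ → C(Icc (-R) R, ℂ)) (j : ℤ) : VecSpace R →L[ℂ] VecSpace R :=
  weightedShift (Equiv.subRight j) (fun _ => ContinuousLinearMap.mul ℂ _ (φ j)) ‖φ j‖
    fun _ => ContinuousLinearMap.opNorm_mul_apply_le ℂ _ _

theorem norm_shiftMul_le (φ : ℤ → C(Icc (-R) R, ℂ)) (j : ℤ) : ‖shiftMul φ j‖ ≤ ‖φ j‖ :=
  norm_weightedShift_le (Equiv.subRight j) (fun _ => ContinuousLinearMap.mul ℂ _ (φ j)) ‖φ j‖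
    fun _ => ContinuousLinearMap.opNorm_mul_apply_le ℂ _ _

/-- The operator `A ↦ (∑_n φ_{m-n} A_n)_m`. -/
def indexConvOp (φ : ℤ → C(Icc (-R) R, ℂ)) : VecSpace R →L[ℂ] VecSpace R :=
  ∑' j, shiftMul φ j

theorem summable_shiftMul (hφ : Summable fun j => ‖φ j‖) : Summable (shiftMul φ) :=
  summable_clm_of_norm_le (V := VecSpace R) hφ (norm_shiftMul_le φ)

theorem hasSum_indexConvOp (hφ : Summable fun j => ‖φ j‖) (A : VecSpace R) (m : ℤ)
    (x : Icc (-R) R) : HasSum (fun n => φ (m - n) x * A n x) (indexConvOp φ A m x) := by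
  have h1 : HasSum (shiftMul φ) (indexConvOp φ) := (summable_shiftMul hφ).hasSum
  have h2 := (ContinuousLinearMap.apply ℂ (VecSpace R) A).hasSum h1
  have h3 := (lp.evalCLM ℂ (fun _ : ℤ => C(Icc (-R) R, ℂ)) 2 m).hasSum h2
  have h4 := (ContinuousMap.evalCLM ℂ x).hasSum h3
  have h5 : HasSum (fun j => φ j x * A (m - j) x) (indexConvOp φ A m x) := h4
  -- The norm-convergent sum over shifts `j` has been evaluated at `A`, `m` and `x`; the index is
  -- now `n = m - j`.
  rw [← (Equiv.subLeft m).hasSum_iff] at h5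
  convert! h5 using 2 with n
  simp [Function.comp]

/-- The operator `A ↦ (∑_n φ_{m-n} (h_n * A_n))_m`. -/
def kernelOp (hR : 0 ≤ R) (φ : ℤ → C(Icc (-R) R, ℂ)) (h : Kern) : VecSpace R →L[ℂ] VecSpace R :=
  (indexConvOp φ).comp (weightedShift (Equiv.refl ℤ) (convOp hR h) _ (norm_convOp_le hR h))

theorem hasSum_kernelOp (hR : 0 ≤ R) (hφ : Summable fun j => ‖φ j‖) (h : Kern) (A : VecSpace R)
    (m : ℤ) (x : Icc (-R) R) :
    HasSum (fun n => φ (m - n) x * conv (fun t => h (n, t)) (A n) x) (kernelOp hR φ h A m x) :=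
  hasSum_indexConvOp hφ _ m x

theorem norm_kernelOp_le (hR : 0 ≤ R) (φ : ℤ → C(Icc (-R) R, ℂ)) (h : Kern) :
    ‖kernelOp hR φ h‖ ≤ ‖indexConvOp φ‖ * (2 * R) * ‖h‖ := by
  refine (ContinuousLinearMap.opNorm_comp_le _ _).trans ?_
  refine (mul_le_mul_of_nonneg_left (norm_weightedShift_le _ _ _ _) (norm_nonneg _)).trans_eq ?_
  ring

theorem kernelOp_add (hR : 0 ≤ R) (h h' : Kern) :
    kernelOp hR φ (h + h') = kernelOp hR φ h + kernelOp hR φ h' := by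
  unfold kernelOp
  rw [← ContinuousLinearMap.comp_add]
  congr 1
  ext A m x
  simp only [weightedShift_apply, _root_.add_apply, lp.coeFn_add, Pi.add_apply,
    ContinuousMap.add_apply, convOp_apply, conv, BoundedContinuousFunction.add_apply, add_mul]
  exact integral_add (integrable_conv h m _ x) (integrable_conv h' m _ x)

theorem kernelOp_smul (hR : 0 ≤ R) (z : ℂ) (h : Kern) :
    kernelOp hR φ (z • h) = z • kernelOp hR φ h := by
  unfold kernelOp
  rw [← ContinuousLinearMap.comp_smul]
  congr 1
  ext A m x
  simp only [weightedShift_apply, _root_.smul_apply, lp.coeFn_smul, Pi.smul_apply,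
    ContinuousMap.smul_apply, convOp_apply, conv, BoundedContinuousFunction.smul_apply, smul_eq_mul]
  rw [← integral_const_mul]
  congr 1; ext ξ; ring

/-- `kernelOp` as a real-linear bounded operator in the kernel. -/
def kernelOpL (hR : 0 ≤ R) (φ : ℤ → C(Icc (-R) R, ℂ)) : Kern →L[ℝ] (VecSpace R →L[ℝ] VecSpace R) :=
  LinearMap.mkContinuous
    { toFun := fun h => (kernelOp hR φ h).restrictScalars ℝ
      map_add' := fun h h' => by rw [kernelOp_add]; rfl
      map_smul' := fun r h => by
        have : r • h = (r : ℂ) • h := by ext; simp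
        rw [this, kernelOp_smul]
        ext A m x
        exact (Complex.real_smul (x := r) (z := kernelOp hR φ h A m x)).symm }
    (‖indexConvOp φ‖ * (2 * R)) fun h => by
      simpa using norm_kernelOp_le hR φ h

/-- The functional `(Y, c) ↦ ∫ c_m Y_m`, as a real-bilinear map. -/
def pairing (hR : 0 ≤ R) (m : ℤ) : Kern →L[ℝ] VecSpace R →L[ℝ] ℂ :=
  LinearMap.mkContinuous₂
    (LinearMap.mk₂ ℝ (fun (c : Kern) (Y : VecSpace R) => ∫ ξ, c (m, ξ) * zeroExt (Y m) ξ)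
      (fun c c' Y => by
        simp only [BoundedContinuousFunction.add_apply, add_mul]
        exact integral_add (integrable_mul_zeroExt (continuous_kern c m) (norm_kern_le c m) _)
          (integrable_mul_zeroExt (continuous_kern c' m) (norm_kern_le c' m) _))
      (fun r c Y => by
        simp only [BoundedContinuousFunction.smul_apply, Complex.real_smul]
        rw [← integral_const_mul]
        congr 1; ext ξ; ring)
      (fun c Y Y' => by
        simp only [lp.coeFn_add, Pi.add_apply, zeroExt_add, mul_add]
        exact integral_add (integrable_mul_zeroExt (continuous_kern c m) (norm_kern_le c m) _)
          (integrable_mul_zeroExt (continuous_kern c m) (norm_kern_le c m) _))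
      (fun r c Y => by
        have : (r • Y) m = (r : ℂ) • Y m := by ext; simp
        simp only [this, zeroExt_smul, Complex.real_smul]
        rw [← integral_const_mul]
        congr 1; ext ξ; ring))
    (2 * R) fun c Y => by
      refine (norm_integral_mul_zeroExt_le hR (norm_kern_le c m) _).trans ?_
      gcongr
      exact lp.norm_apply_le_norm (by norm_num) Y m

theorem pairing_apply (hR : 0 ≤ R) (m : ℤ) (c : Kern) (Y : VecSpace R) :
    pairing hR m c Y = ∫ ξ, c (m, ξ) * zeroExt (Y m) ξ := rfl

/-! ### Symmetries -/

/-- The reflection `x ↦ -x` of `[-R,R]`. -/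
def reflIcc (R : ℝ) : C(Icc (-R) R, Icc (-R) R) :=
  ⟨fun x => ⟨-x, by constructor <;> linarith [x.2.1, x.2.2]⟩, by fun_prop⟩

/-- The reflection of a vector. -/
def reflect : VecSpace R →L[ℂ] VecSpace R :=
  weightedShift (Equiv.refl ℤ) (fun _ => ContinuousMap.compCLM ℂ ℂ (reflIcc R)) 1
    fun _ => ContinuousLinearMap.opNorm_le_bound _ zero_le_one fun a => by
      rw [one_mul]
      exact (ContinuousMap.norm_le _ (norm_nonneg _)).2 fun x => a.norm_coe_le_norm _

theorem reflect_apply (A : VecSpace R) (m : ℤ) (x : Icc (-R) R) :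
    reflect A m x = A m (reflIcc R x) := rfl

theorem zeroExt_reflect (A : VecSpace R) (m : ℤ) (x : ℝ) :
    zeroExt (reflect A m) x = zeroExt (A m) (-x) := by
  by_cases hx : x ∈ Icc (-R) R
  · have hx' : -x ∈ Icc (-R) R := ⟨by linarith [hx.2], by linarith [hx.1]⟩
    rw [zeroExt_of_mem _ hx, zeroExt_of_mem _ hx', reflect_apply]; rfl
  · have hx' : -x ∉ Icc (-R) R := fun h => hx ⟨by linarith [h.2], by linarith [h.1]⟩
    rw [zeroExt_of_notMem _ hx, zeroExt_of_notMem _ hx']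

theorem zeroExt_star (A : VecSpace R) (m : ℤ) (x : ℝ) :
    zeroExt ((star A : VecSpace R) m) x = star (zeroExt (A m) x) := by
  rw [lp.star_apply]
  unfold zeroExt; split_ifs <;> simp

/-- Substitution `ξ ↦ -ξ` in the convolution. With unique solvability this forces solutions with
even data to be even. -/
theorem kernelOp_reflect (hR : 0 ≤ R) (hφ : Summable fun j => ‖φ j‖)
    (hφe : ∀ j x, φ j (reflIcc R x) = φ j x) {h : Kern} (he : ∀ n t, h (n, -t) = h (n, t))
    (A : VecSpace R) : kernelOp hR φ h (reflect A) = reflect (kernelOp hR φ h A) := by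
  ext m x
  rw [reflect_apply]
  refine (hasSum_kernelOp hR hφ h (reflect A) m x).unique ?_
  convert! hasSum_kernelOp hR hφ h A m (reflIcc R x) using 2 with n
  rw [hφe]
  congr 1
  unfold conv
  rw [← integral_neg_eq_self]
  congr 1; ext ξ
  rw [zeroExt_reflect, neg_neg]
  congr 1
  have hx : ((reflIcc R x : Icc (-R) R) : ℝ) - ξ = -((x : ℝ) - -ξ) := by
    change -(x : ℝ) - ξ = _
    ring
  simp only [hx, he]

/-- The analogue for conjugation, which forces solutions of the reduced equation to be real. It is
not available for the outgoing kernel, which is not real. -/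
theorem kernelOp_star (hR : 0 ≤ R) (hφ : Summable fun j => ‖φ j‖)
    (hφr : ∀ j x, star (φ j x) = φ j x) {h : Kern} (hr : ∀ n t, star (h (n, t)) = h (n, t))
    (A : VecSpace R) : kernelOp hR φ h (star A) = star (kernelOp hR φ h A) := by
  ext m x
  have h0 : (star (kernelOp hR φ h A) : VecSpace R) m x = star (kernelOp hR φ h A m x) := by
    rw [lp.star_apply]; rfl
  rw [h0]
  refine (hasSum_kernelOp hR hφ h (star A) m x).unique ?_
  convert! (hasSum_kernelOp hR hφ h A m x).star using 2 with n
  rw [StarMul.star_mul, hφr, mul_comm]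
  congr 1
  unfold conv
  rw [Complex.star_def, ← integral_conj]
  congr 1; ext ξ
  rw [zeroExt_star, map_mul]
  congr 1
  exact (hr n _).symm

end Convolution

end

end RayleighBloch

namespace RayleighBloch

noncomputable section

/-! ### Analytic functions in commutative Banach algebras -/

section BanachAlgebra

variable {A : Type*} [NormedCommRing A] [NormedAlgebra ℝ A] [CompleteSpace A]

/-- The quadratic equation `d + q d² = a` has a small solution depending analytically on `a`. -/
theorem exists_contDiffAt_quadratic (q : A) : ∃ D : A → A, ContDiffAt ℝ ω D 0 ∧ D 0 = 0 ∧
    ∀ᶠ a in 𝓝 0, D a + q * (D a * D a) = a := by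
  set f : A → A := fun d => d + q * (d * d) with hf
  have hc : ContDiffAt ℝ ω f 0 := by
    have : ContDiff ℝ ω f := contDiff_id.add (contDiff_const.mul (contDiff_id.mul contDiff_id))
    exact this.contDiffAt
  -- The quadratic term has zero derivative at the origin, so the derivative is the identity and the
  -- inverse function theorem applies.
  have hd : HasFDerivAt f ((ContinuousLinearEquiv.refl ℝ A : A ≃L[ℝ] A) : A →L[ℝ] A) 0 := by
    have h1 : HasFDerivAt (fun d : A => d) (ContinuousLinearMap.id ℝ A) 0 := hasFDerivAt_id 0
    refine (h1.add ((h1.mul h1).const_mul q)).congr_fderiv ?_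
    ext v; simp
  have h0 : f 0 = 0 := by simp [hf]
  refine ⟨hc.localInverse hd (by simp), ?_, ?_, ?_⟩
  · have := hc.to_localInverse hd (by simp)
    rwa [h0] at this
  · have := hc.localInverse_apply_image hd (by simp)
    rwa [h0] at this
  · have := (hc.hasStrictFDerivAt' hd (by simp)).eventually_right_inverse
    rwa [h0] at this

theorem contDiffAt_exp_smul {G : Type*} [NormedAddCommGroup G] [NormedSpace ℝ G] {k : G → ℝ}
    {p : G} (hk : ContDiffAt ℝ ω k p) (a : A) :
    ContDiffAt ℝ ω (fun p => NormedSpace.exp (k p • a)) p :=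
  (NormedSpace.exp_analytic (𝕂 := ℝ) (k p • a)).contDiffAt.comp p (hk.smul contDiffAt_const)

/-- With `a = -|x|` (truncated) this is `(e^{-μ|x|} - 1)/μ`, continued analytically through `μ = 0`;
it carries the regularized kernel `H_{-1}`. -/
theorem contDiffAt_dslope_exp (a : A) :
    ContDiffAt ℝ ω (dslope (fun μ : ℝ => NormedSpace.exp (μ • a)) 0) 0 := by
  have h : AnalyticAt ℝ (fun μ : ℝ => NormedSpace.exp (μ • a)) 0 :=
    (contDiffAt_exp_smul (k := fun μ : ℝ => μ) contDiffAt_id a).analyticAt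
  obtain ⟨p, hp⟩ := h
  exact AnalyticAt.contDiffAt ⟨_, hp.has_fpower_series_dslope_fslope⟩

end BanachAlgebra

/-! ### Elements of the algebra of kernels -/

section Kernels

/-- A bounded family of continuous functions as an element of `Kern`. -/
def mkKern (F : ℤ → ℝ → ℂ) (hF : ∀ m, Continuous (F m)) (C : ℝ) (hC : ∀ m x, ‖F m x‖ ≤ C) : Kern :=
  BoundedContinuousFunction.ofNormedAddCommGroup (fun p => F p.1 p.2)
    (continuous_prod_of_discrete_left.2 hF) C fun p => hC p.1 p.2

theorem mkKern_apply (F : ℤ → ℝ → ℂ) (hF : ∀ m, Continuous (F m)) (C : ℝ)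
    (hC : ∀ m x, ‖F m x‖ ≤ C) (m : ℤ) (x : ℝ) : mkKern F hF C hC (m, x) = F m x := rfl

/-- The truncated absolute value `min |x| (2R)`. -/
def absKern (R : ℝ) : Kern :=
  mkKern (fun _ x => ((min |x| (2 * R) : ℝ) : ℂ)) (fun _ => by fun_prop) |2 * R| fun _ x => by
    rw [Complex.norm_real, Real.norm_eq_abs]
    refine abs_le.2 ⟨?_, (min_le_right _ _).trans (le_abs_self _)⟩
    exact le_min ((neg_nonpos.2 (abs_nonneg _)).trans (abs_nonneg x)) (neg_abs_le _)

theorem absKern_apply (R : ℝ) (m : ℤ) (x : ℝ) :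
    absKern R (m, x) = ((min |x| (2 * R) : ℝ) : ℂ) := rfl

/-- The indicator of the index `j`. -/
def indKern (j : ℤ) : Kern :=
  mkKern (fun m _ => if m = j then 1 else 0) (fun _ => continuous_const) 1 fun m _ => by
    split_ifs <;> simp

theorem indKern_apply (j m : ℤ) (x : ℝ) : indKern j (m, x) = if m = j then 1 else 0 := rfl

/-- Evaluation at a point is a continuous ring homomorphism, so it commutes with the exponential. -/
theorem exp_kern_apply (h : Kern) (p : ℤ × ℝ) :
    (NormedSpace.exp h) p = Complex.exp (h p) := by
  let ev : Kern →+* ℂ :=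
    { toFun := fun h => h p, map_one' := rfl, map_mul' := fun _ _ => rfl, map_zero' := rfl,
      map_add' := fun _ _ => rfl }
  have hev : Continuous ev := continuous_eval_const p
  have := NormedSpace.map_exp (𝔸 := Kern) (𝔹 := ℂ) ev hev h
  rw [Complex.exp_eq_exp_ℂ]
  exact this

theorem inverse_kern_apply {h : Kern} (hh : IsUnit h) (p : ℤ × ℝ) :
    (Ring.inverse h) p = (h p)⁻¹ := by
  have h1 : (Ring.inverse h * h) p = 1 := by rw [Ring.inverse_mul_cancel _ hh]; rfl
  exact eq_inv_of_mul_eq_one_left h1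

/-! ### Wave numbers at the bifurcation point and analyticity of the evanescent kernels -/

variable (β₀ : ℝ)

/-- The wave number of the `m`-th mode at `μ = 0`, `β = β₀` (and `1` for `m = 0, -1`). -/
def baseWave (m : ℤ) : ℝ :=
  if m = 0 ∨ m = -1 then 1 else √(((m : ℝ) + 1) * (2 * β₀ + m - 1))

/-- The right-hand side of the first bound is `(β+m)² - (1-β)²`, and it exceeds the left by
`(1-β)(m²-1) ≥ 0`. Thus `k_m` grows linearly in `m`, uniformly in `μ`. -/
theorem mul_sq_le_waveSq {β : ℝ} (h0 : 0 < β) (h1 : β < 1 / 2) {m : ℤ} (hm0 : m ≠ 0) (hm1 : m ≠ -1) :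
    β * ((m : ℝ) + 1) ^ 2 ≤ ((m : ℝ) + 1) * (2 * β + m - 1) ∧ 1 ≤ |(m : ℝ) + 1| := by
  rcases lt_or_ge m 0 with h | h
  · have h2 : m ≤ -2 := by omega
    have h2' : (m : ℝ) ≤ -2 := by exact_mod_cast h2
    constructor
    · nlinarith
    · rw [abs_of_neg (by linarith)]; linarith
  · have h2 : 1 ≤ m := by omega
    have h2' : (1 : ℝ) ≤ m := by exact_mod_cast h2
    constructor
    · nlinarith [mul_nonneg (mul_nonneg (by linarith : (0 : ℝ) ≤ m + 1)
        (by linarith : 0 ≤ 1 - β)) (by linarith : (0 : ℝ) ≤ m - 1)]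
    · rw [abs_of_pos (by linarith)]; linarith

variable {β₀}

theorem sqrt_mul_abs_le_baseWave (h0 : 0 < β₀) (h1 : β₀ < 1 / 2) (m : ℤ) :
    √β₀ * |(m : ℝ) + 1| ≤ baseWave β₀ m := by
  unfold baseWave
  split_ifs with h
  · have hs : √β₀ ≤ 1 := Real.sqrt_le_one.2 (by linarith)
    rcases h with h | h <;> simp [h, hs]
  · push Not at h
    have := (mul_sq_le_waveSq h0 h1 h.1 h.2).1
    rw [← Real.sqrt_sq_eq_abs, ← Real.sqrt_mul h0.le]
    exact Real.sqrt_le_sqrt this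

theorem sqrt_le_baseWave (h0 : 0 < β₀) (h1 : β₀ < 1 / 2) (m : ℤ) : √β₀ ≤ baseWave β₀ m := by
  by_cases h : m = 0 ∨ m = -1
  · have hs : √β₀ ≤ 1 := Real.sqrt_le_one.2 (by linarith)
    simp [baseWave, h, hs]
  · push Not at h
    have h2 := (mul_sq_le_waveSq h0 h1 h.1 h.2).2
    exact (le_mul_of_one_le_right (Real.sqrt_nonneg _) h2).trans (sqrt_mul_abs_le_baseWave h0 h1 m)

theorem baseWave_pos (h0 : 0 < β₀) (h1 : β₀ < 1 / 2) (m : ℤ) : 0 < baseWave β₀ m :=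
  (Real.sqrt_pos.2 h0).trans_le (sqrt_le_baseWave h0 h1 m)

/-- The family `1 / (2 k_m)`. -/
def invWaveKern (h0 : 0 < β₀) (h1 : β₀ < 1 / 2) : Kern :=
  mkKern (fun m _ => ((1 / (2 * baseWave β₀ m) : ℝ) : ℂ)) (fun _ => continuous_const)
    (1 / (2 * √β₀)) fun m _ => by
      have := baseWave_pos h0 h1 m
      have hs := Real.sqrt_pos.2 h0
      rw [Complex.norm_real, Real.norm_of_nonneg (by positivity)]
      gcongr
      exact sqrt_le_baseWave h0 h1 m

/-- The family `(m + 1) / k_m`. -/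
def ratioKern (h0 : 0 < β₀) (h1 : β₀ < 1 / 2) : Kern :=
  mkKern (fun m _ => ((((m : ℝ) + 1) / baseWave β₀ m : ℝ) : ℂ)) (fun _ => continuous_const)
    (1 / √β₀) fun m _ => by
      have := baseWave_pos h0 h1 m
      have hs := Real.sqrt_pos.2 h0
      rw [Complex.norm_real, Real.norm_eq_abs, abs_div, abs_of_pos this,
        div_le_div_iff₀ this hs, one_mul, mul_comm]
      exact sqrt_mul_abs_le_baseWave h0 h1 m

/-- The base kernels `e^{-k_m min(|x|, 2R)} / (2 k_m)` for `m ≠ 0, -1`. -/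
def baseKern {R : ℝ} (hR : 0 ≤ R) (h0 : 0 < β₀) (h1 : β₀ < 1 / 2) : Kern :=
  mkKern (fun m x => if m = 0 ∨ m = -1 then 0 else
      ((Real.exp (-(baseWave β₀ m * min |x| (2 * R))) / (2 * baseWave β₀ m) : ℝ) : ℂ))
    (fun m => by split_ifs <;> fun_prop) (1 / (2 * √β₀)) fun m x => by
      have := baseWave_pos h0 h1 m
      have hs := Real.sqrt_pos.2 h0
      split_ifs
      · simp
      · rw [Complex.norm_real, Real.norm_of_nonneg (by positivity)]
        have hmin : 0 ≤ min |x| (2 * R) := le_min (abs_nonneg x) (by positivity)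
        gcongr
        · exact Real.exp_le_one_iff.2 (by have := mul_nonneg this.le hmin; linarith)
        · exact sqrt_le_baseWave h0 h1 m

/-- The value of the regularized kernel with real mode `0` at `|x| = a`. -/
def regVal (μ β : ℝ) (m : ℤ) (a : ℝ) : ℝ :=
  if m = 0 then -Real.sin (waveNumber μ β 0 * a) / (2 * waveNumber μ β 0)
  else if m = -1 then (Real.exp (-(μ * a)) - 1) / (2 * μ)
  else Real.exp (-(waveNumber μ β m * a)) / (2 * waveNumber μ β m)

theorem waveNumber_sq_eq (μ β : ℝ) (m : ℤ) :
    (β + m) ^ 2 - omegaSq μ β = ((m : ℝ) + 1) * (2 * β + m - 1) + μ ^ 2 := by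
  unfold omegaSq; ring

/-- Analytic dependence of the evanescent kernels on the parameters. -/
theorem exists_evanescentKern {R : ℝ} (hR : 0 ≤ R) (h0 : 0 < β₀) (h1 : β₀ < 1 / 2) :
    ∃ H : ℝ × ℝ → Kern, ContDiffAt ℝ ω H (0, β₀) ∧ ∀ᶠ p in 𝓝 ((0 : ℝ), β₀), ∀ (m : ℤ) (x : ℝ),
      H p (m, x) = if m = 0 ∨ m = -1 then 0 else
        (regVal p.1 p.2 m (min |x| (2 * R)) : ℂ) := by
  set q := invWaveKern h0 h1 with hq
  set P := ratioKern h0 h1 with hP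
  obtain ⟨D, hD, hD0, hDe⟩ := exists_contDiffAt_quadratic q
  -- Write `k_m = k + d` with `k` the value at `(0, β₀)`. Dividing `k_m² - k² = 2(m+1)(β-β₀) + μ²`
  -- by `2k` gives `d + q d² = s` with `q = 1/(2k)`. The coefficients `(m+1)/k` and `1/(2k)` are
  -- bounded in `m`, so all modes are solved for at once.
  set s : ℝ × ℝ → Kern := fun p => (p.2 - β₀) • P + (p.1 ^ 2) • q with hs
  have hsC : ContDiff ℝ ω s := by fun_prop
  have hs0 : s (0, β₀) = 0 := by simp [hs]
  set d : ℝ × ℝ → Kern := fun p => D (s p) with hd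
  have hdC : ContDiffAt ℝ ω d (0, β₀) := by
    refine ContDiffAt.comp (0, β₀) ?_ hsC.contDiffAt
    rwa [hs0]
  have hd0 : d (0, β₀) = 0 := by simp [hd, hs0, hD0]
  -- This is the ratio `(k + d)/k` of the new wave number to the old one; its inverse corrects the
  -- prefactor `1/(2k)`.
  set r : ℝ × ℝ → Kern := fun p => 1 + (q + q) * d p with hr
  have hrC : ContDiffAt ℝ ω r (0, β₀) := contDiffAt_const.add (contDiffAt_const.mul hdC)
  have hr0 : r (0, β₀) = 1 := by simp [hr, hd0]
  have hinv : ContDiffAt ℝ ω (fun p => Ring.inverse (r p)) (0, β₀) := by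
    have h1 : ContDiffAt ℝ ω (Ring.inverse : Kern → Kern) (r (0, β₀)) := by
      rw [hr0]
      exact contDiffAt_ringInverse ℝ (1 : Kernˣ)
    exact h1.comp (0, β₀) hrC
  have hexp : ContDiffAt ℝ ω (fun p => NormedSpace.exp (-(d p * absKern R))) (0, β₀) :=
    (NormedSpace.exp_analytic (𝕂 := ℝ) _).contDiffAt.comp (0, β₀)
      (hdC.mul contDiffAt_const).neg
  refine ⟨fun p => baseKern hR h0 h1 * NormedSpace.exp (-(d p * absKern R)) * Ring.inverse (r p),
    (contDiffAt_const.mul hexp).mul hinv, ?_⟩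
  have e1 : ∀ᶠ p in 𝓝 ((0 : ℝ), β₀), d p + q * (d p * d p) = s p := by
    have hcont : Tendsto s (𝓝 (0, β₀)) (𝓝 0) := by
      have := hsC.continuous.tendsto (0, β₀)
      rwa [hs0] at this
    exact hcont.eventually hDe
  -- The bound `√β₀ ≤ k`, uniform in `m`, keeps `k + d` in the right half-plane, which selects the
  -- positive square root.
  have e2 : ∀ᶠ p in 𝓝 ((0 : ℝ), β₀), ‖d p‖ < √β₀ := by
    have hcont := hdC.continuousAt.norm
    refine hcont.eventually_lt continuousAt_const ?_
    simp only [hd0, norm_zero]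
    exact Real.sqrt_pos.2 h0
  have e3 : ∀ᶠ p in 𝓝 ((0 : ℝ), β₀), IsUnit (r p) := by
    refine hrC.continuousAt.eventually (Units.isOpen.mem_nhds ?_)
    rw [hr0]; exact isUnit_one
  filter_upwards [e1, e2, e3] with p h1p h2p h3p m x
  simp only [BoundedContinuousFunction.mul_apply, exp_kern_apply, inverse_kern_apply h3p,
    BoundedContinuousFunction.neg_apply, absKern_apply]
  have hb : baseKern hR h0 h1 (m, x) = if m = 0 ∨ m = -1 then 0 else
      ((Real.exp (-(baseWave β₀ m * min |x| (2 * R))) / (2 * baseWave β₀ m) : ℝ) : ℂ) := rfl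
  rw [hb]
  by_cases hm : m = 0 ∨ m = -1
  · simp [hm]
  rw [if_neg hm, if_neg hm]
  have hk := baseWave_pos h0 h1 m
  set k := baseWave β₀ m with hk_def
  push Not at hm
  have hq1 : q (m, x) = 1 / (2 * (k : ℂ)) := by
    change ((1 / (2 * k) : ℝ) : ℂ) = _; push_cast; rfl
  have hP1 : P (m, x) = ((m : ℂ) + 1) / k := by
    change ((((m : ℝ) + 1) / k : ℝ) : ℂ) = _; push_cast; rfl
  have hkc : (k : ℂ) ≠ 0 := by exact_mod_cast hk.ne'
  set z := d p (m, x) with hz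
  have hzn : ‖z‖ < k :=
    ((d p).norm_coe_le_norm _).trans_lt (h2p.trans_le (sqrt_le_baseWave h0 h1 m))
  have hquad : z + 1 / (2 * (k : ℂ)) * (z * z) =
      ((p.2 - β₀ : ℝ) : ℂ) * (((m : ℂ) + 1) / k) + ((p.1 ^ 2 : ℝ) : ℂ) * (1 / (2 * (k : ℂ))) := by
    have := congrArg (fun h : Kern => h (m, x)) h1p
    simpa [hs, hq1, hP1] using this
  have hksq : k ^ 2 = ((m : ℝ) + 1) * (2 * β₀ + m - 1) := by
    rw [hk_def, baseWave, if_neg (by tauto), Real.sq_sqrt]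
    exact le_trans (by positivity) (mul_sq_le_waveSq h0 h1 hm.1 hm.2).1
  set S : ℝ := (p.2 + m) ^ 2 - omegaSq p.1 p.2 with hS
  have hzsq : ((k : ℂ) + z) ^ 2 = (S : ℂ) := by
    have hksq' : (k : ℂ) ^ 2 = ((m : ℂ) + 1) * (2 * β₀ + m - 1) := by exact_mod_cast hksq
    rw [hS, waveNumber_sq_eq]
    field_simp at hquad
    push_cast at hquad ⊢
    linear_combination hksq' + hquad
  have hre : 0 < ((k : ℂ) + z).re := by
    have := (abs_le.1 (Complex.abs_re_le_norm z)).1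
    simp; linarith
  -- A number with positive real part and real square is real, so its square is nonnegative.
  have hS0 : 0 ≤ S := by
    have him : ((k : ℂ) + z).im = 0 := by
      have := congrArg Complex.im hzsq
      rw [sq, Complex.mul_im, Complex.ofReal_im] at this
      have h' : ((k : ℂ) + z).re * ((k : ℂ) + z).im = 0 := by linarith
      exact (mul_eq_zero.1 h').resolve_left hre.ne'
    have := congrArg Complex.re hzsq
    rw [sq, Complex.mul_re, him, Complex.ofReal_re] at this
    nlinarith
  have hkz : (k : ℂ) + z = (√S : ℂ) := by
    have h2 : ((k : ℂ) + z) ^ 2 = ((√S : ℝ) : ℂ) ^ 2 := by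
      rw [hzsq, ← Complex.ofReal_pow, Real.sq_sqrt hS0]
    rcases sq_eq_sq_iff_eq_or_eq_neg.1 h2 with h | h
    · exact h
    · exfalso
      rw [h] at hre
      simp at hre
      exact absurd hre (not_lt.2 (Real.sqrt_nonneg S))
  have hwave : waveNumber p.1 p.2 m = √S := by
    rw [waveNumber, if_neg hm.1, if_neg hm.2]
  have hr1 : r p (m, x) = ((k : ℂ) + z) / k := by
    have : r p (m, x) = 1 + (1 / (2 * (k : ℂ)) + 1 / (2 * (k : ℂ))) * z := by
      simp [hr, hq1, hz]
    rw [this]; field_simp; ring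
  rw [hr1, regVal, if_neg hm.1, if_neg hm.2, hwave]
  push_cast
  rw [← hkz, show -(((k : ℂ) + z) * ((min |x| (2 * R) : ℝ) : ℂ)) =
    -(k * ((min |x| (2 * R) : ℝ) : ℂ)) + -(z * ((min |x| (2 * R) : ℝ) : ℂ)) by ring,
    Complex.exp_add]
  have hne : (k : ℂ) + z ≠ 0 := fun h => by rw [h] at hre; simp at hre
  field_simp

end Kernels

end

end RayleighBloch

namespace RayleighBloch

noncomputable section

/-! ### An analytic branch of zeros -/

section Branch

/-- Analytic implicit function theorem for `ψ(ε, v) = 0`, `ε ∈ ℝ`, `v ∈ ℝ²`, with local uniqueness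
in a neighbourhood in which a given property holds. -/
theorem exists_analytic_branch {ψ : ℝ × ℝ × ℝ → ℝ × ℝ} {v₀ : ℝ × ℝ}
    (hψ : ContDiffAt ℝ ω ψ (0, v₀)) (h0 : ψ (0, v₀) = 0)
    (hinj : ∀ v : ℝ × ℝ, fderiv ℝ ψ (0, v₀) (0, v) = 0 → v = 0)
    {P : ℝ × ℝ × ℝ → Prop} (hP : ∀ᶠ q in 𝓝 ((0 : ℝ), v₀), P q) :
    ∃ (ε₀ δ : ℝ) (φ : ℝ → ℝ × ℝ), 0 < ε₀ ∧ 0 < δ ∧ AnalyticOnNhd ℝ φ (Ioo (-ε₀) ε₀) ∧ φ 0 = v₀ ∧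
      ∀ ε ∈ Ioo (-ε₀) ε₀, ψ (ε, φ ε) = 0 ∧ P (ε, φ ε) ∧
        ∀ v, dist v v₀ < δ → P (ε, v) ∧ (ψ (ε, v) = 0 → v = φ ε) := by
  -- Adjoining `ε` as a component reduces the implicit function theorem to the inverse one; in
  -- finite dimension injectivity of the derivative suffices.
  set Q : ℝ × ℝ × ℝ → ℝ × ℝ × ℝ := fun q => (q.1, ψ q) with hQ
  have hQC : ContDiffAt ℝ ω Q (0, v₀) := contDiffAt_fst.prodMk hψ
  set Q' : ℝ × ℝ × ℝ →L[ℝ] ℝ × ℝ × ℝ :=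
    (ContinuousLinearMap.fst ℝ ℝ (ℝ × ℝ)).prod (fderiv ℝ ψ (0, v₀)) with hQ'
  have hQd : HasFDerivAt Q Q' (0, v₀) :=
    hasFDerivAt_fst.prodMk (hψ.differentiableAt (by simp)).hasFDerivAt
  have hQi : Function.Injective Q'.toLinearMap := by
    rw [← LinearMap.ker_eq_bot, LinearMap.ker_eq_bot']
    rintro ⟨t, v⟩ h
    have h1 : t = 0 := congrArg Prod.fst h
    subst h1
    have h2 : fderiv ℝ ψ (0, v₀) (0, v) = 0 := congrArg Prod.snd h
    rw [hinj v h2]; rfl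
  let e' : (ℝ × ℝ × ℝ) ≃L[ℝ] ℝ × ℝ × ℝ :=
    (LinearEquiv.ofInjectiveEndo Q'.toLinearMap hQi).toContinuousLinearEquiv
  have he' : (e' : ℝ × ℝ × ℝ →L[ℝ] ℝ × ℝ × ℝ) = Q' := by ext <;> rfl
  have hQd' : HasFDerivAt Q (e' : ℝ × ℝ × ℝ →L[ℝ] ℝ × ℝ × ℝ) (0, v₀) := by rwa [he']
  let e := hQC.toOpenPartialHomeomorph Q hQd' (by simp)
  have hecoe : (e : ℝ × ℝ × ℝ → ℝ × ℝ × ℝ) = Q := rfl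
  have hsrc : (0, v₀) ∈ e.source := hQC.mem_toOpenPartialHomeomorph_source hQd' (by simp)
  have hQ0 : Q (0, v₀) = 0 := by simp [hQ, h0]
  have htgt : (0 : ℝ × ℝ × ℝ) ∈ e.target := by
    have := e.map_source hsrc
    rwa [hecoe, hQ0] at this
  have hsymm0 : e.symm 0 = (0, v₀) := by
    rw [← hQ0, ← hecoe]; exact e.left_inv hsrc
  have hsC : ContDiffAt ℝ ω e.symm 0 := by
    refine e.contDiffAt_symm htgt (f₀' := e') ?_ ?_
    · rw [hsymm0]; exact hQd'
    · rw [hsymm0]; exact hQC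
  -- The branch is the local inverse of `Q` along the line `(ε, 0)`.
  set ι : ℝ → ℝ × ℝ × ℝ := fun ε => (ε, 0) with hι
  have hιC : ContDiff ℝ ω ι := contDiff_id.prodMk contDiff_const
  have hι0 : ι 0 = 0 := rfl
  have hφC : ContDiffAt ℝ ω (fun ε => (e.symm (ι ε)).2) 0 := by
    have : ContDiffAt ℝ ω e.symm (ι 0) := by rwa [hι0]
    exact contDiffAt_snd.comp 0 (this.comp 0 hιC.contDiffAt)
  have hA : ∀ᶠ ε in 𝓝 (0 : ℝ), AnalyticAt ℝ (fun ε => (e.symm (ι ε)).2) ε :=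
    hφC.analyticAt.eventually_analyticAt
  have hT : ∀ᶠ ε in 𝓝 (0 : ℝ), ι ε ∈ e.target :=
    hιC.continuous.continuousAt.eventually (e.open_target.mem_nhds htgt)
  have hφ0 : (e.symm (ι 0)).2 = v₀ := by rw [hι0, hsymm0]
  have hPφ : ∀ᶠ ε in 𝓝 (0 : ℝ), P (ε, (e.symm (ι ε)).2) := by
    have hc : ContinuousAt (fun ε => (ε, (e.symm (ι ε)).2)) 0 :=
      continuousAt_id.prodMk hφC.continuousAt
    have ht : Tendsto (fun ε => (ε, (e.symm (ι ε)).2)) (𝓝 0) (𝓝 (0, v₀)) := by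
      have := hc.tendsto
      rwa [hφ0] at this
    exact ht.eventually hP
  have hS : ∀ᶠ q in 𝓝 ((0 : ℝ), v₀), P q ∧ q ∈ e.source :=
    hP.and (e.open_source.mem_nhds hsrc)
  obtain ⟨δ, hδ, hδb⟩ := Metric.eventually_nhds_iff.1 hS
  obtain ⟨ε₁, hε₁, hε₁b⟩ := Metric.eventually_nhds_iff.1 (hA.and (hT.and hPφ))
  have hmem : ∀ ε ∈ Ioo (-(min ε₁ δ)) (min ε₁ δ), dist ε 0 < ε₁ ∧ dist ε 0 < δ := by
    intro ε hε
    rw [Real.dist_eq, sub_zero]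
    have := abs_lt.2 hε
    exact ⟨this.trans_le (min_le_left _ _), this.trans_le (min_le_right _ _)⟩
  refine ⟨min ε₁ δ, δ, fun ε => (e.symm (ι ε)).2, lt_min hε₁ hδ, hδ,
    fun ε hε => (hε₁b (hmem ε hε).1).1, hφ0, fun ε hε => ?_⟩
  obtain ⟨-, hεT, hεP⟩ := hε₁b (hmem ε hε).1
  have hr : Q (e.symm (ι ε)) = ι ε := e.right_inv hεT
  have hr1 : (e.symm (ι ε)).1 = ε := congrArg Prod.fst hr
  have hr2 : ψ (e.symm (ι ε)) = 0 := congrArg Prod.snd hr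
  have hpair : (ε, (e.symm (ι ε)).2) = e.symm (ι ε) := Prod.ext hr1.symm rfl
  refine ⟨by rw [hpair]; exact hr2, hεP, fun v hv => ?_⟩
  have hq := hδb (y := (ε, v)) (by rw [Prod.dist_eq]; exact max_lt (hmem ε hε).2 hv)
  refine ⟨hq.1, fun hz => ?_⟩
  have hQv : e (ε, v) = ι ε := by rw [hecoe]; simp [hQ, hz, hι]
  have := e.left_inv hq.2
  rw [hQv] at this
  exact (congrArg Prod.snd this).symm

end Branch

/-! ### The reduced real system -/

section Reduced

variable {E V : Type*} [NormedAddCommGroup E] [NormedSpace ℝ E] [NormedAddCommGroup V]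
  [NormedSpace ℝ V]

/-- The parameters `(μ, β) = (εν, β)`. -/
def spectralParam (q : ℝ × ℝ × ℝ) : ℝ × ℝ := (q.1 * q.2.1, q.2.2)

theorem contDiff_spectralParam : ContDiff ℝ ω spectralParam := by
  unfold spectralParam; fun_prop

theorem contDiff_gam : ContDiff ℝ ω fun p : ℝ × ℝ => gam p.1 p.2 := by
  unfold gam omegaSq
  simp only [div_eq_mul_inv]
  fun_prop

/-- The operator `1 - 2 ε γ L(H(εν, β))`. -/
def reducedOp (L : E →L[ℝ] (V →L[ℝ] V)) (H : ℝ × ℝ → E) (q : ℝ × ℝ × ℝ) : V →L[ℝ] V :=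
  1 - (2 * q.1 * gam (spectralParam q).1 (spectralParam q).2) • L (H (spectralParam q))

theorem contDiffAt_reducedOp {L : E →L[ℝ] (V →L[ℝ] V)} {H : ℝ × ℝ → E} {ν₀ β₀ : ℝ}
    (hH : ContDiffAt ℝ ω H (0, β₀)) : ContDiffAt ℝ ω (reducedOp L H) (0, ν₀, β₀) := by
  have hs : spectralParam (0, ν₀, β₀) = (0, β₀) := by simp [spectralParam]
  have h1 : ContDiffAt ℝ ω (fun q => H (spectralParam q)) (0, ν₀, β₀) := by
    refine ContDiffAt.comp (0, ν₀, β₀) ?_ contDiff_spectralParam.contDiffAt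
    rwa [hs]
  have h2 : ContDiff ℝ ω fun q : ℝ × ℝ × ℝ =>
      2 * q.1 * gam (spectralParam q).1 (spectralParam q).2 :=
    (contDiff_const.mul contDiff_fst).mul (contDiff_gam.comp contDiff_spectralParam)
  exact contDiffAt_const.sub (h2.contDiffAt.smul (L.contDiff.contDiffAt.comp _ h1))

theorem reducedOp_zero (L : E →L[ℝ] (V →L[ℝ] V)) (H : ℝ × ℝ → E) (v : ℝ × ℝ) :
    reducedOp L H (0, v) = 1 := by simp [reducedOp]

theorem eventually_isUnit_reducedOp [CompleteSpace V] {L : E →L[ℝ] (V →L[ℝ] V)}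
    {H : ℝ × ℝ → E} {ν₀ β₀ : ℝ}
    (hH : ContDiffAt ℝ ω H (0, β₀)) :
    ∀ᶠ q in 𝓝 ((0 : ℝ), ν₀, β₀), IsUnit (reducedOp L H q) := by
  refine (contDiffAt_reducedOp (L := L) (ν₀ := ν₀) hH).continuousAt.eventually
    (Units.isOpen.mem_nhds ?_)
  rw [reducedOp_zero]; exact isUnit_one

/-- The solution of `(1 - 2 ε γ L(H)) Y = g`. -/
def reducedSol (L : E →L[ℝ] (V →L[ℝ] V)) (H : ℝ × ℝ → E) (g : V) (q : ℝ × ℝ × ℝ) : V :=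
  Ring.inverse (reducedOp L H q) g

theorem contDiffAt_reducedSol [CompleteSpace V] {L : E →L[ℝ] (V →L[ℝ] V)} {H : ℝ × ℝ → E}
    {ν₀ β₀ : ℝ} (g : V)
    (hH : ContDiffAt ℝ ω H (0, β₀)) : ContDiffAt ℝ ω (reducedSol L H g) (0, ν₀, β₀) := by
  have h1 : ContDiffAt ℝ ω (Ring.inverse : (V →L[ℝ] V) → _) (reducedOp L H (0, ν₀, β₀)) := by
    rw [reducedOp_zero]
    exact contDiffAt_ringInverse ℝ (1 : (V →L[ℝ] V)ˣ)
  exact (h1.comp _ (contDiffAt_reducedOp hH)).clm_apply contDiffAt_const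

theorem reducedSol_zero (L : E →L[ℝ] (V →L[ℝ] V)) (H : ℝ × ℝ → E) (g : V) (v : ℝ × ℝ) :
    reducedSol L H g (0, v) = g := by simp [reducedSol, reducedOp_zero]

theorem reducedOp_reducedSol {L : E →L[ℝ] (V →L[ℝ] V)} {H : ℝ × ℝ → E} {g : V}
    {q : ℝ × ℝ × ℝ} (h : IsUnit (reducedOp L H q)) :
    reducedOp L H q (reducedSol L H g q) = g := by
  have := Ring.mul_inverse_cancel _ h
  exact congrArg (fun T : V →L[ℝ] V => T g) this

theorem eq_reducedSol {L : E →L[ℝ] (V →L[ℝ] V)} {H : ℝ × ℝ → E} {g Y : V}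
    {q : ℝ × ℝ × ℝ} (h : IsUnit (reducedOp L H q)) (hY : reducedOp L H q Y = g) :
    Y = reducedSol L H g q := by
  have := Ring.inverse_mul_cancel _ h
  rw [reducedSol, ← hY]
  exact (congrArg (fun T : V →L[ℝ] V => T Y) this).symm

/-- The left-hand sides of the reduced real system. -/
def reducedMap (L : E →L[ℝ] (V →L[ℝ] V)) (H C : ℝ × ℝ → E) (g : V) (F : V →L[ℝ] ℝ)
    (B : E →L[ℝ] V →L[ℝ] ℝ) (q : ℝ × ℝ × ℝ) : ℝ × ℝ :=
  (q.2.1 - gam (spectralParam q).1 (spectralParam q).2 * F (reducedSol L H g q),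
    B (C (spectralParam q)) (reducedSol L H g q))

/-- At `ε = 0` the operator is the identity and `μ = 0`, so the map becomes `(ν - γ(0,β) F g, B (C
(0,β)) g)`. Its differential is triangular with diagonal entries `1` and `ρ'`. -/
theorem exists_reduced_branch [CompleteSpace V] {L : E →L[ℝ] (V →L[ℝ] V)} {H C : ℝ × ℝ → E} {g : V}
    {F : V →L[ℝ] ℝ} {B : E →L[ℝ] V →L[ℝ] ℝ} {β₀ ρ' : ℝ}
    (hH : ContDiffAt ℝ ω H (0, β₀)) (hC : ContDiffAt ℝ ω C (0, β₀))
    (hρ0 : B (C (0, β₀)) g = 0) (hρ : HasDerivAt (fun β => B (C (0, β)) g) ρ' β₀) (hρ' : ρ' ≠ 0)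
    {P : ℝ × ℝ × ℝ → Prop} (hP : ∀ᶠ q in 𝓝 ((0 : ℝ), gam 0 β₀ * F g, β₀), P q) :
    ∃ (ε₀ δ : ℝ) (φ : ℝ → ℝ × ℝ), 0 < ε₀ ∧ 0 < δ ∧ AnalyticOnNhd ℝ φ (Ioo (-ε₀) ε₀) ∧
      φ 0 = (gam 0 β₀ * F g, β₀) ∧
      ∀ ε ∈ Ioo (-ε₀) ε₀, reducedMap L H C g F B (ε, φ ε) = 0 ∧ P (ε, φ ε) ∧
        ∀ v, dist v (gam 0 β₀ * F g, β₀) < δ →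
          P (ε, v) ∧ (reducedMap L H C g F B (ε, v) = 0 → v = φ ε) := by
  set ν₀ := gam 0 β₀ * F g with hν₀
  have hs : spectralParam (0, ν₀, β₀) = (0, β₀) := by simp [spectralParam]
  have hsol := contDiffAt_reducedSol (L := L) (ν₀ := ν₀) g hH
  have hC' : ContDiffAt ℝ ω (fun q => C (spectralParam q)) (0, ν₀, β₀) := by
    refine ContDiffAt.comp (0, ν₀, β₀) ?_ contDiff_spectralParam.contDiffAt
    rwa [hs]
  have hψ : ContDiffAt ℝ ω (reducedMap L H C g F B) (0, ν₀, β₀) := by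
    refine ContDiffAt.prodMk ?_ ?_
    · exact (contDiff_fst.comp contDiff_snd).contDiffAt.sub
        ((contDiff_gam.comp contDiff_spectralParam).contDiffAt.mul
          (F.contDiff.contDiffAt.comp _ hsol))
    · exact (B.contDiff.contDiffAt.comp _ hC').clm_apply hsol
  refine exists_analytic_branch hψ ?_ ?_ hP
  · simp only [reducedMap, reducedSol_zero, hs, hρ0]
    simp [hν₀]
  · rintro ⟨a, b⟩ hv
    have h1 : HasFDerivAt (fun v : ℝ × ℝ => reducedMap L H C g F B (0, v))
        ((fderiv ℝ (reducedMap L H C g F B) (0, ν₀, β₀)).comp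
          (ContinuousLinearMap.inr ℝ ℝ (ℝ × ℝ))) (ν₀, β₀) :=
      (hψ.differentiableAt (by simp)).hasFDerivAt.comp (ν₀, β₀)
        (hasFDerivAt_prodMk_right (0 : ℝ) (ν₀, β₀))
    have h2 : HasDerivAt (fun t : ℝ => (ν₀ + t * a, β₀ + t * b)) (a, b) 0 := by
      have ha : HasDerivAt (fun t : ℝ => ν₀ + t * a) a 0 := by
        simpa using ((hasDerivAt_id (0 : ℝ)).mul_const a).const_add ν₀
      have hb : HasDerivAt (fun t : ℝ => β₀ + t * b) b 0 := by
        simpa using ((hasDerivAt_id (0 : ℝ)).mul_const b).const_add β₀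
      exact ha.prodMk hb
    have h3 : HasDerivAt (fun t : ℝ => reducedMap L H C g F B (0, (ν₀ + t * a, β₀ + t * b)))
        0 0 := by
      have h1' : HasFDerivAt (fun v : ℝ × ℝ => reducedMap L H C g F B (0, v))
        ((fderiv ℝ (reducedMap L H C g F B) (0, ν₀, β₀)).comp
          (ContinuousLinearMap.inr ℝ ℝ (ℝ × ℝ))) (ν₀ + 0 * a, β₀ + 0 * b) := by simpa using h1
      have := h1'.comp_hasDerivAt (0 : ℝ) h2
      refine this.congr_deriv ?_
      simpa using hv
    have hb : HasDerivAt (fun t : ℝ => β₀ + t * b) b 0 := by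
      simpa using ((hasDerivAt_id (0 : ℝ)).mul_const b).const_add β₀
    have ha : HasDerivAt (fun t : ℝ => ν₀ + t * a) a 0 := by
      simpa using ((hasDerivAt_id (0 : ℝ)).mul_const a).const_add ν₀
    have h4 : HasDerivAt (fun t : ℝ => B (C (0, β₀ + t * b)) g) (ρ' * b) 0 := by
      have : HasDerivAt (fun β => B (C (0, β)) g) ρ' (β₀ + 0 * b) := by simpa using hρ
      exact this.comp (0 : ℝ) hb
    -- The second equation does not involve `ν`: it gives `b = 0` first, and the first equation then
    -- gives `a = 0`.
    have h5 : HasDerivAt (fun t : ℝ => B (C (0, β₀ + t * b)) g) 0 0 := by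
      have := (hasFDerivAt_snd (𝕜 := ℝ) (E := ℝ) (F := ℝ)).comp_hasDerivAt (0 : ℝ) h3
      simpa [Function.comp_def, reducedMap, reducedSol_zero, spectralParam] using this
    have hb0 : b = 0 := (mul_eq_zero.1 (h4.unique h5)).resolve_left hρ'
    subst hb0
    have h6 : HasDerivAt (fun t : ℝ => ν₀ + t * a - gam 0 β₀ * F g) 0 0 := by
      have := (hasFDerivAt_fst (𝕜 := ℝ) (E := ℝ) (F := ℝ)).comp_hasDerivAt (0 : ℝ) h3
      simpa [Function.comp_def, reducedMap, reducedSol_zero, spectralParam] using this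
    have ha0 : a = 0 := (ha.sub_const _).unique h6
    simp [ha0]

end Reduced

/-! ### The kernels of the full and of the reduced problem -/

section FullKernels

/-- `H` is the reduced family, with the standing wave `-sin(k_0|x|)/(2k_0)` at `m = 0`; `C` is the
cosine of the radiation condition; `K` is the outgoing family. The formula for `H` needs `μ > 0`: at
`μ = 0` the analytic continuation of `H_{-1}` is `-min |x| (2R) / 2`, whereas division by zero makes
`regVal` vanish. -/
theorem exists_kernels {R β₀ : ℝ} (hR : 0 ≤ R) (h0 : 0 < β₀) (h1 : β₀ < 1 / 2) :
    ∃ H C K : ℝ × ℝ → Kern, ContDiffAt ℝ ω H (0, β₀) ∧ ContDiffAt ℝ ω C (0, β₀) ∧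
      ContDiffAt ℝ ω K (0, β₀) ∧ ∀ᶠ p in 𝓝 ((0 : ℝ), β₀),
        (0 < p.1 → ∀ m x, H p (m, x) = (regVal p.1 p.2 m (min |x| (2 * R)) : ℂ)) ∧
        (∀ m x, C p (m, x) = (Real.cos (waveNumber p.1 p.2 0 * min |x| (2 * R)) : ℂ)) ∧
        ∀ m x, K p (m, x) = H p (m, x) + if m = 0 then
          Complex.I / (2 * (waveNumber p.1 p.2 0 : ℂ)) *
            (Real.cos (waveNumber p.1 p.2 0 * min |x| (2 * R)) : ℂ) else 0 := by
  obtain ⟨H₁, hH₁, hH₁e⟩ := exists_evanescentKern hR h0 h1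
  set k : ℝ × ℝ → ℝ := fun p => √(1 - 2 * p.2 - p.1 ^ 2) with hk
  have hk0 : k (0, β₀) ≠ 0 := by
    refine (Real.sqrt_pos.2 ?_).ne'
    simp; linarith
  have hkC : ContDiffAt ℝ ω k (0, β₀) := by
    have hin : ContDiff ℝ ω fun p : ℝ × ℝ => 1 - 2 * p.2 - p.1 ^ 2 := by fun_prop
    refine (Real.contDiffAt_sqrt ?_).comp (0, β₀) hin.contDiffAt
    simp; linarith
  have hkinv : ContDiffAt ℝ ω (fun p => (k p)⁻¹) (0, β₀) := hkC.inv hk0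
  set iK : Kern := Complex.I • absKern R with hiK
  set E₁ : ℝ × ℝ → Kern := fun p => NormedSpace.exp (k p • iK)
  set E₂ : ℝ × ℝ → Kern := fun p => NormedSpace.exp (k p • (-iK))
  have hE₁ : ContDiffAt ℝ ω E₁ (0, β₀) := contDiffAt_exp_smul hkC iK
  have hE₂ : ContDiffAt ℝ ω E₂ (0, β₀) := contDiffAt_exp_smul hkC (-iK)
  set M : ℝ → Kern := dslope (fun μ : ℝ => NormedSpace.exp (μ • (-absKern R))) 0 with hM
  have hMC : ContDiffAt ℝ ω (fun p : ℝ × ℝ => M p.1) (0, β₀) :=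
    ContDiffAt.comp (0, β₀) (g := M) (contDiffAt_dslope_exp _) contDiffAt_fst
  have hC : ContDiffAt ℝ ω (fun p => (1 / 2 : ℝ) • (E₁ p + E₂ p)) (0, β₀) :=
    (hE₁.add hE₂).const_smul (1 / 2 : ℝ)
  -- The three summands live on disjoint indices: `m ≠ 0, -1`, then `m = -1`, then `m = 0`. In the
  -- last, `i(e^{ika} - e^{-ika})/(4k) = -sin(ka)/(2k)`.
  set H : ℝ × ℝ → Kern := fun p => H₁ p + indKern (-1) * ((1 / 2 : ℝ) • M p.1) +
    ((1 / 4 : ℝ) * (k p)⁻¹) • ((Complex.I • indKern 0) * (E₁ p - E₂ p)) with hH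
  have hHC : ContDiffAt ℝ ω H (0, β₀) := by
    refine (hH₁.add (contDiffAt_const.mul (hMC.const_smul (1 / 2 : ℝ)))).add ?_
    exact (contDiffAt_const.mul hkinv).smul (contDiffAt_const.mul (hE₁.sub hE₂))
  refine ⟨H, fun p => (1 / 2 : ℝ) • (E₁ p + E₂ p), fun p => H p + ((1 / 2 : ℝ) * (k p)⁻¹) •
    ((Complex.I • indKern 0) * ((1 / 2 : ℝ) • (E₁ p + E₂ p))), hHC, hC, ?_, ?_⟩
  · exact hHC.add ((contDiffAt_const.mul hkinv).smul (contDiffAt_const.mul hC))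
  · have hE₁a : ∀ p m x, E₁ p (m, x) =
        Complex.exp (((k p * min |x| (2 * R) : ℝ) : ℂ) * Complex.I) := fun p m x => by
      simp only [E₁, exp_kern_apply, hiK, BoundedContinuousFunction.smul_apply, absKern_apply]
      congr 1
      rw [Complex.real_smul, smul_eq_mul]; push_cast; ring
    have hE₂a : ∀ p m x, E₂ p (m, x) =
        Complex.exp (-((k p * min |x| (2 * R) : ℝ) : ℂ) * Complex.I) := fun p m x => by
      simp only [E₂, exp_kern_apply, hiK, BoundedContinuousFunction.smul_apply, absKern_apply,
        BoundedContinuousFunction.neg_apply]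
      congr 1
      rw [Complex.real_smul, smul_eq_mul]; push_cast; ring
    have hCa : ∀ p m x, ((1 / 2 : ℝ) • (E₁ p + E₂ p)) (m, x) =
        (Real.cos (k p * min |x| (2 * R)) : ℂ) := fun p m x => by
      rw [Complex.ofReal_cos, Complex.cos]
      simp only [BoundedContinuousFunction.smul_apply, BoundedContinuousFunction.add_apply,
        hE₁a, hE₂a, Complex.real_smul]
      push_cast; ring
    have hkw : ∀ p : ℝ × ℝ, waveNumber p.1 p.2 0 = k p := fun p => by simp [waveNumber, hk]
    filter_upwards [hH₁e] with p hp
    refine ⟨fun hμ m x => ?_, fun m x => by rw [hkw]; exact hCa p m x, fun m x => ?_⟩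
    · simp only [hH, BoundedContinuousFunction.add_apply, BoundedContinuousFunction.mul_apply,
        BoundedContinuousFunction.smul_apply, BoundedContinuousFunction.sub_apply, indKern_apply,
        hp m x, hE₁a, hE₂a]
      by_cases hm0 : m = 0
      · subst hm0
        have hv : ((regVal p.1 p.2 0 (min |x| (2 * R)) : ℝ) : ℂ) =
            -Complex.sin ((k p * min |x| (2 * R) : ℝ) : ℂ) / (2 * (k p : ℂ)) := by
          rw [regVal, if_pos rfl, hkw]; push_cast; rfl
        rw [hv, Complex.sin]
        simp only [true_or, if_true, Complex.real_smul, smul_eq_mul]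
        norm_num
        by_cases hkp : k p = 0
        · simp [hkp]
        have : (k p : ℂ) ≠ 0 := by exact_mod_cast hkp
        field_simp
        ring_nf
      · by_cases hm1 : m = -1
        · subst hm1
          have hv : ((regVal p.1 p.2 (-1) (min |x| (2 * R)) : ℝ) : ℂ) =
              (Complex.exp (-((p.1 : ℂ) * ((min |x| (2 * R) : ℝ) : ℂ))) - 1) / (2 * (p.1 : ℂ)) := by
            rw [regVal, if_neg (by norm_num), if_pos rfl]; push_cast; rfl
          rw [hv, hM, dslope_of_ne _ hμ.ne', slope_def_module]
          simp only [BoundedContinuousFunction.smul_apply, BoundedContinuousFunction.sub_apply,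
            exp_kern_apply, BoundedContinuousFunction.neg_apply, absKern_apply, Complex.real_smul]
          have : (p.1 : ℂ) ≠ 0 := by exact_mod_cast hμ.ne'
          norm_num
          field_simp
        · simp [hm0, hm1]
    · rw [hkw]
      simp only [BoundedContinuousFunction.add_apply, BoundedContinuousFunction.mul_apply,
        BoundedContinuousFunction.smul_apply (c := (1 / 2 : ℝ) * (k p)⁻¹)]
      rw [hCa]
      congr 1
      simp only [BoundedContinuousFunction.smul_apply, indKern_apply]
      split_ifs
      · simp only [Complex.real_smul, smul_eq_mul]
        push_cast
        ring
      · simp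

end FullKernels

end

end RayleighBloch

namespace RayleighBloch

noncomputable section

/-! ### Regularity of the mode -/

/-- The complex wave number: `-i k_0` for `m = 0` and `k_m` for `m ≠ 0`. -/
def modeWave (μ β : ℝ) (m : ℤ) : ℂ :=
  if m = 0 then -(Complex.I * (waveNumber μ β 0 : ℂ)) else (waveNumber μ β m : ℂ)

/-- With `κ = -ik_0` one has `1/(2κ) = i/(2k_0)`, so the propagating mode is covered by the same
kernel calculus as the evanescent ones. -/
theorem green_eq_expKernel (μ β : ℝ) (m : ℤ) : green μ β m = expKernel (modeWave μ β m) := by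
  ext x
  unfold green expKernel modeWave
  split_ifs with h
  · have h1 : -(-(Complex.I * (waveNumber μ β 0 : ℂ)) * ((|x| : ℝ) : ℂ)) =
        Complex.I * (waveNumber μ β 0 : ℂ) * ((|x| : ℝ) : ℂ) := by ring
    rw [h1]
    by_cases h0 : (waveNumber μ β 0 : ℂ) = 0
    · simp [h0]
    · rw [div_mul_eq_mul_div, div_eq_div_iff (by simpa using h0) (by simpa using h0)]
      linear_combination (-2 * (waveNumber μ β 0 : ℂ) *
        Complex.exp (Complex.I * (waveNumber μ β 0 : ℂ) * ((|x| : ℝ) : ℂ))) * Complex.I_sq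
  · push_cast; rfl

theorem waveNumber_of_ne {μ β : ℝ} {m : ℤ} (h0 : m ≠ 0) (h1 : m ≠ -1) :
    waveNumber μ β m = √(((m : ℝ) + 1) * (2 * β + m - 1) + μ ^ 2) := by
  rw [waveNumber, if_neg h0, if_neg h1, waveNumber_sq_eq]

/-! ### Dispersion relation and growth of the wave numbers -/

section ModeWave

variable {μ β : ℝ}

theorem waveNumber_zero_pos (hk : 0 < 1 - 2 * β - μ ^ 2) : 0 < waveNumber μ β 0 := by
  simpa [waveNumber] using Real.sqrt_pos.2 hk

theorem le_waveNumber (h0 : 0 < β) (h1 : β < 1 / 2) {m : ℤ} (hm : m ≠ 0) :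
    μ ≤ waveNumber μ β m := by
  by_cases hm1 : m = -1
  · simp [waveNumber, hm1]
  · rw [waveNumber_of_ne hm hm1]
    refine Real.le_sqrt_of_sq_le ?_
    have := (mul_sq_le_waveSq h0 h1 hm hm1).1
    have : 0 ≤ β * ((m : ℝ) + 1) ^ 2 := by positivity
    linarith

theorem modeWave_ne_zero (hμ : 0 < μ) (h0 : 0 < β) (h1 : β < 1 / 2) (hk : 0 < 1 - 2 * β - μ ^ 2)
    (m : ℤ) : modeWave μ β m ≠ 0 := by
  unfold modeWave
  split_ifs with hm
  · have := (waveNumber_zero_pos hk).ne'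
    simp [this]
  · have := (hμ.trans_le (le_waveNumber h0 h1 hm)).ne'
    exact_mod_cast this

theorem modeWave_sq (h0 : 0 < β) (h1 : β < 1 / 2) (hk : 0 < 1 - 2 * β - μ ^ 2)
    (m : ℤ) : modeWave μ β m ^ 2 = ((β : ℂ) + m) ^ 2 - (omegaSq μ β : ℂ) := by
  have hreal : ((β : ℂ) + m) ^ 2 - (omegaSq μ β : ℂ) =
      ((((m : ℝ) + 1) * (2 * β + m - 1) + μ ^ 2 : ℝ) : ℂ) := by
    rw [← waveNumber_sq_eq]; push_cast; ring
  rw [hreal]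
  unfold modeWave
  split_ifs with hm
  · subst hm
    have : waveNumber μ β 0 ^ 2 = 1 - 2 * β - μ ^ 2 := by
      simp only [waveNumber, if_true]; exact Real.sq_sqrt hk.le
    have h' : (waveNumber μ β 0 : ℂ) ^ 2 = 1 - 2 * β - μ ^ 2 := by exact_mod_cast this
    rw [neg_sq, mul_pow, Complex.I_sq, h']
    push_cast; ring
  · rw [← Complex.ofReal_pow]
    congr 1
    by_cases hm1 : m = -1
    · subst hm1; simp [waveNumber]
    · rw [waveNumber_of_ne hm hm1, Real.sq_sqrt]
      have := (mul_sq_le_waveSq h0 h1 hm hm1).1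
      have h2 : 0 ≤ β * ((m : ℝ) + 1) ^ 2 := by positivity
      have : 0 ≤ μ ^ 2 := sq_nonneg μ
      linarith

theorem modeWave_re_nonneg (hμ : 0 < μ) (h0 : 0 < β) (h1 : β < 1 / 2) (m : ℤ) :
    0 ≤ (modeWave μ β m).re := by
  unfold modeWave
  split_ifs with hm
  · simp
  · rw [Complex.ofReal_re]; exact hμ.le.trans (le_waveNumber h0 h1 hm)

theorem le_modeWave_re (h0 : 0 < β) (h1 : β < 1 / 2) {m : ℤ} (hm : m ≠ 0) :
    μ ≤ (modeWave μ β m).re := by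
  rw [modeWave, if_neg hm, Complex.ofReal_re]; exact le_waveNumber h0 h1 hm

/-- Convolution with `G_m` therefore gains one power of `1 + |m|`. The three summands of the
constant serve `m ≠ 0, -1` (where `1 + |m| ≤ 3|m+1|`), `m = 0` and `m = -1`. -/
theorem exists_one_add_abs_le_modeWave (hμ : 0 < μ) (h0 : 0 < β) (h1 : β < 1 / 2)
    (hk : 0 < 1 - 2 * β - μ ^ 2) :
    ∃ K, 0 < K ∧ ∀ m : ℤ, 1 + |(m : ℝ)| ≤ K * ‖modeWave μ β m‖ := by
  have hk0 := waveNumber_zero_pos hk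
  have hs := Real.sqrt_pos.2 h0
  set k := waveNumber μ β 0
  have hp1 : 0 < 3 / √β := by positivity
  have hp2 : 0 < 1 / k := by positivity
  have hp3 : 0 < 2 / μ := by positivity
  refine ⟨3 / √β + 1 / k + 2 / μ, by positivity, fun m => ?_⟩
  have hn := norm_nonneg (modeWave μ β m)
  by_cases hm : m = 0
  · subst hm
    have : ‖modeWave μ β 0‖ = k := by
      rw [modeWave, if_pos rfl, norm_neg, norm_mul, Complex.norm_I, one_mul, Complex.norm_real,
        Real.norm_of_nonneg hk0.le]
    rw [this]
    have h2 : 1 / k * k = 1 := by field_simp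
    simp only [Int.cast_zero, abs_zero]
    nlinarith [mul_pos hp1 hk0, mul_pos hp3 hk0]
  · have hw : ‖modeWave μ β m‖ = waveNumber μ β m := by
      rw [modeWave, if_neg hm, Complex.norm_real,
        Real.norm_of_nonneg (hμ.le.trans (le_waveNumber h0 h1 hm))]
    have hwp : 0 < waveNumber μ β m := hμ.trans_le (le_waveNumber h0 h1 hm)
    rw [hw]
    by_cases hm1 : m = -1
    · subst hm1
      have : waveNumber μ β (-1) = μ := by simp [waveNumber]
      rw [this]
      have h2 : 2 / μ * μ = 2 := by field_simp
      simp only [Int.cast_neg, Int.cast_one, abs_neg, abs_one]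
      nlinarith [mul_pos hp1 hμ, mul_pos hp2 hμ]
    · obtain ⟨h2, h3⟩ := mul_sq_le_waveSq h0 h1 hm hm1
      have h4 : √β * |(m : ℝ) + 1| ≤ waveNumber μ β m := by
        rw [waveNumber_of_ne hm hm1, ← Real.sqrt_sq_eq_abs, ← Real.sqrt_mul h0.le]
        exact Real.sqrt_le_sqrt (by nlinarith [sq_nonneg μ])
      have h5 : |(m : ℝ)| ≤ |(m : ℝ) + 1| + 1 := by
        have := abs_sub_le ((m : ℝ) + 1) 0 1
        have := abs_add_le ((m : ℝ) + 1) (-1)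
        simpa using this
      have h6 : 3 * |(m : ℝ) + 1| ≤ 3 / √β * waveNumber μ β m := by
        rw [div_mul_eq_mul_div, le_div_iff₀ hs]; nlinarith
      nlinarith [mul_pos hp2 hwp, mul_pos hp3 hwp]

end ModeWave

/-- The functions `u_m = G_m * Y_m`. -/
def modeCoef {R : ℝ} (μ β : ℝ) (Y : VecSpace R) (m : ℤ) : ℝ → ℂ := conv (green μ β m) (Y m)

theorem mode_eq_synthesis {R : ℝ} (μ β : ℝ) (Y : VecSpace R) :
    mode μ β Y = synthesis β (modeCoef μ β Y) := rfl

theorem modeCoef_eq_expConv {R : ℝ} (μ β : ℝ) (Y : VecSpace R) (m : ℤ) :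
    modeCoef μ β Y m = expConv (modeWave μ β m) (zeroExt (Y m)) := by
  ext x
  unfold modeCoef conv expConv
  rw [green_eq_expKernel]

/-- The data of a solution of `Y = 2 γ ε ∑_n f_{m-n} (G_n * Y_n)` that does not radiate. -/
structure IsModeData (f : ℝ × ℝ → ℝ) (R ε μ β : ℝ) (Y : VecSpace R) : Prop where
  strip : IsStripFunction f R
  R_nonneg : 0 ≤ R
  mu_pos : 0 < μ
  beta_pos : 0 < β
  beta_lt : β < 1 / 2
  wave_pos : 0 < 1 - 2 * β - μ ^ 2
  eqn : ∀ (m : ℤ) (x : Icc (-R) R), HasSum (fun n : ℤ => 2 * (gam μ β : ℂ) * ε *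
    (conv (green μ β n) (Y n) (x : ℝ) * fourierCoef f (m - n) (x : ℝ))) (Y m x)
  no_radiation : ∀ x : ℝ, R < |x| → conv (green μ β 0) (Y 0) x = 0

/-! ### Decay, smoothness and differential equation of the mode -/

namespace IsModeData

variable {f : ℝ × ℝ → ℝ} {R ε μ β : ℝ} {Y : VecSpace R}

theorem norm_exp_le_one (h : IsModeData f R ε μ β Y) (m : ℤ) (t : ℝ) :
    ‖Complex.exp (-(modeWave μ β m * (|t| : ℝ)))‖ ≤ 1 := by
  rw [Complex.norm_exp]
  refine Real.exp_le_one_iff.2 ?_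
  have := mul_nonneg (modeWave_re_nonneg h.mu_pos h.beta_pos h.beta_lt m) (abs_nonneg t)
  simp
  linarith

theorem wave_ne (h : IsModeData f R ε μ β Y) (m : ℤ) : modeWave μ β m ≠ 0 :=
  modeWave_ne_zero h.mu_pos h.beta_pos h.beta_lt h.wave_pos m

theorem norm_green_le (h : IsModeData f R ε μ β Y) (m : ℤ) (t : ℝ) :
    ‖green μ β m t‖ ≤ (2 * ‖modeWave μ β m‖)⁻¹ := by
  rw [green_eq_expKernel, expKernel, norm_div, norm_mul, Complex.norm_ofNat, div_eq_mul_inv]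
  exact mul_le_of_le_one_left (by positivity) (h.norm_exp_le_one m t)

theorem continuous_green (μ β : ℝ) (m : ℤ) : Continuous (green μ β m) := by
  rw [green_eq_expKernel]
  unfold expKernel
  fun_prop

theorem continuous_modeCoef (h : IsModeData f R ε μ β Y) (m : ℤ) :
    Continuous (modeCoef μ β Y m) :=
  continuous_conv (continuous_green μ β m) (h.norm_green_le m) (Y m)

theorem norm_modeCoef_le (h : IsModeData f R ε μ β Y) (m : ℤ) (x : ℝ) :
    ‖modeCoef μ β Y m x‖ ≤ R * ‖modeWave μ β m‖⁻¹ * ‖Y m‖ := by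
  refine (norm_integral_mul_zeroExt_le h.R_nonneg (h := fun ξ => green μ β m (x - ξ))
    (fun ξ => h.norm_green_le m _) (Y m)).trans_eq ?_
  rw [mul_inv]; ring

theorem summable_eqn (h : IsModeData f R ε μ β Y) (m : ℤ) (x : ℝ) :
    Summable fun n => fourierCoef f (m - n) x * modeCoef μ β Y n x := by
  obtain ⟨C, hC⟩ := h.strip.rapid_fourierCoef 2
  obtain ⟨K, hK0, hK⟩ := exists_one_add_abs_le_modeWave h.mu_pos h.beta_pos h.beta_lt h.wave_pos
  have hC0 : 0 ≤ C := le_trans (by positivity) (hC 0 0)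
  refine Summable.of_norm_bounded (g := fun n : ℤ =>
    (C * (R * K * ‖Y‖)) * (1 / (1 + |((m - n : ℤ) : ℝ)|) ^ 2)) ?_ fun n => ?_
  · exact (((Equiv.subLeft m).summable_iff
      (f := fun n : ℤ => 1 / (1 + |(n : ℝ)|) ^ 2)).2 summable_inv_one_add_abs_sq).mul_left _
  · rw [norm_mul]
    have h1 : ‖fourierCoef f (m - n) x‖ ≤ C * (1 / (1 + |((m - n : ℤ) : ℝ)|) ^ 2) := by
      rw [mul_one_div, le_div_iff₀ (by positivity), mul_comm]; exact hC _ _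
    have h2 : ‖modeCoef μ β Y n x‖ ≤ R * K * ‖Y‖ := by
      refine (h.norm_modeCoef_le n x).trans ?_
      have hw := norm_pos_iff.2 (h.wave_ne n)
      have h3 : ‖modeWave μ β n‖⁻¹ ≤ K := by
        rw [inv_le_iff_one_le_mul₀ hw]
        have := hK n
        have := abs_nonneg (n : ℝ)
        linarith
      have h4 : ‖Y n‖ ≤ ‖Y‖ := lp.norm_apply_le_norm (by norm_num) Y n
      have := h.R_nonneg
      gcongr
    calc _ ≤ (C * (1 / (1 + |((m - n : ℤ) : ℝ)|) ^ 2)) * (R * K * ‖Y‖) := by gcongr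
      _ = _ := by ring

/-- The equation, given on `[-R, R]`, extends to the whole line because every `f_j` vanishes
outside. -/
theorem zeroExt_eq (h : IsModeData f R ε μ β Y) (m : ℤ) (x : ℝ) :
    zeroExt (Y m) x = 2 * (gam μ β : ℂ) * ε * indexConv (fourierCoef f) (modeCoef μ β Y) m x := by
  by_cases hx : x ∈ Icc (-R) R
  · rw [zeroExt_of_mem _ hx]
    refine (h.eqn m ⟨x, hx⟩).unique ?_
    have := (h.summable_eqn m x).hasSum.mul_left (2 * (gam μ β : ℂ) * ε)
    convert! this using 2 with n
    rw [mul_comm (fourierCoef f (m - n) x)]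
    rfl
  · rw [zeroExt_of_notMem _ hx]
    have hx' : R ≤ |x| := (not_le.1 fun h' => hx (abs_le.1 h')).le
    simp [indexConv, h.strip.fourierCoef_eq_zero hx']

/-- The components decay faster than any power of the index. -/
theorem rapid_norm (h : IsModeData f R ε μ β Y) (N : ℕ) :
    ∃ C, 0 ≤ C ∧ ∀ m : ℤ, (1 + |(m : ℝ)|) ^ N * ‖Y m‖ ≤ C := by
  obtain ⟨K, hK0, hK⟩ := exists_one_add_abs_le_modeWave h.mu_pos h.beta_pos h.beta_lt h.wave_pos
  induction N with
  | zero => exact ⟨‖Y‖, norm_nonneg _, fun m => by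
      simpa using lp.norm_apply_le_norm (by norm_num) Y m⟩
  | succ N ih =>
    obtain ⟨C, hC0, hC⟩ := ih
    -- `N + 1` powers carry the weight from `n` to `m`, two more give summability.
    obtain ⟨D, hD⟩ := h.strip.rapid_fourierCoef (N + 3)
    have hD0 : 0 ≤ D := le_trans (by positivity) (hD 0 0)
    have hR := h.R_nonneg
    set S := ∑' n : ℤ, 1 / (1 + |(n : ℝ)|) ^ 2 with hS
    have hS0 : 0 ≤ S := tsum_nonneg fun n => by positivity
    -- The bootstrap: dividing by the wave number raises the decay by one order.
    have hu : ∀ (n : ℤ) (x : ℝ),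
        (1 + |(n : ℝ)|) ^ (N + 1) * ‖modeCoef μ β Y n x‖ ≤ R * K * C := by
      intro n x
      have hw := norm_pos_iff.2 (h.wave_ne n)
      have h3 : (1 + |(n : ℝ)|) * ‖modeWave μ β n‖⁻¹ ≤ K := by
        rw [← div_eq_mul_inv, div_le_iff₀ hw]; exact hK n
      calc _ ≤ (1 + |(n : ℝ)|) ^ (N + 1) * (R * ‖modeWave μ β n‖⁻¹ * ‖Y n‖) := by
            gcongr; exact h.norm_modeCoef_le n x
        _ = R * ((1 + |(n : ℝ)|) * ‖modeWave μ β n‖⁻¹) * ((1 + |(n : ℝ)|) ^ N * ‖Y n‖) := by ring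
        _ ≤ R * K * C := by gcongr; exact hC n
    set z : ℂ := 2 * (gam μ β : ℂ) * ε
    refine ⟨‖z‖ * (D * (R * K * C) * S), by positivity, fun m => ?_⟩
    have hpos : 0 < (1 + |(m : ℝ)|) ^ (N + 1) := by positivity
    rw [← le_div_iff₀' hpos]
    refine (ContinuousMap.norm_le _ (by positivity)).2 fun x => ?_
    rw [le_div_iff₀' hpos, ← zeroExt_of_mem (Y m) x.2, h.zeroExt_eq, norm_mul, mul_left_comm]
    refine mul_le_mul_of_nonneg_left ?_ (norm_nonneg z)
    have hterm : ∀ n : ℤ, ‖fourierCoef f (m - n) x * modeCoef μ β Y n x‖ ≤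
        ((1 + |(m : ℝ)|) ^ (N + 1))⁻¹ * (D * (R * K * C)) *
          (1 / (1 + |((m - n : ℤ) : ℝ)|) ^ 2) := by
      intro n
      rw [mul_assoc, mul_one_div, ← div_eq_inv_mul, le_div_iff₀' hpos, le_div_iff₀ (by positivity)]
      calc _ ≤ ((1 + |((m - n : ℤ) : ℝ)|) * (1 + |(n : ℝ)|)) ^ (N + 1) *
            ‖fourierCoef f (m - n) x * modeCoef μ β Y n x‖ *
              (1 + |((m - n : ℤ) : ℝ)|) ^ 2 := by
            gcongr; exact one_add_abs_le_mul m n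
        _ = ((1 + |((m - n : ℤ) : ℝ)|) ^ (N + 3) * ‖fourierCoef f (m - n) x‖) *
            ((1 + |(n : ℝ)|) ^ (N + 1) * ‖modeCoef μ β Y n x‖) := by rw [norm_mul, mul_pow]; ring
        _ ≤ D * (R * K * C) := mul_le_mul (hD _ _) (hu n x) (by positivity) hD0
    have hsum : Summable fun n : ℤ => 1 / (1 + |((m - n : ℤ) : ℝ)|) ^ 2 :=
      ((Equiv.subLeft m).summable_iff
        (f := fun n : ℤ => 1 / (1 + |(n : ℝ)|) ^ 2)).2 summable_inv_one_add_abs_sq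
    have hSm : ∑' n : ℤ, 1 / (1 + |((m - n : ℤ) : ℝ)|) ^ 2 = S :=
      (Equiv.subLeft m).tsum_eq (fun n : ℤ => 1 / (1 + |(n : ℝ)|) ^ 2)
    have := tsum_of_norm_bounded (hsum.mul_left
      (((1 + |(m : ℝ)|) ^ (N + 1))⁻¹ * (D * (R * K * C)))).hasSum hterm
    rw [tsum_mul_left, hSm] at this
    rw [← le_div_iff₀' hpos]
    refine (this : ‖indexConv (fourierCoef f) (modeCoef μ β Y) m x‖ ≤ _).trans_eq ?_
    rw [div_eq_inv_mul]; ring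

/-- A priori an extension by zero may jump at `±R`. The equation exhibits it as a uniformly
convergent sum of functions continuous on the whole line. -/
theorem continuous_zeroExt (h : IsModeData f R ε μ β Y) (m : ℤ) : Continuous (zeroExt (Y m)) := by
  have hfun : zeroExt (Y m) = fun x =>
      2 * (gam μ β : ℂ) * ε * indexConv (fourierCoef f) (modeCoef μ β Y) m x :=
    funext (h.zeroExt_eq m)
  rw [hfun]
  have hu0 : RapidFam 0 (modeCoef μ β Y) := by
    intro N
    obtain ⟨C, hC0, hC⟩ := h.rapid_norm N
    obtain ⟨K, hK0, hK⟩ := exists_one_add_abs_le_modeWave h.mu_pos h.beta_pos h.beta_lt h.wave_pos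
    have hR := h.R_nonneg
    refine ⟨R * K * C, by positivity, fun n x => ?_⟩
    have hw := norm_pos_iff.2 (h.wave_ne n)
    have h3 : ‖modeWave μ β n‖⁻¹ ≤ K := by
      rw [inv_le_iff_one_le_mul₀ hw]
      have := hK n
      have := abs_nonneg (n : ℝ)
      linarith
    rw [zero_mul, neg_zero, Real.exp_zero, mul_one]
    calc _ ≤ (1 + |(n : ℝ)|) ^ N * (R * ‖modeWave μ β n‖⁻¹ * ‖Y n‖) := by
          gcongr; exact h.norm_modeCoef_le n x
      _ = R * ‖modeWave μ β n‖⁻¹ * ((1 + |(n : ℝ)|) ^ N * ‖Y n‖) := by ring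
      _ ≤ R * K * C := by gcongr; exact hC n
  have h1 : SmoothFam 0 0 (modeCoef μ β Y) := ⟨hu0, h.continuous_modeCoef⟩
  have h2 := SmoothFam.indexConv le_rfl (h.strip.smoothFam_fourierCoef 0) h1
  exact continuous_const.mul (h2.2 m)

theorem zeroExt_eq_zero (Y : VecSpace R) (m : ℤ) (x : ℝ) (hx : R < |x|) : zeroExt (Y m) x = 0 :=
  zeroExt_of_notMem _ fun h => not_lt.2 (abs_le.2 h) hx

/-- The derivative of `modeCoef`. -/
def _root_.RayleighBloch.modeCoefDeriv (μ β : ℝ) (Y : VecSpace R) (m : ℤ) : ℝ → ℂ :=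
  expConvDeriv (modeWave μ β m) (zeroExt (Y m))

theorem hasDerivAt_modeCoef (h : IsModeData f R ε μ β Y) (m : ℤ) (x : ℝ) :
    HasDerivAt (modeCoef μ β Y m) (modeCoefDeriv μ β Y m x) x := by
  rw [modeCoef_eq_expConv]
  exact hasDerivAt_expConv (h.wave_ne m) (h.continuous_zeroExt m) (zeroExt_eq_zero Y m) x

theorem hasDerivAt_modeCoefDeriv (h : IsModeData f R ε μ β Y) (m : ℤ) (x : ℝ) :
    HasDerivAt (modeCoefDeriv μ β Y m)
      (modeWave μ β m ^ 2 * modeCoef μ β Y m x - zeroExt (Y m) x) x := by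
  rw [modeCoef_eq_expConv]
  exact hasDerivAt_expConvDeriv (h.continuous_zeroExt m) (zeroExt_eq_zero Y m) x

/-- For `m = 0` the exponential is unimodular, so the bound can be used only for `|x| ≤ R`, where
the right-hand side is at least `1`. Beyond that, `no_radiation` takes over. -/
theorem norm_exp_modeWave_le (h : IsModeData f R ε μ β Y) {m : ℤ} {x : ℝ}
    (hmx : m ≠ 0 ∨ |x| ≤ R) (ξ : ℝ) (hξ : |ξ| ≤ R) :
    ‖Complex.exp (-(modeWave μ β m * (|x - ξ| : ℝ)))‖ ≤
      Real.exp (μ * R) * Real.exp (-(μ * |x|)) := by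
  by_cases hm : m = 0
  · refine (h.norm_exp_le_one m (x - ξ)).trans ?_
    have hx := hmx.resolve_left (not_not.2 hm)
    rw [← Real.exp_add, Real.one_le_exp_iff]
    have := mul_le_mul_of_nonneg_left hx h.mu_pos.le
    linarith
  · exact norm_exp_abs_le h.mu_pos.le (le_modeWave_re h.beta_pos h.beta_lt hm) hξ

theorem norm_modeCoef_le_exp (h : IsModeData f R ε μ β Y) (m : ℤ) (x : ℝ) :
    ‖modeCoef μ β Y m x‖ ≤ ‖modeWave μ β m‖⁻¹ *
      (R * (Real.exp (μ * R) * Real.exp (-(μ * |x|)) * ‖Y m‖)) := by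
  by_cases hmx : m ≠ 0 ∨ |x| ≤ R
  · rw [modeCoef_eq_expConv]
    exact norm_expConv_le h.R_nonneg (h.wave_ne m) (h.continuous_zeroExt m) (zeroExt_eq_zero Y m)
      (by positivity) (norm_zeroExt_le' (Y m)) (h.norm_exp_modeWave_le hmx)
  · push Not at hmx
    have hz : modeCoef μ β Y m x = 0 := by rw [hmx.1]; exact h.no_radiation x hmx.2
    rw [hz, norm_zero]
    have := h.R_nonneg
    positivity

theorem norm_modeCoefDeriv_le_exp (h : IsModeData f R ε μ β Y) (m : ℤ) (x : ℝ) :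
    ‖modeCoefDeriv μ β Y m x‖ ≤
      R * (Real.exp (μ * R) * Real.exp (-(μ * |x|)) * ‖Y m‖) := by
  by_cases hmx : m ≠ 0 ∨ |x| ≤ R
  · exact norm_expConvDeriv_le h.R_nonneg (h.continuous_zeroExt m) (zeroExt_eq_zero Y m)
      (by positivity) (norm_zeroExt_le' (Y m)) (h.norm_exp_modeWave_le hmx)
  · push Not at hmx
    have hz : modeCoefDeriv μ β Y m x = 0 := by
      rw [hmx.1]
      refine (h.hasDerivAt_modeCoef 0 x).unique ?_
      refine (hasDerivAt_const x (0 : ℂ)).congr_of_eventuallyEq ?_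
      filter_upwards [continuous_abs.continuousAt.eventually_const_lt hmx.2] with t ht
      exact h.no_radiation t ht
    rw [hz, norm_zero]
    have := h.R_nonneg
    positivity

theorem rapidFam_modeCoefDeriv (h : IsModeData f R ε μ β Y) :
    RapidFam μ (modeCoefDeriv μ β Y) := by
  intro N
  obtain ⟨C, hC0, hC⟩ := h.rapid_norm N
  have hR := h.R_nonneg
  refine ⟨R * Real.exp (μ * R) * C, by positivity, fun m x => ?_⟩
  calc _ ≤ (1 + |(m : ℝ)|) ^ N *
        (R * (Real.exp (μ * R) * Real.exp (-(μ * |x|)) * ‖Y m‖)) := by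
        gcongr; exact h.norm_modeCoefDeriv_le_exp m x
    _ = R * Real.exp (μ * R) * ((1 + |(m : ℝ)|) ^ N * ‖Y m‖) * Real.exp (-(μ * |x|)) := by ring
    _ ≤ _ := by gcongr; exact hC m

theorem rapidFam_modeCoef (h : IsModeData f R ε μ β Y) : RapidFam μ (modeCoef μ β Y) := by
  intro N
  obtain ⟨C, hC0, hC⟩ := h.rapid_norm N
  obtain ⟨K, hK0, hK⟩ := exists_one_add_abs_le_modeWave h.mu_pos h.beta_pos h.beta_lt h.wave_pos
  have hR := h.R_nonneg
  refine ⟨K * (R * Real.exp (μ * R) * C), by positivity, fun m x => ?_⟩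
  have hw := norm_pos_iff.2 (h.wave_ne m)
  have h3 : ‖modeWave μ β m‖⁻¹ ≤ K := by
    rw [inv_le_iff_one_le_mul₀ hw]
    have := hK m
    have := abs_nonneg (m : ℝ)
    linarith
  calc _ ≤ (1 + |(m : ℝ)|) ^ N * (‖modeWave μ β m‖⁻¹ *
        (R * (Real.exp (μ * R) * Real.exp (-(μ * |x|)) * ‖Y m‖))) := by
        gcongr; exact h.norm_modeCoef_le_exp m x
    _ = ‖modeWave μ β m‖⁻¹ *
        (R * Real.exp (μ * R) * ((1 + |(m : ℝ)|) ^ N * ‖Y m‖)) * Real.exp (-(μ * |x|)) := by ring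
    _ ≤ _ := by gcongr; exact hC m

theorem norm_modeWave_sq_le (h : IsModeData f R ε μ β Y) : ∃ K : ℝ, ∀ m : ℤ,
    ‖modeWave μ β m ^ 2‖ ≤ K * (1 + |(m : ℝ)|) ^ 2 := by
  refine ⟨(1 + |β|) ^ 2 + |omegaSq μ β|, fun m => ?_⟩
  rw [modeWave_sq h.beta_pos h.beta_lt h.wave_pos]
  have h1 : ‖(β : ℂ) + m‖ ≤ (1 + |β|) * (1 + |(m : ℝ)|) := by
    simpa using norm_quasiWave_le β m
  calc _ ≤ ‖((β : ℂ) + m) ^ 2‖ + ‖(omegaSq μ β : ℂ)‖ := norm_sub_le _ _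
    _ ≤ ((1 + |β|) * (1 + |(m : ℝ)|)) ^ 2 + |omegaSq μ β| * (1 + |(m : ℝ)|) ^ 2 := by
        rw [norm_pow, Complex.norm_real, Real.norm_eq_abs]
        gcongr
        refine le_mul_of_one_le_right (abs_nonneg _) ?_
        have := abs_nonneg (m : ℝ)
        nlinarith
    _ = _ := by ring

/-- The three families are bootstrapped together: `u' = v`, `v' = k²u - Y`, and `Y` is an index
convolution of `u` with smooth coefficients. The factor `k_m²` is only quadratic in `m`, hence
harmless. -/
theorem smoothFam_modeCoef_aux (h : IsModeData f R ε μ β Y) (j : ℕ) :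
    SmoothFam μ j (modeCoef μ β Y) ∧ SmoothFam μ j (modeCoefDeriv μ β Y) ∧
      SmoothFam μ j fun m => zeroExt (Y m) := by
  have hY : ∀ {j}, SmoothFam μ j (modeCoef μ β Y) → SmoothFam μ j fun m => zeroExt (Y m) := by
    intro j hj
    have hfun : (fun m => zeroExt (Y m)) = fun m x =>
        2 * (gam μ β : ℂ) * ε * indexConv (fourierCoef f) (modeCoef μ β Y) m x := by
      ext m x; exact h.zeroExt_eq m x
    rw [hfun]
    exact (SmoothFam.indexConv h.mu_pos.le (h.strip.smoothFam_fourierCoef j) hj).const_mul _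
  induction j with
  | zero =>
    have h1 : SmoothFam μ 0 (modeCoef μ β Y) := ⟨h.rapidFam_modeCoef, h.continuous_modeCoef⟩
    exact ⟨h1, ⟨h.rapidFam_modeCoefDeriv, fun m =>
      continuous_iff_continuousAt.2 fun x => (h.hasDerivAt_modeCoefDeriv m x).continuousAt⟩, hY h1⟩
  | succ j ih =>
    have h1 := SmoothFam.mk_succ h.rapidFam_modeCoef h.hasDerivAt_modeCoef ih.2.1
    obtain ⟨K, hK⟩ := h.norm_modeWave_sq_le
    refine ⟨h1, SmoothFam.mk_succ h.rapidFam_modeCoefDeriv h.hasDerivAt_modeCoefDeriv ?_, hY h1⟩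
    have := (ih.1.mul_poly hK).add (ih.2.2.const_mul (-1))
    simpa only [neg_one_mul, ← sub_eq_add_neg] using this

theorem smoothFam_modeCoef (h : IsModeData f R ε μ β Y) (j : ℕ) :
    SmoothFam μ j (modeCoef μ β Y) := (h.smoothFam_modeCoef_aux j).1

theorem contDiff_mode (h : IsModeData f R ε μ β Y) : ContDiff ℝ ∞ (mode μ β Y) :=
  contDiff_infty_synthesis h.mu_pos.le h.smoothFam_modeCoef

theorem summable_modeTerm (h : IsModeData f R ε μ β Y) (p : ℝ × ℝ) :
    Summable (modeTerm μ β Y p) :=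
  (summable_norm_synthesis h.mu_pos.le h.rapidFam_modeCoef p).of_norm

/-- The mode and its gradient decay exponentially. -/
theorem exists_norm_mode_le (h : IsModeData f R ε μ β Y) : ∃ C, 0 ≤ C ∧ ∀ p : ℝ × ℝ,
    ‖mode μ β Y p‖ ≤ C * Real.exp (-(μ * |p.1|)) ∧
    ‖dx (mode μ β Y) p‖ ≤ C * Real.exp (-(μ * |p.1|)) ∧
    ‖dy (mode μ β Y) p‖ ≤ C * Real.exp (-(μ * |p.1|)) := by
  have hs := h.smoothFam_modeCoef 1
  obtain ⟨C₁, h₁, hC₁⟩ := exists_norm_synthesis_le (β := β) hs.rapid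
  obtain ⟨C₂, h₂, hC₂⟩ := exists_norm_synthesis_le (β := β) hs.2.2.rapid
  obtain ⟨C₃, h₃, hC₃⟩ := exists_norm_synthesis_le (β := β)
    (hs.rapid.mul_poly (norm_quasiWave_le β))
  rw [mode_eq_synthesis, dx_synthesis h.mu_pos.le hs, dy_synthesis h.mu_pos.le hs]
  refine ⟨C₁ + C₂ + C₃, by positivity, fun p => ⟨(hC₁ p).trans ?_, (hC₂ p).trans ?_,
    (hC₃ p).trans ?_⟩⟩ <;> gcongr <;> linarith

theorem boundaryCond_mode (h : IsModeData f R ε μ β Y) : BoundaryCond β (mode μ β Y) :=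
  boundaryCond_synthesis h.mu_pos.le (h.smoothFam_modeCoef 1)

/-- `∑_m e^{i(β+m)y} Y_m = ω² ε f Ψ`. -/
theorem synthesis_zeroExt (h : IsModeData f R ε μ β Y) (p : ℝ × ℝ) :
    synthesis β (fun m => zeroExt (Y m)) p =
      (omegaSq μ β : ℂ) * (ε : ℂ) * (f p : ℂ) * mode μ β Y p := by
  obtain ⟨x, y⟩ := p
  set a : ℤ → ℂ := fun j => fourierCoef f j x * Complex.exp (Complex.I * (j : ℂ) * (y : ℂ))
  set b : ℤ → ℂ := fun n =>
    Complex.exp (Complex.I * ((β : ℂ) + (n : ℂ)) * (y : ℂ)) * modeCoef μ β Y n x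
  have ha : HasSum a (2 * Real.pi * (f (x, y) : ℂ)) := h.strip.hasSum_fourierCoef x y
  have han : Summable fun j => ‖a j‖ := by
    obtain ⟨C, -, hC⟩ := (h.strip.smoothFam_fourierCoef 0).rapid.norm_le_summable le_rfl
    refine Summable.of_nonneg_of_le (fun _ => norm_nonneg _) (fun j => ?_)
      (summable_inv_one_add_abs_sq.mul_left C)
    have : ‖Complex.exp (Complex.I * (j : ℂ) * (y : ℂ))‖ = 1 := by rw [Complex.norm_exp]; simp
    rw [norm_mul, this, mul_one]
    exact hC j x
  have hbn : Summable fun n => ‖b n‖ :=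
    summable_norm_synthesis h.mu_pos.le h.rapidFam_modeCoef (x, y)
  have hb : ∑' n, b n = mode μ β Y (x, y) := rfl
  have hprod : Summable fun q : ℤ × ℤ => a q.1 * b q.2 := summable_mul_of_summable_norm han hbn
  -- This shear turns the absolutely convergent product of the two series into the double sum
  -- indexed by `m` and `n`.
  let e : ℤ × ℤ ≃ ℤ × ℤ :=
    { toFun := fun q => (q.1 - q.2, q.2), invFun := fun q => (q.1 + q.2, q.2)
      left_inv := fun q => by simp, right_inv := fun q => by simp }
  have hprod' : Summable fun q : ℤ × ℤ => a (q.1 - q.2) * b q.2 := e.summable_iff.2 hprod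
  have h1 : (2 * Real.pi * (f (x, y) : ℂ)) * mode μ β Y (x, y) =
      ∑' m, ∑' n, a (m - n) * b n := by
    rw [← ha.tsum_eq, ← hb, tsum_mul_tsum_of_summable_norm han hbn]
    rw [← hprod'.tsum_prod]
    exact (e.tsum_eq (fun q : ℤ × ℤ => a q.1 * b q.2)).symm
  have h2 : ∀ m : ℤ, ∑' n, a (m - n) * b n = Complex.exp (Complex.I * ((β : ℂ) + (m : ℂ)) * y) *
      indexConv (fourierCoef f) (modeCoef μ β Y) m x := by
    intro m
    rw [indexConv, ← tsum_mul_left]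
    congr 1; ext n
    have : Complex.exp (Complex.I * ((m - n : ℤ) : ℂ) * (y : ℂ)) *
        Complex.exp (Complex.I * ((β : ℂ) + (n : ℂ)) * (y : ℂ)) =
        Complex.exp (Complex.I * ((β : ℂ) + (m : ℂ)) * y) := by
      rw [← Complex.exp_add]; congr 1; push_cast; ring
    rw [← this]
    simp only [a, b]; ring
  have h3 : synthesis β (fun m => zeroExt (Y m)) (x, y) =
      2 * (gam μ β : ℂ) * ε * ((2 * Real.pi * (f (x, y) : ℂ)) * mode μ β Y (x, y)) := by
    rw [h1, ← tsum_mul_left, synthesis]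
    congr 1; ext m
    rw [h2, h.zeroExt_eq]; ring
  -- The Fourier series sums to `2πf`, and `2γ · 2π = ω²`.
  rw [h3, gam]
  have hpi : (Real.pi : ℂ) ≠ 0 := by exact_mod_cast Real.pi_ne_zero
  push_cast
  field_simp
  ring

/-- Termwise, `-u_m'' + (β+m)² u_m = ω² u_m + Y_m` by the dispersion relation, and the `Y_m`
synthesize to `ω²εfΨ`. -/
theorem helmholtz_mode (h : IsModeData f R ε μ β Y) (p : ℝ × ℝ) :
    -(dx (dx (mode μ β Y)) p + dy (dy (mode μ β Y)) p) =
      (omegaSq μ β : ℂ) * (1 + (ε : ℂ) * (f p : ℂ)) * mode μ β Y p := by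
  have hs := h.smoothFam_modeCoef 2
  have hw := norm_quasiWave_le β
  have hs2 : SmoothFam μ 1
      (fun m x => Complex.I * ((β : ℂ) + (m : ℂ)) * modeCoef μ β Y m x) := hs.of_succ.mul_poly hw
  have hμ := h.mu_pos.le
  rw [mode_eq_synthesis, dx_synthesis hμ hs.of_succ, dy_synthesis hμ hs.of_succ,
    dx_synthesis hμ hs.2.2, dy_synthesis hμ hs2]
  have hd : ∀ m, deriv (deriv (modeCoef μ β Y m)) = fun x =>
      modeWave μ β m ^ 2 * modeCoef μ β Y m x - zeroExt (Y m) x := by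
    intro m
    have h1 : deriv (modeCoef μ β Y m) = modeCoefDeriv μ β Y m :=
      funext fun x => (h.hasDerivAt_modeCoef m x).deriv
    rw [h1]
    exact funext fun x => (h.hasDerivAt_modeCoefDeriv m x).deriv
  have e1 := (summable_norm_synthesis (β := β) hμ hs.2.2.2.2.rapid p).of_norm.hasSum
  have e2 := (summable_norm_synthesis (β := β) hμ (hs2.rapid.mul_poly hw) p).of_norm.hasSum
  have e3 := (summable_norm_synthesis (β := β) hμ (h.smoothFam_modeCoef_aux 0).2.2.rapid
    p).of_norm.hasSum
  have e4 := (summable_norm_synthesis (β := β) hμ hs.rapid p).of_norm.hasSum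
  have hsum := (e1.add e2).neg
  have hsum' := e3.add (e4.mul_left (omegaSq μ β : ℂ))
  have key : -(synthesis β (fun m => deriv (deriv (modeCoef μ β Y m))) p +
      synthesis β (fun m x => Complex.I * ((β : ℂ) + (m : ℂ)) *
        (Complex.I * ((β : ℂ) + (m : ℂ)) * modeCoef μ β Y m x)) p) =
      synthesis β (fun m => zeroExt (Y m)) p +
        (omegaSq μ β : ℂ) * synthesis β (modeCoef μ β Y) p := by
    refine hsum.unique ?_
    convert! hsum' using 2 with m
    rw [hd, modeWave_sq h.beta_pos h.beta_lt h.wave_pos]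
    linear_combination (-Complex.exp (Complex.I * ((β : ℂ) + (m : ℂ)) * p.2) *
      ((β : ℂ) + m) ^ 2 * modeCoef μ β Y m p.1) * Complex.I_sq
  rw [key, h.synthesis_zeroExt, mode_eq_synthesis]
  ring

/-- Orthogonality kills `u_{-1}`, and its differential equation then kills `Y_{-1}`. The
contrapositive gives nontriviality of the mode. -/
theorem averageF_eq_zero (h : IsModeData f R ε μ β Y) (hz : ∀ p, mode μ β Y p = 0) :
    averageF Y = 0 := by
  have hu : ∀ x, modeCoef μ β Y (-1) x = 0 := by
    intro x
    have := integral_synthesis_coeff (β := β) h.mu_pos.le h.rapidFam_modeCoef (-1) x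
    have hz' : ∀ p, synthesis β (modeCoef μ β Y) p = 0 := hz
    simp only [hz', mul_zero, intervalIntegral.integral_zero] at this
    have hpi : (2 * Real.pi : ℂ) ≠ 0 := by
      have := Real.pi_ne_zero
      exact_mod_cast mul_ne_zero two_ne_zero this
    exact (mul_eq_zero.1 this.symm).resolve_left hpi
  have hu1 : ∀ x, modeCoefDeriv μ β Y (-1) x = 0 := by
    intro x
    refine (h.hasDerivAt_modeCoef (-1) x).unique ?_
    rw [funext hu]
    exact hasDerivAt_const x 0
  have hy : ∀ x, zeroExt (Y (-1)) x = 0 := by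
    intro x
    have h1 := h.hasDerivAt_modeCoefDeriv (-1) x
    rw [funext hu1, hu, mul_zero, zero_sub] at h1
    exact neg_eq_zero.1 (h1.unique (hasDerivAt_const x 0))
  simp [averageF, hy]

end IsModeData

end

end RayleighBloch

namespace RayleighBloch

noncomputable section

/-! ### Decaying functions in the strip: energy space and weak formulation -/

section Partial

variable {U : ℝ × ℝ → ℂ}

theorem hasDerivAt_dx (hU : Differentiable ℝ U) (p : ℝ × ℝ) :
    HasDerivAt (fun t => U (t, p.2)) (dx U p) p.1 := by
  have h : DifferentiableAt ℝ (fun t : ℝ => U (t, p.2)) p.1 := by fun_prop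
  exact h.hasDerivAt

theorem hasDerivAt_dy (hU : Differentiable ℝ U) (p : ℝ × ℝ) :
    HasDerivAt (fun t => U (p.1, t)) (dy U p) p.2 := by
  have h : DifferentiableAt ℝ (fun t : ℝ => U (p.1, t)) p.2 := by fun_prop
  exact h.hasDerivAt

theorem dx_eq_fderiv (hU : Differentiable ℝ U) (p : ℝ × ℝ) : dx U p = fderiv ℝ U p (1, 0) := by
  have h : HasFDerivAt U (fderiv ℝ U p) (p.1, p.2) := (hU p).hasFDerivAt
  exact (h.comp_hasDerivAt p.1 ((hasDerivAt_id p.1).prodMk (hasDerivAt_const p.1 p.2))).deriv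

theorem dy_eq_fderiv (hU : Differentiable ℝ U) (p : ℝ × ℝ) : dy U p = fderiv ℝ U p (0, 1) := by
  have h : HasFDerivAt U (fderiv ℝ U p) (p.1, p.2) := (hU p).hasFDerivAt
  exact (h.comp_hasDerivAt p.2 ((hasDerivAt_const p.2 p.1).prodMk (hasDerivAt_id p.2))).deriv

theorem contDiff_dx (hU : ContDiff ℝ ∞ U) : ContDiff ℝ ∞ (dx U) := by
  rw [funext (dx_eq_fderiv (hU.differentiable (by simp)))]
  exact (hU.fderiv_right (m := ∞) (by simp)).clm_apply contDiff_const

theorem contDiff_dy (hU : ContDiff ℝ ∞ U) : ContDiff ℝ ∞ (dy U) := by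
  rw [funext (dy_eq_fderiv (hU.differentiable (by simp)))]
  exact (hU.fderiv_right (m := ∞) (by simp)).clm_apply contDiff_const

end Partial

theorem measurableSet_strip : MeasurableSet strip := MeasurableSet.univ.prod measurableSet_Ioo

theorem memLp_exp_strip {c : ℝ} (hc : 0 < c) :
    MemLp (fun p : ℝ × ℝ => Real.exp (-(c * |p.1|))) 2 (volume.restrict strip) := by
  rw [memLp_two_iff_integrable_sq (Continuous.aestronglyMeasurable (by fun_prop))]
  have h1 : Integrable fun x : ℝ => Real.exp (-(2 * c) * |x|) := by
    have hl : IntegrableOn (fun x : ℝ => Real.exp (-(2 * c) * |x|)) (Iic 0) :=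
      (integrableOn_exp_mul_Iic (a := 2 * c) (by positivity) 0).congr_fun
        (fun x hx => by simp [abs_of_nonpos (mem_Iic.1 hx)]) measurableSet_Iic
    have hr : IntegrableOn (fun x : ℝ => Real.exp (-(2 * c) * |x|)) (Ioi 0) :=
      (integrableOn_exp_mul_Ioi (a := -(2 * c)) (by linarith) 0).congr_fun
        (fun x hx => by simp [abs_of_pos (mem_Ioi.1 hx)]) measurableSet_Ioi
    have := hl.union hr
    rwa [Iic_union_Ioi, integrableOn_univ] at this
  have h2 : Integrable (fun _ : ℝ => (1 : ℝ)) (volume.restrict (Ioo 0 (2 * Real.pi))) :=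
    integrable_const 1
  have h3 := h1.mul_prod h2
  rw [strip, Measure.volume_eq_prod, ← Measure.prod_restrict, Measure.restrict_univ]
  refine h3.congr (.of_forall fun p => ?_)
  simp only [mul_one, ← Real.exp_nat_mul]
  congr 1; push_cast; ring

theorem tendsto_eLpNorm_of_norm_le {α : Type*} [MeasurableSpace α] {ν : Measure α}
    {w : ℕ → α → ℂ} {G : α → ℝ} {K : ℝ} (hG : MemLp G 2 ν)
    (hw : ∀ n p, ‖w n p‖ ≤ K * (1 / ((n : ℝ) + 1)) * ‖G p‖) :
    Tendsto (fun n => eLpNorm (w n) 2 ν) atTop (𝓝 0) := by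
  have h1 : Tendsto (fun n : ℕ => ENNReal.ofReal (K * (1 / ((n : ℝ) + 1))) * eLpNorm G 2 ν)
      atTop (𝓝 0) := by
    have h2 := tendsto_one_div_add_atTop_nhds_zero_nat (𝕜 := ℝ) |>.const_mul K
    have h3 := ENNReal.tendsto_ofReal h2
    have h4 := ENNReal.Tendsto.mul_const h3 (b := eLpNorm G 2 ν) (Or.inr hG.2.ne)
    simpa using h4
  exact tendsto_of_tendsto_of_tendsto_of_le_of_le tendsto_const_nhds h1 (fun _ => zero_le)
    fun n => eLpNorm_le_mul_eLpNorm_of_ae_le_mul (.of_forall (hw n)) 2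

/-- A smooth cut-off function on the line. -/
theorem exists_cutoff : ∃ (χ : ℝ → ℝ) (L : ℝ), ContDiff ℝ ∞ χ ∧ 0 ≤ L ∧
    (∀ t, |χ t - 1| ≤ |t|) ∧ (∀ t, |deriv χ t| ≤ L) ∧
    ∀ t, 2 < |t| → χ t = 0 := by
  let χ : ContDiffBump (0 : ℝ) := ⟨1, 2, one_pos, one_lt_two⟩
  have hχ : ContDiff ℝ ∞ χ := χ.contDiff
  obtain ⟨L, hL⟩ := (hχ.continuous_deriv (by simp)).bounded_above_of_compact_support
    χ.hasCompactSupport.deriv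
  refine ⟨χ, L, hχ, (norm_nonneg _).trans (hL 0), fun t => ?_, hL, fun t ht => ?_⟩
  · by_cases ht : |t| ≤ 1
    · rw [χ.one_of_mem_closedBall (by simpa [χ] using ht)]; simp
    · have h1 := χ.nonneg (x := t)
      have h2 := χ.le_one (x := t)
      rw [abs_le]; constructor <;> linarith [not_le.1 ht]
  · exact χ.zero_of_le_dist (by simpa [χ] using ht.le)

/-- A smooth function that decays exponentially together with its gradient. -/
structure IsDecaying (C c : ℝ) (U : ℝ × ℝ → ℂ) : Prop where
  smooth : ContDiff ℝ ∞ U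
  rate_pos : 0 < c
  norm_le : ∀ p, ‖U p‖ ≤ C * Real.exp (-(c * |p.1|))
  norm_dx_le : ∀ p, ‖dx U p‖ ≤ C * Real.exp (-(c * |p.1|))
  norm_dy_le : ∀ p, ‖dy U p‖ ≤ C * Real.exp (-(c * |p.1|))

namespace IsDecaying

variable {C c β : ℝ} {U : ℝ × ℝ → ℂ}

theorem const_nonneg (h : IsDecaying C c U) : 0 ≤ C := by
  have := (norm_nonneg _).trans (h.norm_le (0, 0))
  simpa using this

theorem memLp_of_norm_le {V : ℝ × ℝ → ℂ} (hc : 0 < c) (hV : Continuous V)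
    (hle : ∀ p, ‖V p‖ ≤ C * Real.exp (-(c * |p.1|))) : MemLp V 2 (volume.restrict strip) :=
  ((memLp_exp_strip hc).const_mul C).mono' hV.aestronglyMeasurable (.of_forall hle)

/-- The cut-offs depend on `x` alone, so they respect the quasiperiodic conditions. Scaled to length
`n + 1`, they leave an error of order `1/(n+1)` times a fixed square-integrable function. -/
theorem memEnergySpace (h : IsDecaying C c U) (hb : BoundaryCond β U) :
    MemEnergySpace β U (dx U) (dy U) := by
  have hC := h.const_nonneg
  have hc := h.rate_pos
  refine ⟨memLp_of_norm_le hc h.smooth.continuous h.norm_le,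
    memLp_of_norm_le hc (contDiff_dx h.smooth).continuous h.norm_dx_le,
    memLp_of_norm_le hc (contDiff_dy h.smooth).continuous h.norm_dy_le, ?_⟩
  obtain ⟨χ, L, hχ, hL0, hχ1, hχL, hχ0⟩ := exists_cutoff
  have hUd : Differentiable ℝ U := h.smooth.differentiable (by simp)
  have hχd : Differentiable ℝ χ := hχ.differentiable (by simp)
  set s : ℕ → ℝ := fun n => 1 / ((n : ℝ) + 1)
  have hs : ∀ n, 0 < s n := fun n => Nat.one_div_pos_of_nat
  let Φ : ℕ → ℝ × ℝ → ℂ := fun n p => (χ (s n * p.1) : ℂ) * U p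
  have hdx : ∀ n p, dx (Φ n) p =
      ((deriv χ (s n * p.1) * s n : ℝ) : ℂ) * U p + (χ (s n * p.1) : ℂ) * dx U p := by
    intro n p
    have h1 : HasDerivAt (fun t => χ (s n * t)) (deriv χ (s n * p.1) * s n) p.1 := by
      have := (hχd (s n * p.1)).hasDerivAt.comp p.1 ((hasDerivAt_id p.1).const_mul (s n))
      rwa [mul_one] at this
    exact (h1.ofReal_comp.mul (hasDerivAt_dx hUd p)).deriv
  have hdy : ∀ n p, dy (Φ n) p = (χ (s n * p.1) : ℂ) * dy U p := fun n p =>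
    ((hasDerivAt_dy hUd p).const_mul (χ (s n * p.1) : ℂ)).deriv
  have hsx : ∀ n (x : ℝ), |s n * x| = s n * |x| := fun n x => by
    rw [abs_mul, abs_of_pos (hs n)]
  have hχs : ∀ n (x : ℝ), ‖((χ (s n * x) : ℂ) - 1)‖ ≤ s n * |x| := by
    intro n x
    rw [← Complex.ofReal_one, ← Complex.ofReal_sub, Complex.norm_real, Real.norm_eq_abs, ← hsx]
    exact hχ1 _
  have hG := memLp_exp_strip (half_pos hc)
  -- Half of the exponential absorbs the factor `|x|` coming from the cut-off error.
  have hexp : ∀ x : ℝ, (|x| + L) * Real.exp (-(c * |x|)) ≤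
      (2 / c + L) * Real.exp (-(c / 2 * |x|)) := by
    intro x
    have h1 : Real.exp (-(c * |x|)) = Real.exp (-(c / 2 * |x|)) * Real.exp (-(c / 2 * |x|)) := by
      rw [← Real.exp_add]; congr 1; ring
    have h2 : |x| * Real.exp (-(c / 2 * |x|)) ≤ 2 / c := by
      have h3 := Real.add_one_le_exp (c / 2 * |x|)
      rw [Real.exp_neg, ← div_eq_mul_inv, div_le_iff₀ (Real.exp_pos _), div_mul_eq_mul_div,
        le_div_iff₀ hc]
      linarith
    have h4 : Real.exp (-(c / 2 * |x|)) ≤ 1 := by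
      rw [Real.exp_le_one_iff]
      have := abs_nonneg x
      have : 0 ≤ c / 2 * |x| := by positivity
      linarith
    rw [h1]
    nlinarith [mul_nonneg hL0 (sub_nonneg.2 h4), Real.exp_pos (-(c / 2 * |x|)),
      mul_le_mul_of_nonneg_right h2 (Real.exp_pos (-(c / 2 * |x|))).le,
      mul_nonneg (mul_nonneg hL0 (sub_nonneg.2 h4)) (Real.exp_pos (-(c / 2 * |x|))).le]
  have hfin : ∀ (n : ℕ) (p : ℝ × ℝ) (z : ℂ),
      ‖z‖ ≤ s n * ((|p.1| + L) * (C * Real.exp (-(c * |p.1|)))) →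
      ‖z‖ ≤ C * (2 / c + L) * s n * ‖Real.exp (-(c / 2 * |p.1|))‖ := by
    intro n p z hz
    rw [Real.norm_of_nonneg (Real.exp_pos _).le]
    have := mul_le_mul_of_nonneg_left (hexp p.1) (mul_nonneg (hs n).le hC)
    linarith
  have hcut : ∀ (n : ℕ) (p : ℝ × ℝ) (z : ℂ), ‖z‖ ≤ C * Real.exp (-(c * |p.1|)) →
      ‖(χ (s n * p.1) : ℂ) * z - z‖ ≤ s n * (|p.1| * (C * Real.exp (-(c * |p.1|)))) := by
    intro n p z hz
    rw [← sub_one_mul, norm_mul, ← mul_assoc]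
    exact mul_le_mul (hχs n p.1) hz (norm_nonneg _) (mul_nonneg (hs n).le (abs_nonneg _))
  have hcut' : ∀ (n : ℕ) (p : ℝ × ℝ) (z : ℂ), ‖z‖ ≤ C * Real.exp (-(c * |p.1|)) →
      ‖(χ (s n * p.1) : ℂ) * z - z‖ ≤ C * (2 / c + L) * s n * ‖Real.exp (-(c / 2 * |p.1|))‖ := by
    intro n p z hz
    refine hfin n p _ ((hcut n p z hz).trans ?_)
    have := (hs n).le
    gcongr
    linarith
  refine ⟨Φ, fun n => ⟨?_, fun x => ?_, 2 / s n, fun x y hx _ => ?_⟩,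
    tendsto_eLpNorm_of_norm_le hG fun n p => hcut' n p (U p) (h.norm_le p),
    tendsto_eLpNorm_of_norm_le (K := C * (2 / c + L)) hG fun n p => ?_,
    tendsto_eLpNorm_of_norm_le (K := C * (2 / c + L)) hG fun n p => ?_⟩
  · have : ContDiff ℝ ∞ fun p : ℝ × ℝ => χ (s n * p.1) :=
      hχ.comp (contDiff_const.mul contDiff_fst)
    exact (Complex.ofRealCLM.contDiff.comp this).mul h.smooth
  · rw [hdy, hdy, (hb x).2]
    exact ⟨by simp only [Φ]; rw [(hb x).1]; ring, by ring⟩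
  · have : χ (s n * x) = 0 := hχ0 _ (by rw [hsx, mul_comm]; exact (div_lt_iff₀ (hs n)).1 hx)
    simp [Φ, this]
  · refine hfin n p _ ?_
    rw [Pi.sub_apply, hdx, add_sub_assoc]
    refine (norm_add_le _ _).trans ?_
    have h1 := hcut n p (dx U p) (h.norm_dx_le p)
    have h2 : ‖((deriv χ (s n * p.1) * s n : ℝ) : ℂ) * U p‖ ≤
        L * s n * (C * Real.exp (-(c * |p.1|))) := by
      rw [norm_mul, Complex.norm_real, norm_mul, Real.norm_of_nonneg (hs n).le, Real.norm_eq_abs]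
      have := (hs n).le
      gcongr
      exacts [hχL _, h.norm_le p]
    linarith
  · rw [Pi.sub_apply, hdy]
    exact hcut' n p _ (h.norm_dy_le p)

end IsDecaying

/-- An integral over the strip of a function that vanishes for `M < |x|`. -/
theorem setIntegral_strip_eq {g : ℝ × ℝ → ℂ} {M : ℝ}
    (hg : ∀ p ∈ strip, M < |p.1| → g p = 0) :
    ∫ p in strip, g p = ∫ p in Icc ((-M, 0) : ℝ × ℝ) (M, 2 * Real.pi), g p := by
  have h1 : Icc ((-M, 0) : ℝ × ℝ) (M, 2 * Real.pi) = Icc (-M) M ×ˢ Icc 0 (2 * Real.pi) :=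
    (Icc_prod_Icc _ _ _ _).symm
  have h2 : (Icc (-M) M ×ˢ Ioo 0 (2 * Real.pi) : Set (ℝ × ℝ)) =ᵐ[volume]
      (Icc (-M) M ×ˢ Icc 0 (2 * Real.pi) : Set (ℝ × ℝ)) :=
    Measure.set_prod_ae_eq (ae_eq_refl _) Ioo_ae_eq_Icc
  rw [h1, ← setIntegral_congr_set h2]
  refine setIntegral_eq_of_subset_of_forall_sdiff_eq_zero measurableSet_strip
    (prod_mono_left (subset_univ _)) fun p hp => ?_
  refine hg p hp.1 (not_le.1 fun h => hp.2 ⟨abs_le.1 h, hp.1.2⟩)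

/-- Green's identity in the strip for quasiperiodic functions. -/
theorem integral_grad_mul_conj_grad {β : ℝ} {U Φ : ℝ × ℝ → ℂ} (hU : ContDiff ℝ ∞ U)
    (hb : BoundaryCond β U) (hΦ : IsTest β Φ) :
    ∫ p in strip, (dx U p * (starRingEnd ℂ) (dx Φ p) + dy U p * (starRingEnd ℂ) (dy Φ p)) =
      ∫ p in strip, -(dx (dx U) p + dy (dy U) p) * (starRingEnd ℂ) (Φ p) := by
  obtain ⟨M, hM⟩ := hΦ.vanishes
  -- Test functions vanish only for `|x|` strictly beyond `M`; the larger box makes the lateral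
  -- boundary terms zero.
  set N := |M| + 1
  have hMN : M < N := by have := le_abs_self M; simp only [N]; linarith
  have hN : 0 < N := by positivity
  have hpi := Real.two_pi_pos
  have hΦd : Differentiable ℝ Φ := hΦ.smooth.differentiable (by simp)
  have hUx := contDiff_dx hU
  have hUy := contDiff_dy hU
  have hUxx := (contDiff_dx hUx).continuous
  have hUyy := (contDiff_dy hUy).continuous
  have hΦx := (contDiff_dx hΦ.smooth).continuous
  have hΦy := (contDiff_dy hΦ.smooth).continuous
  have hΦc := hΦ.smooth.continuous
  have hconj : ContDiff ℝ ∞ fun p => (starRingEnd ℂ) (Φ p) :=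
    (Complex.conjCLE : ℂ ≃L[ℝ] ℂ).contDiff.comp hΦ.smooth
  have hF : ContDiff ℝ ∞ fun p => dx U p * (starRingEnd ℂ) (Φ p) := hUx.mul hconj
  have hG : ContDiff ℝ ∞ fun p => dy U p * (starRingEnd ℂ) (Φ p) := hUy.mul hconj
  have hFd := hF.differentiable (by simp)
  have hGd := hG.differentiable (by simp)
  have hFx : ∀ p, fderiv ℝ (fun p => dx U p * (starRingEnd ℂ) (Φ p)) p (1, 0) =
      dx (dx U) p * (starRingEnd ℂ) (Φ p) + dx U p * (starRingEnd ℂ) (dx Φ p) := by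
    intro p
    rw [← dx_eq_fderiv hFd]
    exact ((hasDerivAt_dx (hUx.differentiable (by simp)) p).mul
      ((hasDerivAt_dx hΦd p).star)).deriv
  have hGy : ∀ p, fderiv ℝ (fun p => dy U p * (starRingEnd ℂ) (Φ p)) p (0, 1) =
      dy (dy U) p * (starRingEnd ℂ) (Φ p) + dy U p * (starRingEnd ℂ) (dy Φ p) := by
    intro p
    rw [← dy_eq_fderiv hGd]
    exact ((hasDerivAt_dy (hUy.differentiable (by simp)) p).mul
      ((hasDerivAt_dy hΦd p).star)).deriv
  have h0 : ∀ p ∈ strip, N < |p.1| → Φ p = 0 := fun p hp hpN =>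
    hM p.1 p.2 (hMN.trans hpN) (Ioo_subset_Icc_self hp.2)
  -- A test function is assumed to vanish only over one closed period, so its gradient is controlled
  -- in the open strip rather than in the plane.
  have hev : ∀ p ∈ strip, N < |p.1| → Φ =ᶠ[𝓝 p] 0 := by
    intro p hp hpN
    have ho : IsOpen strip := isOpen_univ.prod isOpen_Ioo
    have h1 : ∀ᶠ q : ℝ × ℝ in 𝓝 p, N < |q.1| :=
      (continuous_abs.comp continuous_fst).continuousAt.eventually_const_lt hpN
    filter_upwards [ho.mem_nhds hp, h1] with q hq hqN using h0 q hq hqN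
  have h0x : ∀ p ∈ strip, N < |p.1| → dx Φ p = 0 := by
    intro p hp hpN
    rw [dx_eq_fderiv hΦd, (hev p hp hpN).fderiv_eq]; simp
  have h0y : ∀ p ∈ strip, N < |p.1| → dy Φ p = 0 := by
    intro p hp hpN
    rw [dy_eq_fderiv hΦd, (hev p hp hpN).fderiv_eq]; simp
  rw [setIntegral_strip_eq (M := N) fun p hp hpN => by simp [h0x p hp hpN, h0y p hp hpN],
    setIntegral_strip_eq (M := N) fun p hp hpN => by simp [h0 p hp hpN]]
  have hi1 : IntegrableOn (fun p => dx U p * (starRingEnd ℂ) (dx Φ p) +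
      dy U p * (starRingEnd ℂ) (dy Φ p)) (Icc ((-N, 0) : ℝ × ℝ) (N, 2 * Real.pi)) :=
    Continuous.integrableOn_Icc (by
      have := hUx.continuous; have := hUy.continuous; fun_prop)
  have hi2 : IntegrableOn (fun p => -(dx (dx U) p + dy (dy U) p) * (starRingEnd ℂ) (Φ p))
      (Icc ((-N, 0) : ℝ × ℝ) (N, 2 * Real.pi)) :=
    Continuous.integrableOn_Icc (by fun_prop)
  have hsum : (fun p => fderiv ℝ (fun p => dx U p * (starRingEnd ℂ) (Φ p)) p (1, 0) +
      fderiv ℝ (fun p => dy U p * (starRingEnd ℂ) (Φ p)) p (0, 1)) = fun p =>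
      (dx U p * (starRingEnd ℂ) (dx Φ p) + dy U p * (starRingEnd ℂ) (dy Φ p)) -
      (-(dx (dx U) p + dy (dy U) p) * (starRingEnd ℂ) (Φ p)) := by
    ext p; rw [hFx, hGy]; ring
  have hdiv := integral_divergence_prod_Icc_of_hasFDerivAt_of_le
    (fun p => dx U p * (starRingEnd ℂ) (Φ p)) (fun p => dy U p * (starRingEnd ℂ) (Φ p))
    _ _ (-N, 0) (N, 2 * Real.pi) ⟨by simp only; linarith, hpi.le⟩
    hF.continuous.continuousOn hG.continuous.continuousOn
    (fun p _ => (hFd p).hasFDerivAt) (fun p _ => (hGd p).hasFDerivAt)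
    (by rw [hsum]; exact hi1.sub hi2)
  -- The unimodular phases of `U_y` and of the conjugate of `Φ` cancel, so the top and bottom fluxes
  -- agree.
  have hphase : ∀ x : ℝ, dy U (x, 2 * Real.pi) * (starRingEnd ℂ) (Φ (x, 2 * Real.pi)) =
      dy U (x, 0) * (starRingEnd ℂ) (Φ (x, 0)) := by
    intro x
    rw [(hb x).2, (hΦ.boundary x).1, map_mul]
    have : Complex.exp (2 * (Real.pi : ℂ) * Complex.I * (β : ℂ)) *
        (starRingEnd ℂ) (Complex.exp (2 * (Real.pi : ℂ) * Complex.I * (β : ℂ))) = 1 := by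
      rw [Complex.mul_conj, Complex.normSq_eq_norm_sq, Complex.norm_exp]
      simp
    linear_combination (dy U (x, 0) * (starRingEnd ℂ) (Φ (x, 0))) * this
  have hside : ∀ a : ℝ, |a| = N →
      ∫ y in (0 : ℝ)..2 * Real.pi, dx U (a, y) * (starRingEnd ℂ) (Φ (a, y)) = 0 := by
    intro a ha
    refine intervalIntegral.integral_zero_ae (.of_forall fun y hy => ?_)
    rw [uIoc_of_le hpi.le] at hy
    rw [hM a y (by rw [ha]; exact hMN) (Ioc_subset_Icc_self hy), map_zero, mul_zero]
  rw [hsum, integral_sub hi1 hi2] at hdiv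
  simp only [hphase, sub_self, zero_add] at hdiv
  rw [hside N (abs_of_pos hN), hside (-N) (by rw [abs_neg, abs_of_pos hN]), sub_zero,
    sub_eq_zero] at hdiv
  exact hdiv

theorem IsModeData.isFiniteEnergySolution {f : ℝ × ℝ → ℝ} {R ε μ β : ℝ} {Y : VecSpace R}
    (h : IsModeData f R ε μ β Y) :
    IsFiniteEnergySolution f ε (omegaSq μ β) β (mode μ β Y) := by
  obtain ⟨C, -, hC⟩ := h.exists_norm_mode_le
  have hd : IsDecaying C μ (mode μ β Y) :=
    ⟨h.contDiff_mode, h.mu_pos, fun p => (hC p).1, fun p => (hC p).2.1, fun p => (hC p).2.2⟩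
  refine ⟨h.contDiff_mode, fun x y => synthesis_quasiperiodic x y, h.boundaryCond_mode,
    h.helmholtz_mode, hd.memEnergySpace h.boundaryCond_mode, fun Φ hΦ => ?_⟩
  rw [integral_grad_mul_conj_grad h.contDiff_mode h.boundaryCond_mode hΦ,
    ← integral_const_mul]
  congr 1; ext p
  rw [h.helmholtz_mode]; ring

end

end RayleighBloch

namespace RayleighBloch

noncomputable section

/-! ### Symmetries of the perturbation -/

namespace IsPerturbation

variable {f : ℝ × ℝ → ℝ} {R : ℝ}

theorem fourierCoef_neg (hf : IsPerturbation f R) (j : ℤ) (x : ℝ) :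
    fourierCoef f j (-x) = fourierCoef f j x := by
  simp only [fourierCoef, hf.even_x]

/-- Evenness in `y` turns conjugation of the integrand into `y ↦ -y`, which does not change the
integral over a period. -/
theorem star_fourierCoef (hf : IsPerturbation f R) (j : ℤ) (x : ℝ) :
    star (fourierCoef f j x) = fourierCoef f j x := by
  set F : ℝ → ℂ := fun y => Complex.exp (-(Complex.I * (j : ℂ) * (y : ℂ))) * (f (x, y) : ℂ)
  have hper : Function.Periodic F (2 * Real.pi) := by
    intro y
    simp only [F, hf.periodic]
    congr 1
    rw [Complex.exp_eq_exp_iff_exists_int]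
    exact ⟨-j, by push_cast; ring⟩
  have hstar : ∀ y, star (F y) = F (-y) := by
    intro y
    simp only [F, star_mul', hf.even_y, Complex.star_def, ← Complex.exp_conj, Complex.conj_ofReal,
      map_neg, map_mul, Complex.conj_I, map_intCast]
    push_cast
    congr 2; ring
  have h1 : star (fourierCoef f j x) = ∫ y in (0 : ℝ)..2 * Real.pi, star (F y) := by
    simp only [fourierCoef, intervalIntegral.integral_of_le Real.two_pi_pos.le, Complex.star_def]
    exact integral_conj.symm
  rw [h1]
  simp only [hstar]
  rw [intervalIntegral.integral_comp_neg (f := F), neg_zero]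
  have := hper.intervalIntegral_add_eq (-(2 * Real.pi)) 0
  rwa [neg_add_cancel, zero_add] at this

/-- Evenness in `x` kills the sine part. The transform is thus real and is the radiation integral of
the source vector. -/
theorem fourierCoefHat_eq_integral_cos (hf : IsPerturbation f R) (j : ℤ) (s : ℝ) :
    fourierCoefHat f j s = ∫ x : ℝ, (Real.cos (s * x) : ℂ) * fourierCoef f j x := by
  have hst := hf.isStripFunction
  have hc : Continuous (fourierCoef f j) := (hst.smoothFam_fourierCoef 0).2 j
  have hcs : HasCompactSupport (fourierCoef f j) := by
    refine HasCompactSupport.intro (K := Icc (-R) R) isCompact_Icc fun x hx => ?_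
    exact hst.fourierCoef_eq_zero (not_le.1 fun h => hx (abs_le.1 h)).le j
  have hi1 : Integrable fun x : ℝ => (Real.cos (s * x) : ℂ) * fourierCoef f j x :=
    Continuous.integrable_of_hasCompactSupport (by fun_prop) hcs.mul_left
  have hi2 : Integrable fun x : ℝ => (Real.sin (s * x) : ℂ) * fourierCoef f j x :=
    Continuous.integrable_of_hasCompactSupport (by fun_prop) hcs.mul_left
  have hodd : ∫ x : ℝ, (Real.sin (s * x) : ℂ) * fourierCoef f j x = 0 := by
    have h := integral_neg_eq_self (fun x : ℝ => (Real.sin (s * x) : ℂ) * fourierCoef f j x) volume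
    simp only [mul_neg, Real.sin_neg, Complex.ofReal_neg, neg_mul, hf.fourierCoef_neg,
      integral_neg] at h
    exact self_eq_neg.1 h.symm
  have hsplit : ∀ x : ℝ, Complex.exp (-(Complex.I * (s : ℂ) * (x : ℂ))) * fourierCoef f j x =
      (Real.cos (s * x) : ℂ) * fourierCoef f j x -
        Complex.I * ((Real.sin (s * x) : ℂ) * fourierCoef f j x) := by
    intro x
    have : -(Complex.I * (s : ℂ) * (x : ℂ)) = ((-(s * x) : ℝ) : ℂ) * Complex.I := by
      push_cast; ring
    rw [this, Complex.exp_mul_I, ← Complex.ofReal_cos, ← Complex.ofReal_sin, Real.cos_neg,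
      Real.sin_neg]
    push_cast; ring
  unfold fourierCoefHat
  simp only [hsplit]
  rw [integral_sub hi1 (hi2.const_mul _), integral_const_mul, hodd, mul_zero, sub_zero]

theorem fourierCoefHat_im (hf : IsPerturbation f R) (j : ℤ) (s : ℝ) :
    (fourierCoefHat f j s).im = 0 := by
  rw [← Complex.conj_eq_iff_im, hf.fourierCoefHat_eq_integral_cos, ← integral_conj]
  congr 1; ext x
  rw [map_mul, Complex.conj_ofReal]
  congr 1
  exact hf.star_fourierCoef j x

theorem fourierCoefHat_zero_zero (f : ℝ × ℝ → ℝ) :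
    fourierCoefHat f 0 0 = ((∫ x : ℝ, ∫ y in (0 : ℝ)..(2 * Real.pi), f (x, y) : ℝ) : ℂ) := by
  rw [← integral_complex_ofReal]
  simp [fourierCoefHat, fourierCoef, intervalIntegral.integral_ofReal]

/-- The transform is real-valued, so its derivative is real and the simple zero survives taking real
parts. -/
theorem re_deriv_fourierCoefHat_ne_zero (hf : IsPerturbation f R) {j : ℤ} {s : ℝ}
    (h : deriv (fourierCoefHat f j) s ≠ 0) : (deriv (fourierCoefHat f j) s).re ≠ 0 := by
  have hd : DifferentiableAt ℝ (fourierCoefHat f j) s := by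
    by_contra hd; exact h (deriv_zero_of_not_differentiableAt hd)
  have him : HasDerivAt (fun t => (fourierCoefHat f j t).im) (deriv (fourierCoefHat f j) s).im s :=
    Complex.imCLM.hasFDerivAt.comp_hasDerivAt s hd.hasDerivAt
  simp only [hf.fourierCoefHat_im] at him
  have h0 := him.unique (hasDerivAt_const s 0)
  exact fun hre => h (Complex.ext hre h0)

end IsPerturbation

/-! ### The data of the operator equation -/

section Data

variable {f : ℝ × ℝ → ℝ} {R : ℝ}

/-- The Fourier coefficients as elements of `C[-R,R]`. -/
def coefMap (hf : IsStripFunction f R) (j : ℤ) : C(Icc (-R) R, ℂ) :=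
  ⟨fun x => fourierCoef f j x,
    ((hf.smoothFam_fourierCoef 0).2 j).comp continuous_subtype_val⟩

theorem coefMap_apply (hf : IsStripFunction f R) (j : ℤ) (x : Icc (-R) R) :
    coefMap hf j x = fourierCoef f j x := rfl

theorem summable_norm_coefMap (hf : IsStripFunction f R) : Summable fun j => ‖coefMap hf j‖ := by
  obtain ⟨C, hC⟩ := hf.rapid_fourierCoef 2
  have hC0 : 0 ≤ C := le_trans (by positivity) (hC 0 0)
  refine Summable.of_nonneg_of_le (fun _ => norm_nonneg _) (fun j => ?_)
    (summable_inv_one_add_abs_sq.mul_left C)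
  refine (ContinuousMap.norm_le _ (by positivity)).2 fun x => ?_
  rw [mul_one_div, le_div_iff₀ (by positivity), mul_comm]
  exact hC j x

theorem zeroExt_coefMap (hf : IsStripFunction f R) (j : ℤ) :
    zeroExt (coefMap hf j) = fourierCoef f j := by
  ext x
  by_cases hx : x ∈ Icc (-R) R
  · rw [zeroExt_of_mem _ hx, coefMap_apply]
  · rw [zeroExt_of_notMem _ hx, hf.fourierCoef_eq_zero]
    exact (not_le.1 fun h => hx (abs_le.1 h)).le

theorem memℓp_coefMap (hf : IsStripFunction f R) : Memℓp (fun m => coefMap hf (m + 1)) 2 := by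
  have h1 : Memℓp (fun m => coefMap hf (m + 1)) 1 := by
    refine memℓp_gen ?_
    refine (((Equiv.addRight (1 : ℤ)).summable_iff (f := fun j => ‖coefMap hf j‖)).2
      (summable_norm_coefMap hf)).congr fun m => ?_
    simp
  exact h1.of_exponent_ge (by norm_num)

/-- The vector `g⁽²⁾`. -/
def sourceVec (hf : IsStripFunction f R) : VecSpace R := ⟨_, memℓp_coefMap hf⟩

theorem sourceVec_apply (hf : IsStripFunction f R) (m : ℤ) :
    sourceVec hf m = coefMap hf (m + 1) := rfl

theorem reflect_sourceVec (hf : IsPerturbation f R) :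
    reflect (sourceVec hf.isStripFunction) = sourceVec hf.isStripFunction := by
  ext m x
  rw [reflect_apply, sourceVec_apply, coefMap_apply, coefMap_apply]
  exact hf.fourierCoef_neg _ _

theorem star_sourceVec (hf : IsPerturbation f R) :
    star (sourceVec hf.isStripFunction) = sourceVec hf.isStripFunction := by
  ext m x
  rw [lp.star_apply]
  exact hf.star_fourierCoef _ _

/-- The kernels of the full and of the reduced problem at given parameters. -/
structure IsKernelTriple (R μ β : ℝ) (h c k : Kern) : Prop where
  mu_pos : 0 < μ
  beta_pos : 0 < β
  beta_lt : β < 1 / 2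
  wave_pos : 0 < 1 - 2 * β - μ ^ 2
  reg : ∀ m x, h (m, x) = (regVal μ β m (min |x| (2 * R)) : ℂ)
  cosine : ∀ m x, c (m, x) = (Real.cos (waveNumber μ β 0 * min |x| (2 * R)) : ℂ)
  full : ∀ m x, k (m, x) = h (m, x) + if m = 0 then
    Complex.I / (2 * (waveNumber μ β 0 : ℂ)) *
      (Real.cos (waveNumber μ β 0 * min |x| (2 * R)) : ℂ) else 0

namespace IsKernelTriple

variable {μ β : ℝ} {h c k : Kern}

theorem reg_neg (hk : IsKernelTriple R μ β h c k) (n : ℤ) (t : ℝ) : h (n, -t) = h (n, t) := by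
  rw [hk.reg, hk.reg, abs_neg]

theorem full_neg (hk : IsKernelTriple R μ β h c k) (n : ℤ) (t : ℝ) : k (n, -t) = k (n, t) := by
  rw [hk.full, hk.full, hk.reg_neg, abs_neg]

theorem star_reg (hk : IsKernelTriple R μ β h c k) (n : ℤ) (t : ℝ) :
    star (h (n, t)) = h (n, t) := by
  rw [hk.reg]; exact Complex.conj_ofReal _

/-- At `m = 0` this is Euler's formula: `i e^{ika}/(2k)` is the standing part `-sin(ka)/(2k)` plus
`i cos(ka)/(2k)`. -/
theorem full_eq_greenReg (hk : IsKernelTriple R μ β h c k) (n : ℤ) {t : ℝ} (ht : |t| ≤ 2 * R) :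
    k (n, t) = greenReg μ β n t := by
  rw [hk.full, hk.reg, min_eq_left ht]
  by_cases h0 : n = 0
  · subst h0
    have hexp : Complex.I * (waveNumber μ β 0 : ℂ) * ((|t| : ℝ) : ℂ) =
        ((waveNumber μ β 0 * |t| : ℝ) : ℂ) * Complex.I := by push_cast; ring
    rw [if_pos rfl, greenReg, if_neg (by norm_num), green, if_pos rfl, regVal, if_pos rfl, hexp,
      Complex.exp_mul_I, ← Complex.ofReal_cos, ← Complex.ofReal_sin]
    have hne : (waveNumber μ β 0 : ℂ) ≠ 0 := by
      exact_mod_cast (waveNumber_zero_pos hk.wave_pos).ne'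
    push_cast
    field_simp
    linear_combination (-Complex.sin (waveNumber μ β 0 * ((|t| : ℝ) : ℂ))) * Complex.I_sq
  · rw [if_neg h0, add_zero, regVal, if_neg h0, greenReg]
    split_ifs with h1
    · rfl
    · rw [green, if_neg h0]

theorem isThat (hk : IsKernelTriple R μ β h c k) (hf : IsStripFunction f R) (hR : 0 ≤ R) :
    IsThat f R μ β ((2 * (gam μ β : ℂ)) • kernelOp hR (coefMap hf) k) := by
  intro A m x
  have h1 := (hasSum_kernelOp hR (summable_norm_coefMap hf) k A m x).mul_left
    (2 * (gam μ β : ℂ))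
  convert! h1 using 2 with n
  rw [conv_congr (A n) x.2 fun t ht => (hk.full_eq_greenReg n ht).symm, coefMap_apply,
    mul_comm (conv _ _ _)]

end IsKernelTriple

/-- Lets the unspecified operator in `IsResolventVector` be replaced by the constructed one. -/
theorem IsThat.unique {μ β : ℝ} {T T' : VecSpace R →L[ℂ] VecSpace R} (hT : IsThat f R μ β T)
    (hT' : IsThat f R μ β T') : T = T' := by
  ext A m x
  exact (hT A m x).unique (hT' A m x)

theorem apply_inverse_of_isUnit {𝕜 V : Type*} [NontriviallyNormedField 𝕜] [NormedAddCommGroup V]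
    [NormedSpace 𝕜 V] {T : V →L[𝕜] V} (hT : IsUnit T) (g : V) : T (Ring.inverse T g) = g :=
  congrArg (fun S : V →L[𝕜] V => S g) (Ring.mul_inverse_cancel _ hT)

theorem eq_inverse_of_isUnit {𝕜 V : Type*} [NontriviallyNormedField 𝕜] [NormedAddCommGroup V]
    [NormedSpace 𝕜 V] {T : V →L[𝕜] V} (hT : IsUnit T) {g Y : V} (h : T Y = g) : Y = Ring.inverse T g := by
  rw [← h]
  exact (congrArg (fun S : V →L[𝕜] V => S Y) (Ring.inverse_mul_cancel _ hT)).symm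

theorem isUnit_one_sub_of_norm_lt {V : Type*} [NormedAddCommGroup V] [NormedSpace ℂ V]
    [CompleteSpace V] {T : V →L[ℂ] V} (hT : ‖T‖ < 1) : IsUnit (1 - T) :=
  isUnit_one_sub_of_norm_lt_one hT

end Data

end

end RayleighBloch

namespace RayleighBloch

noncomputable section

/-! ### Full and reduced operator equations -/

section Equivalence

variable {f : ℝ × ℝ → ℝ} {R : ℝ}

theorem zeroExt_neg_of_reflect {A : VecSpace R} (hA : reflect A = A) (m : ℤ) (x : ℝ) :
    zeroExt (A m) (-x) = zeroExt (A m) x := by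
  rw [← zeroExt_reflect, hA]

theorem integral_sin_mul_zeroExt {A : VecSpace R} (hA : reflect A = A) (m : ℤ) (w : ℝ) :
    ∫ ξ : ℝ, (Real.sin (w * ξ) : ℂ) * zeroExt (A m) ξ = 0 := by
  have h := integral_neg_eq_self (fun x : ℝ => (Real.sin (w * x) : ℂ) * zeroExt (A m) x) volume
  simp only [mul_neg, Real.sin_neg, Complex.ofReal_neg, neg_mul, zeroExt_neg_of_reflect hA,
    integral_neg] at h
  exact self_eq_neg.1 h.symm

theorem integrable_cos_mul_zeroExt (a : C(Icc (-R) R, ℂ)) (w : ℝ) :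
    Integrable fun ξ : ℝ => (Real.cos (w * ξ) : ℂ) * zeroExt a ξ :=
  integrable_mul_zeroExt (by fun_prop) (B := 1)
    (fun ξ => by rw [Complex.norm_real]; exact Real.abs_cos_le_one _) a

theorem integrable_sin_mul_zeroExt (a : C(Icc (-R) R, ℂ)) (w : ℝ) :
    Integrable fun ξ : ℝ => (Real.sin (w * ξ) : ℂ) * zeroExt a ξ :=
  integrable_mul_zeroExt (by fun_prop) (B := 1)
    (fun ξ => by rw [Complex.norm_real]; exact Real.abs_sin_le_one _) a

theorem integral_exp_mul_zeroExt {A : VecSpace R} (hA : reflect A = A) (m : ℤ) (w : ℝ) :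
    ∫ ξ : ℝ, Complex.exp (Complex.I * (w : ℂ) * (ξ : ℂ)) * zeroExt (A m) ξ =
      ∫ ξ : ℝ, (Real.cos (w * ξ) : ℂ) * zeroExt (A m) ξ := by
  have hsplit : ∀ ξ : ℝ, Complex.exp (Complex.I * (w : ℂ) * (ξ : ℂ)) * zeroExt (A m) ξ =
      (Real.cos (w * ξ) : ℂ) * zeroExt (A m) ξ +
        Complex.I * ((Real.sin (w * ξ) : ℂ) * zeroExt (A m) ξ) := by
    intro ξ
    have : Complex.I * (w : ℂ) * (ξ : ℂ) = ((w * ξ : ℝ) : ℂ) * Complex.I := by push_cast; ring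
    rw [this, Complex.exp_mul_I, ← Complex.ofReal_cos, ← Complex.ofReal_sin]
    ring
  simp only [hsplit]
  rw [integral_add (integrable_cos_mul_zeroExt _ w) ((integrable_sin_mul_zeroExt _ w).const_mul _),
    integral_const_mul, integral_sin_mul_zeroExt hA, mul_zero, add_zero]

/-- By the addition theorem a cosine kernel has rank two. It is used with `w = k_0` for the
radiating part, and with `w = 0` for the constant `1/(2μ)`. -/
theorem conv_add_cos (h : Kern) (n : ℤ) (a : C(Icc (-R) R, ℂ)) (w : ℝ) (z : ℂ) (x : ℝ) :
    conv (fun t => h (n, t) + z * (Real.cos (w * t) : ℂ)) a x = conv (fun t => h (n, t)) a x +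
      (z * Real.cos (w * x) * (∫ ξ : ℝ, (Real.cos (w * ξ) : ℂ) * zeroExt a ξ) +
        z * Real.sin (w * x) * ∫ ξ : ℝ, (Real.sin (w * ξ) : ℂ) * zeroExt a ξ) := by
  have hi1 := (integrable_cos_mul_zeroExt a w).const_mul (z * Real.cos (w * x))
  have hi2 := (integrable_sin_mul_zeroExt a w).const_mul (z * Real.sin (w * x))
  rw [← integral_const_mul, ← integral_const_mul, ← integral_add hi1 hi2]
  unfold conv
  refine Eq.trans ?_ (integral_add (integrable_conv h n a x) (hi1.add hi2))
  congr 1; ext ξ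
  beta_reduce
  rw [mul_sub, Real.cos_sub]; push_cast; ring

theorem radiation_eq {μ β : ℝ} {A : VecSpace R} (hA : reflect A = A) :
    radiation μ β A = ∫ ξ : ℝ, (Real.cos (waveNumber μ β 0 * ξ) : ℂ) * zeroExt (A 0) ξ := by
  rw [← integral_exp_mul_zeroExt hA]
  simp only [radiation, mul_comm (zeroExt (A 0) _)]

theorem averageF_eq_pairing (hR : 0 ≤ R) (A : VecSpace R) :
    averageF A = pairing hR (-1) 1 A := by
  simp [averageF, pairing_apply]

theorem pairing_cos (hR : 0 ≤ R) {c : Kern} {w : ℝ}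
    (hc : ∀ m x, c (m, x) = (Real.cos (w * min |x| (2 * R)) : ℂ)) (A : VecSpace R) :
    pairing hR 0 c A = ∫ ξ : ℝ, (Real.cos (w * ξ) : ℂ) * zeroExt (A 0) ξ := by
  rw [pairing_apply]
  congr 1; ext ξ
  by_cases hξ : ξ ∈ Icc (-R) R
  · have h1 : |ξ| ≤ 2 * R := (abs_le.2 hξ).trans (by linarith)
    rw [hc, min_eq_left h1]
    congr 2
    rcases abs_choice ξ with h2 | h2 <;> rw [h2]
    rw [mul_neg, Real.cos_neg]
  · rw [zeroExt_of_notMem _ hξ, mul_zero, mul_zero]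

namespace IsKernelTriple

variable {μ β : ℝ} {h c k : Kern}

theorem pairing_eq (hk : IsKernelTriple R μ β h c k) (hR : 0 ≤ R) (A : VecSpace R) :
    pairing hR 0 c A = ∫ ξ : ℝ, (Real.cos (waveNumber μ β 0 * ξ) : ℂ) * zeroExt (A 0) ξ :=
  pairing_cos hR hk.cosine A

/-- On even vectors that do not radiate the full and the reduced operator coincide. -/
theorem kernelOp_full_eq (hk : IsKernelTriple R μ β h c k) (hf : IsStripFunction f R)
    (hR : 0 ≤ R) {A : VecSpace R} (hA : reflect A = A) (hc : pairing hR 0 c A = 0) :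
    kernelOp hR (coefMap hf) k A = kernelOp hR (coefMap hf) h A := by
  have hφ := summable_norm_coefMap hf
  ext m x
  refine (hasSum_kernelOp hR hφ k A m x).unique ?_
  convert! hasSum_kernelOp hR hφ h A m x using 2 with n
  congr 1
  by_cases hn : n = 0
  · subst hn
    set w := waveNumber μ β 0
    set z : ℂ := Complex.I / (2 * (w : ℂ))
    have h1 : conv (fun t => k (0, t)) (A 0) x =
        conv (fun t => h (0, t) + z * (Real.cos (w * t) : ℂ)) (A 0) x := by
      refine conv_congr _ x.2 fun t ht => ?_
      rw [hk.full, if_pos rfl, min_eq_left ht]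
      congr 3
      rcases abs_choice t with h2 | h2 <;> rw [h2]
      rw [mul_neg, Real.cos_neg]
    rw [h1, conv_add_cos, integral_sin_mul_zeroExt hA, ← hk.pairing_eq hR, hc]
    simp
  · simp [hk.full, hn]

end IsKernelTriple

theorem reflect_kernelOp (hf : IsPerturbation f R) (hR : 0 ≤ R) {h : Kern}
    (he : ∀ n t, h (n, -t) = h (n, t)) (A : VecSpace R) :
    kernelOp hR (coefMap hf.isStripFunction) h (reflect A) =
      reflect (kernelOp hR (coefMap hf.isStripFunction) h A) :=
  kernelOp_reflect hR (summable_norm_coefMap _) (fun j x => hf.fourierCoef_neg j x) he A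

theorem star_kernelOp (hf : IsPerturbation f R) (hR : 0 ≤ R) {h : Kern}
    (hr : ∀ n t, star (h (n, t)) = h (n, t)) (A : VecSpace R) :
    kernelOp hR (coefMap hf.isStripFunction) h (star A) =
      star (kernelOp hR (coefMap hf.isStripFunction) h A) :=
  kernelOp_star hR (summable_norm_coefMap _) (fun j x => hf.star_fourierCoef j x) hr A

/-- The full equation `(1 - 2εγ T) A = g` written out. -/
theorem full_apply (hR : 0 ≤ R) (φ : ℤ → C(Icc (-R) R, ℂ)) (k : Kern) (ε γ : ℝ) (A : VecSpace R) :
    (1 - (ε : ℂ) • ((2 * (γ : ℂ)) • kernelOp hR φ k)) A =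
      A - (2 * (ε : ℂ) * γ) • kernelOp hR φ k A := by
  have : (2 * (ε : ℂ) * γ) • kernelOp hR φ k A = (ε : ℂ) • ((2 * (γ : ℂ)) • kernelOp hR φ k A) := by
    rw [smul_smul]; congr 1; ring
  rw [this]; rfl

theorem reduced_apply (hR : 0 ≤ R) (φ : ℤ → C(Icc (-R) R, ℂ)) (h : Kern) (r : ℝ) (A : VecSpace R) :
    (1 - r • kernelOpL hR φ h) A = A - r • kernelOp hR φ h A := rfl

theorem real_smul_eq (r : ℝ) (A : VecSpace R) : r • A = (r : ℂ) • A := by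
  ext m x
  change r • A m x = (r : ℂ) • A m x
  rw [Complex.real_smul, smul_eq_mul]

/-- A solution of an operator equation with an even kernel is even. -/
theorem reflect_eq_of_full (hf : IsPerturbation f R) (hR : 0 ≤ R) {k : Kern}
    (he : ∀ n t, k (n, -t) = k (n, t)) {ε γ : ℝ}
    (hu : IsUnit (1 - (ε : ℂ) • ((2 * (γ : ℂ)) • kernelOp hR (coefMap hf.isStripFunction) k)))
    {A : VecSpace R} (hA : A - (2 * (ε : ℂ) * γ) • kernelOp hR (coefMap hf.isStripFunction) k A =
      sourceVec hf.isStripFunction) : reflect A = A := by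
  have h1 := eq_inverse_of_isUnit (V := VecSpace R) hu ((full_apply hR _ k ε γ A).trans hA)
  -- The reflected vector solves the same equation, so uniqueness identifies it with `A`.
  have h2 : reflect A - (2 * (ε : ℂ) * γ) • kernelOp hR (coefMap hf.isStripFunction) k (reflect A) =
      sourceVec hf.isStripFunction := by
    rw [reflect_kernelOp hf hR he, ← map_smul, ← map_sub, hA, reflect_sourceVec hf]
  have h3 := eq_inverse_of_isUnit (V := VecSpace R) hu ((full_apply hR _ k ε γ _).trans h2)
  rw [h3, ← h1]

theorem reflect_eq_of_reduced (hf : IsPerturbation f R) (hR : 0 ≤ R) {h : Kern}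
    (he : ∀ n t, h (n, -t) = h (n, t)) {r : ℝ}
    (hu : IsUnit (1 - r • kernelOpL hR (coefMap hf.isStripFunction) h))
    {A : VecSpace R} (hA : A - r • kernelOp hR (coefMap hf.isStripFunction) h A =
      sourceVec hf.isStripFunction) : reflect A = A := by
  have h1 := eq_inverse_of_isUnit (V := VecSpace R) hu ((reduced_apply hR _ h r A).trans hA)
  have h2 : reflect A - r • kernelOp hR (coefMap hf.isStripFunction) h (reflect A) =
      sourceVec hf.isStripFunction := by
    rw [reflect_kernelOp hf hR he, real_smul_eq, ← map_smul, ← real_smul_eq, ← map_sub, hA,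
      reflect_sourceVec hf]
  have h3 := eq_inverse_of_isUnit (V := VecSpace R) hu ((reduced_apply hR _ h r _).trans h2)
  rw [h3, ← h1]

theorem star_eq_of_reduced (hf : IsPerturbation f R) (hR : 0 ≤ R) {h : Kern}
    (hr : ∀ n t, star (h (n, t)) = h (n, t)) {r : ℝ}
    (hu : IsUnit (1 - r • kernelOpL hR (coefMap hf.isStripFunction) h))
    {A : VecSpace R} (hA : A - r • kernelOp hR (coefMap hf.isStripFunction) h A =
      sourceVec hf.isStripFunction) : star A = A := by
  have h1 := eq_inverse_of_isUnit (V := VecSpace R) hu ((reduced_apply hR _ h r A).trans hA)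
  have h2 : star A - r • kernelOp hR (coefMap hf.isStripFunction) h (star A) =
      sourceVec hf.isStripFunction := by
    have h4 : r • star (kernelOp hR (coefMap hf.isStripFunction) h A) =
        star (r • kernelOp hR (coefMap hf.isStripFunction) h A) := by
      rw [real_smul_eq, real_smul_eq, star_smul, Complex.star_def, Complex.conj_ofReal]
    rw [star_kernelOp hf hR hr, h4, ← star_sub, hA, star_sourceVec hf]
  have h3 := eq_inverse_of_isUnit (V := VecSpace R) hu ((reduced_apply hR _ h r _).trans h2)
  rw [h3, ← h1]

theorem im_integral_mul_zeroExt {A : VecSpace R} (hA : star A = A) (m : ℤ) (u : ℝ → ℝ) :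
    (∫ ξ, (u ξ : ℂ) * zeroExt (A m) ξ).im = 0 := by
  rw [← Complex.conj_eq_iff_im, ← integral_conj]
  congr 1; ext ξ
  rw [map_mul, Complex.conj_ofReal]
  congr 1
  have := zeroExt_star A m ξ
  rw [hA] at this
  exact this.symm

theorem im_averageF {A : VecSpace R} (hA : star A = A) : (averageF A).im = 0 := by
  have := im_integral_mul_zeroExt hA (-1) (fun _ => 1)
  simpa [averageF] using this

/-! ### Passage between the full equation, the reduced equation and the mode -/

namespace IsKernelTriple

variable {μ β : ℝ} {h c k : Kern}

/-- An even solution of the trapping system solves the reduced equation. -/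
theorem reduced_of_isResolventVector (hk : IsKernelTriple R μ β h c k) (hf : IsPerturbation f R)
    (hR : 0 ≤ R) {ε : ℝ} {Y : VecSpace R} (hY : IsResolventVector f R ε μ β Y)
    (hrad : radiation μ β Y = 0) :
    Y - (2 * ε * gam μ β) • kernelOp hR (coefMap hf.isStripFunction) h Y =
      sourceVec hf.isStripFunction ∧ pairing hR 0 c Y = 0 := by
  obtain ⟨T, g, hT, hg, hu, rfl⟩ := hY
  have hgs : g = sourceVec hf.isStripFunction := by
    ext m x
    rw [hg, sourceVec_apply, coefMap_apply]
  subst hgs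
  obtain rfl := hT.unique (hk.isThat hf.isStripFunction hR)
  set Y := Ring.inverse (1 - (ε : ℂ) • ((2 * (gam μ β : ℂ)) •
    kernelOp hR (coefMap hf.isStripFunction) k)) (sourceVec hf.isStripFunction) with hYdef
  have hfull := (full_apply hR _ k ε (gam μ β) Y).symm.trans
    (apply_inverse_of_isUnit (V := VecSpace R) hu _)
  have heven := reflect_eq_of_full hf hR hk.full_neg hu hfull
  have hp : pairing hR 0 c Y = 0 := by rw [hk.pairing_eq hR, ← radiation_eq heven, hrad]
  refine ⟨?_, hp⟩
  rw [← hk.kernelOp_full_eq hf.isStripFunction hR heven hp, real_smul_eq]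
  push_cast
  exact hfull

theorem isResolventVector_of_reduced (hk : IsKernelTriple R μ β h c k) (hf : IsPerturbation f R)
    (hR : 0 ≤ R) {ε : ℝ} {Y : VecSpace R} (heven : reflect Y = Y) (hp : pairing hR 0 c Y = 0)
    (hu : IsUnit (1 - (ε : ℂ) • ((2 * (gam μ β : ℂ)) •
      kernelOp hR (coefMap hf.isStripFunction) k)))
    (hY : Y - (2 * ε * gam μ β) • kernelOp hR (coefMap hf.isStripFunction) h Y =
      sourceVec hf.isStripFunction) : IsResolventVector f R ε μ β Y := by
  refine ⟨_, sourceVec hf.isStripFunction, hk.isThat hf.isStripFunction hR, fun m x => rfl, hu,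
    eq_inverse_of_isUnit (V := VecSpace R) hu ?_⟩
  rw [full_apply, hk.kernelOp_full_eq hf.isStripFunction hR heven hp, ← hY, real_smul_eq]
  push_cast
  rfl

theorem conv_green_neg_one (hk : IsKernelTriple R μ β h c k) (a : C(Icc (-R) R, ℂ)) {x : ℝ}
    (hx : x ∈ Icc (-R) R) : conv (green μ β (-1)) a x =
      conv (greenReg μ β (-1)) a x + (2 * (μ : ℂ))⁻¹ * ∫ ξ, zeroExt a ξ := by
  have h1 : conv (green μ β (-1)) a x =
      conv (fun t => k (-1, t) + (2 * (μ : ℂ))⁻¹ * (Real.cos (0 * t) : ℂ)) a x := by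
    refine conv_congr a hx fun t ht => ?_
    rw [hk.full_eq_greenReg _ ht, greenReg, if_pos rfl, green, if_neg (by norm_num), waveNumber,
      if_neg (by norm_num), if_pos rfl]
    have : (μ : ℂ) ≠ 0 := by exact_mod_cast hk.mu_pos.ne'
    push_cast
    simp only [zero_mul, Complex.cos_zero]
    field_simp
    ring
  rw [h1, conv_add_cos, conv_congr a hx fun t ht => hk.full_eq_greenReg (-1) ht]
  simp

/-- Beyond the support `|x - ξ|` is `±(x - ξ)`, so the convolution is an outgoing wave times an
amplitude; by evenness both amplitudes equal the cosine integral. -/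
theorem conv_green_zero_eq_zero (hk : IsKernelTriple R μ β h c k) (hR : 0 ≤ R) {A : VecSpace R}
    (hA : reflect A = A) (hp : pairing hR 0 c A = 0) {x : ℝ} (hx : R < |x|) :
    conv (green μ β 0) (A 0) x = 0 := by
  rw [hk.pairing_eq hR] at hp
  set w := waveNumber μ β 0
  have key : ∀ s : ℝ, (s = 1 ∨ s = -1) → |x| = s * x → conv (green μ β 0) (A 0) x = 0 := by
    intro s hs hxs
    have h1 : ∀ ξ, green μ β 0 (x - ξ) * zeroExt (A 0) ξ =
        Complex.I / (2 * (w : ℂ)) * Complex.exp (Complex.I * (w : ℂ) * ((s * x : ℝ) : ℂ)) *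
          (Complex.exp (Complex.I * ((-(s * w) : ℝ) : ℂ) * (ξ : ℂ)) * zeroExt (A 0) ξ) := by
      intro ξ
      by_cases hξ : ξ ∈ Icc (-R) R
      · have h2 : |x - ξ| = s * x - s * ξ := by
          rw [← mul_sub]
          rcases hs with rfl | rfl
          · rw [one_mul, abs_of_nonneg]
            rw [one_mul] at hxs; rw [hxs] at hx; linarith [hξ.2]
          · rw [neg_one_mul, abs_of_nonpos]
            rw [neg_one_mul] at hxs; rw [hxs] at hx; linarith [hξ.1]
        rw [green, if_pos rfl, h2]
        have h3 : Complex.I * (w : ℂ) * ((s * x - s * ξ : ℝ) : ℂ) =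
            Complex.I * (w : ℂ) * ((s * x : ℝ) : ℂ) +
              Complex.I * ((-(s * w) : ℝ) : ℂ) * (ξ : ℂ) := by push_cast; ring
        rw [h3, Complex.exp_add]; ring
      · rw [zeroExt_of_notMem _ hξ, mul_zero, mul_zero, mul_zero]
    have h4 : ∀ ξ, Real.cos (-(s * w) * ξ) = Real.cos (w * ξ) := by
      intro ξ
      rcases hs with rfl | rfl
      · rw [one_mul, neg_mul, Real.cos_neg]
      · simp
    unfold conv
    simp only [h1]
    rw [integral_const_mul, integral_exp_mul_zeroExt hA]
    simp only [h4]
    rw [hp, mul_zero]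
  rcases abs_choice x with h | h
  · exact key 1 (Or.inl rfl) (by rw [h, one_mul])
  · exact key (-1) (Or.inr rfl) (by rw [h, neg_one_mul])

/-- The normalisation makes the source disappear: restoring `1/(2μ)` in `H_{-1}` adds `2γε (2εν)⁻¹
(∫ Y_{-1}) f_{m+1}`, which is `f_{m+1}` because `γ ∫ Y_{-1} = ν`. The inhomogeneous equation for `H`
thus becomes the homogeneous one for `G`. -/
theorem isModeData (hk : IsKernelTriple R μ β h c k) (hf : IsPerturbation f R)
    (hR : 0 ≤ R) {ε ν : ℝ} (hν : ν ≠ 0) (hμ : μ = ε * ν) {Y : VecSpace R} (heven : reflect Y = Y)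
    (hp : pairing hR 0 c Y = 0) (hav : (ν : ℂ) = (gam μ β : ℂ) * averageF Y)
    (hY : Y - (2 * ε * gam μ β) • kernelOp hR (coefMap hf.isStripFunction) h Y =
      sourceVec hf.isStripFunction) : IsModeData f R ε μ β Y := by
  refine ⟨hf.isStripFunction, hR, hk.mu_pos, hk.beta_pos, hk.beta_lt, hk.wave_pos, fun m x => ?_,
    fun x hx => hk.conv_green_zero_eq_zero hR heven hp hx⟩
  have hT := (hk.isThat hf.isStripFunction hR Y m x).mul_left (ε : ℂ)
  rw [← hk.kernelOp_full_eq hf.isStripFunction hR heven hp] at hY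
  have hYm : Y m x = (ε : ℂ) * (((2 * (gam μ β : ℂ)) •
      kernelOp hR (coefMap hf.isStripFunction) k) Y m x) + fourierCoef f (m + 1) x := by
    have h1 := congrArg (fun A : VecSpace R => A m x) (eq_add_of_sub_eq hY)
    refine h1.trans ?_
    have h2 : (sourceVec hf.isStripFunction +
        (2 * ε * gam μ β) • kernelOp hR (coefMap hf.isStripFunction) k Y : VecSpace R) m x =
        fourierCoef f (m + 1) x + ((2 * ε * gam μ β : ℝ) : ℂ) *
          kernelOp hR (coefMap hf.isStripFunction) k Y m x := by
      rw [real_smul_eq]; rfl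
    have h3 : ((2 * (gam μ β : ℂ)) • kernelOp hR (coefMap hf.isStripFunction) k) Y m x =
        (2 * (gam μ β : ℂ)) * kernelOp hR (coefMap hf.isStripFunction) k Y m x := rfl
    rw [h3]
    refine h2.trans ?_
    push_cast; ring
  -- The source is booked as an extra term at `n = -1`, where the rank-one part of `G_{-1}`
  -- reproduces it.
  have hite := hasSum_ite_eq (-1 : ℤ) (fourierCoef f (m + 1) (x : ℝ))
  rw [hYm]
  convert! hT.add hite using 2 with n
  by_cases hn : n = -1
  · subst hn
    have hε : (ε : ℂ) ≠ 0 := by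
      rintro h0
      have : ε = 0 := by exact_mod_cast h0
      have := hk.mu_pos
      simp [hμ, ‹ε = 0›] at this
    have hνc : (ν : ℂ) ≠ 0 := by exact_mod_cast hν
    rw [if_pos rfl, hk.conv_green_neg_one _ x.2, sub_neg_eq_add]
    have h5 : 2 * (gam μ β : ℂ) * ε * ((2 * (μ : ℂ))⁻¹ * ∫ ξ, zeroExt (Y (-1)) ξ) = 1 := by
      have h6 : (gam μ β : ℂ) * ∫ ξ, zeroExt (Y (-1)) ξ = ν := hav.symm
      have h7 : (μ : ℂ) = ε * ν := by rw [hμ]; push_cast; rfl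
      rw [h7]
      calc _ = (2 * (ε : ℂ)) * (2 * (ε * ν : ℂ))⁻¹ *
            ((gam μ β : ℂ) * ∫ ξ, zeroExt (Y (-1)) ξ) := by ring
        _ = 1 := by rw [h6]; field_simp
    linear_combination (fourierCoef f (m + 1) (x : ℝ)) * h5
  · have h8 : greenReg μ β n = green μ β n := funext fun t => if_neg hn
    rw [if_neg hn, add_zero, h8]
    ring

end IsKernelTriple

end Equivalence

end

end RayleighBloch

namespace RayleighBloch

noncomputable section

/-! ### The bifurcation point -/

section BifurcationPoint

variable {f : ℝ × ℝ → ℝ} {R : ℝ}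

theorem averageF_sourceVec (hf : IsStripFunction f R) :
    averageF (sourceVec hf) = fourierCoefHat f 0 0 := by
  have h : zeroExt (sourceVec hf (-1)) = fourierCoef f 0 := zeroExt_coefMap hf 0
  rw [averageF, h]
  simp [fourierCoefHat]

theorem pairing_sourceVec (hf : IsPerturbation f R) (hR : 0 ≤ R) {c : Kern} {w : ℝ}
    (hc : ∀ m x, c (m, x) = (Real.cos (w * min |x| (2 * R)) : ℂ)) :
    pairing hR 0 c (sourceVec hf.isStripFunction) = fourierCoefHat f 1 w := by
  have h : zeroExt (sourceVec hf.isStripFunction 0) = fourierCoef f 1 :=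
    zeroExt_coefMap hf.isStripFunction 1
  rw [pairing_cos hR hc, h, hf.fourierCoefHat_eq_integral_cos]

/-- The real functional `Y ↦ Re ∫ Y_{-1}`. -/
def reAverage (hR : 0 ≤ R) : VecSpace R →L[ℝ] ℝ := Complex.reCLM.comp (pairing hR (-1) 1)

theorem reAverage_apply (hR : 0 ≤ R) (Y : VecSpace R) : reAverage hR Y = (averageF Y).re := by
  rw [averageF_eq_pairing hR]; rfl

/-- The real part of `pairing hR 0`. -/
def rePairing (hR : 0 ≤ R) : Kern →L[ℝ] VecSpace R →L[ℝ] ℝ :=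
  (ContinuousLinearMap.compL ℝ (VecSpace R) ℂ ℝ Complex.reCLM).comp (pairing hR 0)

theorem rePairing_apply (hR : 0 ≤ R) (c : Kern) (Y : VecSpace R) :
    rePairing hR c Y = (pairing hR 0 c Y).re := rfl

theorem waveNumber_zero_zero (β : ℝ) : waveNumber 0 β 0 = √(1 - 2 * β) := by
  simp [waveNumber]

/-- Chain rule: `√(1-2β)` has nonzero derivative at `β₀`, so a simple zero in the wave number is a
simple zero in `β`. -/
theorem hasDerivAt_rePairing_sourceVec (hf : IsPerturbation f R) (hR : 0 ≤ R) {β₀ : ℝ}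
    (hβ : β₀ < 1 / 2) (hd : deriv (fourierCoefHat f 1) (√(1 - 2 * β₀)) ≠ 0)
    {C : ℝ × ℝ → Kern} (hC : ∀ᶠ p in 𝓝 ((0 : ℝ), β₀), ∀ m x,
      C p (m, x) = (Real.cos (waveNumber p.1 p.2 0 * min |x| (2 * R)) : ℂ)) :
    ∃ ρ', ρ' ≠ 0 ∧
      HasDerivAt (fun β => rePairing hR (C (0, β)) (sourceVec hf.isStripFunction)) ρ' β₀ := by
  have hpos : 0 < 1 - 2 * β₀ := by linarith
  have hdiff : DifferentiableAt ℝ (fourierCoefHat f 1) (√(1 - 2 * β₀)) := by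
    by_contra h; exact hd (deriv_zero_of_not_differentiableAt h)
  have h1 : HasDerivAt (fun β : ℝ => √(1 - 2 * β)) (-2 / (2 * √(1 - 2 * β₀))) β₀ := by
    have : HasDerivAt (fun β : ℝ => 1 - 2 * β) (-2) β₀ := by
      simpa using ((hasDerivAt_id β₀).const_mul 2).const_sub 1
    exact this.sqrt hpos.ne'
  have h2 : HasDerivAt (fun s => (fourierCoefHat f 1 s).re)
      (deriv (fourierCoefHat f 1) (√(1 - 2 * β₀))).re (√(1 - 2 * β₀)) :=
    Complex.reCLM.hasFDerivAt.comp_hasDerivAt _ hdiff.hasDerivAt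
  refine ⟨_, mul_ne_zero (hf.re_deriv_fourierCoefHat_ne_zero hd) ?_,
    (h2.comp β₀ h1).congr_of_eventuallyEq ?_⟩
  · have := Real.sqrt_pos.2 hpos
    exact div_ne_zero (by norm_num) (by positivity)
  · have hc : Tendsto (fun β : ℝ => ((0 : ℝ), β)) (𝓝 β₀) (𝓝 (0, β₀)) :=
      (Continuous.prodMk_right (0 : ℝ)).tendsto β₀
    filter_upwards [hc.eventually hC] with β hβ'
    rw [rePairing_apply, pairing_sourceVec hf hR hβ', waveNumber_zero_zero]
    rfl

theorem tendsto_spectralParam (ν₀ β₀ : ℝ) :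
    Tendsto spectralParam (𝓝 (0, ν₀, β₀)) (𝓝 (0, β₀)) := by
  have := contDiff_spectralParam.continuous.tendsto (0, ν₀, β₀)
  simpa [spectralParam] using this

/-- The explicit factor `ε` makes the perturbation of the identity small while the kernels stay
bounded, so a Neumann series applies. -/
theorem eventually_isUnit_full (hR : 0 ≤ R) (φ : ℤ → C(Icc (-R) R, ℂ)) {K : ℝ × ℝ → Kern}
    {ν₀ β₀ : ℝ} (hK : ContDiffAt ℝ ω K (0, β₀)) :
    ∀ᶠ q : ℝ × ℝ × ℝ in 𝓝 ((0 : ℝ), ν₀, β₀), IsUnit (1 - (q.1 : ℂ) •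
      ((2 * (gam (spectralParam q).1 (spectralParam q).2 : ℂ)) •
        kernelOp hR φ (K (spectralParam q)))) := by
  set b : ℝ × ℝ × ℝ → ℝ := fun q => |q.1| * (2 * |gam (spectralParam q).1 (spectralParam q).2| *
    (‖indexConvOp φ‖ * (2 * R) * ‖K (spectralParam q)‖))
  have hKc : ContinuousAt (fun q => K (spectralParam q)) (0, ν₀, β₀) := by
    have : ContinuousAt K (spectralParam (0, ν₀, β₀)) := by
      simpa [spectralParam] using hK.continuousAt
    exact ContinuousAt.comp this contDiff_spectralParam.continuous.continuousAt
  have hg : Continuous fun q => gam (spectralParam q).1 (spectralParam q).2 :=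
    contDiff_gam.continuous.comp contDiff_spectralParam.continuous
  have hb : ContinuousAt b (0, ν₀, β₀) :=
    continuous_fst.abs.continuousAt.mul ((continuousAt_const.mul hg.abs.continuousAt).mul
      (continuousAt_const.mul hKc.norm))
  have hb0 : b (0, ν₀, β₀) < 1 := by simp [b]
  filter_upwards [hb.eventually_lt_const hb0] with q hq
  refine isUnit_one_sub_of_norm_lt (V := VecSpace R) (lt_of_le_of_lt ?_ hq)
  rw [norm_smul, norm_smul, norm_mul, Complex.norm_real, Complex.norm_real, Complex.norm_ofNat,
    Real.norm_eq_abs, Real.norm_eq_abs]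
  exact mul_le_mul_of_nonneg_left (mul_le_mul_of_nonneg_left
    (norm_kernelOp_le hR φ (K (spectralParam q))) (by positivity)) (abs_nonneg _)

/-- The kernels, with everything that holds near the bifurcation point. -/
theorem exists_kernelTriples (hR : 0 ≤ R) (φ : ℤ → C(Icc (-R) R, ℂ)) {ν₀ β₀ : ℝ} (h0 : 0 < β₀)
    (h1 : β₀ < 1 / 2) (hν : 0 < ν₀) :
    ∃ H C K : ℝ × ℝ → Kern, ContDiffAt ℝ ω H (0, β₀) ∧ ContDiffAt ℝ ω C (0, β₀) ∧
      (∀ᶠ p in 𝓝 ((0 : ℝ), β₀), ∀ m x,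
        C p (m, x) = (Real.cos (waveNumber p.1 p.2 0 * min |x| (2 * R)) : ℂ)) ∧
      ∀ᶠ q : ℝ × ℝ × ℝ in 𝓝 ((0 : ℝ), ν₀, β₀), 0 < q.2.1 ∧
        (0 < q.1 → IsKernelTriple R (q.1 * q.2.1) q.2.2 (H (q.1 * q.2.1, q.2.2))
          (C (q.1 * q.2.1, q.2.2)) (K (q.1 * q.2.1, q.2.2))) ∧
        IsUnit (reducedOp (kernelOpL hR φ) H q) ∧
        IsUnit (1 - (q.1 : ℂ) • ((2 * (gam (q.1 * q.2.1) q.2.2 : ℂ)) •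
          kernelOp hR φ (K (q.1 * q.2.1, q.2.2)))) := by
  obtain ⟨H, C, K, hH, hC, hK, hev⟩ := exists_kernels hR h0 h1
  refine ⟨H, C, K, hH, hC, hev.mono fun p hp => hp.2.1, ?_⟩
  have hνc : ∀ᶠ q : ℝ × ℝ × ℝ in 𝓝 ((0 : ℝ), ν₀, β₀), 0 < q.2.1 :=
    (continuous_snd.fst.tendsto _).eventually_const_lt hν
  have hβ0 : ∀ᶠ q : ℝ × ℝ × ℝ in 𝓝 ((0 : ℝ), ν₀, β₀), 0 < q.2.2 :=
    (continuous_snd.snd.tendsto _).eventually_const_lt h0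
  have hβ1 : ∀ᶠ q : ℝ × ℝ × ℝ in 𝓝 ((0 : ℝ), ν₀, β₀), q.2.2 < 1 / 2 :=
    (continuous_snd.snd.tendsto _).eventually_lt_const h1
  have hw : ∀ᶠ q : ℝ × ℝ × ℝ in 𝓝 ((0 : ℝ), ν₀, β₀), 0 < 1 - 2 * q.2.2 - (q.1 * q.2.1) ^ 2 := by
    have hc : Continuous fun q : ℝ × ℝ × ℝ => 1 - 2 * q.2.2 - (q.1 * q.2.1) ^ 2 := by fun_prop
    refine (hc.tendsto _).eventually_const_lt ?_
    simp only [zero_mul]; linarith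
  filter_upwards [hνc, hβ0, hβ1, hw, (tendsto_spectralParam ν₀ β₀).eventually hev,
    eventually_isUnit_reducedOp (V := VecSpace R) (L := kernelOpL hR φ) (ν₀ := ν₀) hH,
    eventually_isUnit_full hR φ (ν₀ := ν₀) hK] with q e1 e2 e3 e4 e5 e6 e7
  refine ⟨e1, fun hq => ?_, e6, e7⟩
  have hμ : 0 < q.1 * q.2.1 := mul_pos hq e1
  exact ⟨hμ, e2, e3, e4, e5.1 hμ, e5.2.1, e5.2.2⟩

end BifurcationPoint

/-! ### Solutions of the reduced system and trapped modes -/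

namespace IsKernelTriple

variable {f : ℝ × ℝ → ℝ} {R ε ν β : ℝ} {H C : ℝ × ℝ → Kern} {k : Kern}

theorem reducedMap_eq_zero (hk : IsKernelTriple R (ε * ν) β (H (ε * ν, β)) (C (ε * ν, β)) k)
    (hf : IsPerturbation f R) (hR : 0 ≤ R)
    (hu : IsUnit (reducedOp (kernelOpL hR (coefMap hf.isStripFunction)) H (ε, ν, β)))
    {Y : VecSpace R} (hY : IsResolventVector f R ε (ε * ν) β Y) (hs : TrappingSystem ε ν β Y) :
    reducedMap (kernelOpL hR (coefMap hf.isStripFunction)) H C (sourceVec hf.isStripFunction)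
      (reAverage hR) (rePairing hR) (ε, ν, β) = 0 := by
  obtain ⟨h1, h2⟩ := hk.reduced_of_isResolventVector hf hR hY hs.2
  have h3 := eq_reducedSol (V := VecSpace R) hu h1
  simp only [reducedMap, ← h3, reAverage_apply, rePairing_apply]
  refine Prod.ext ?_ ?_
  · have := congrArg Complex.re hs.1
    rw [Complex.re_ofReal_mul, Complex.ofReal_re] at this
    exact sub_eq_zero.2 this
  · exact congrArg Complex.re h2

/-- The reduced solution is real and even, so the imaginary parts of both equations vanish
automatically and two real equations yield the complex trapping system. -/
theorem exists_modeData (hk : IsKernelTriple R (ε * ν) β (H (ε * ν, β)) (C (ε * ν, β)) k)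
    (hf : IsPerturbation f R) (hR : 0 ≤ R) (hν : ν ≠ 0)
    (hu : IsUnit (reducedOp (kernelOpL hR (coefMap hf.isStripFunction)) H (ε, ν, β)))
    (hu' : IsUnit (1 - (ε : ℂ) • ((2 * (gam (ε * ν) β : ℂ)) •
      kernelOp hR (coefMap hf.isStripFunction) k)))
    (hz : reducedMap (kernelOpL hR (coefMap hf.isStripFunction)) H C (sourceVec hf.isStripFunction)
      (reAverage hR) (rePairing hR) (ε, ν, β) = 0) :
    ∃ Y : VecSpace R, IsResolventVector f R ε (ε * ν) β Y ∧ TrappingSystem ε ν β Y ∧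
      IsModeData f R ε (ε * ν) β Y := by
  set Y := reducedSol (kernelOpL hR (coefMap hf.isStripFunction)) H
    (sourceVec hf.isStripFunction) (ε, ν, β) with hYdef
  have hY : Y - (2 * ε * gam (ε * ν) β) •
      kernelOp hR (coefMap hf.isStripFunction) (H (ε * ν, β)) Y = sourceVec hf.isStripFunction :=
    reducedOp_reducedSol (V := VecSpace R) hu
  have heven := reflect_eq_of_reduced hf hR hk.reg_neg hu hY
  have hstar := star_eq_of_reduced hf hR hk.star_reg hu hY
  have hz1 : ν - gam (ε * ν) β * (averageF Y).re = 0 := by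
    rw [← reAverage_apply hR]; exact congrArg Prod.fst hz
  have hz2 : (pairing hR 0 (C (ε * ν, β)) Y).re = 0 := congrArg Prod.snd hz
  have hp : pairing hR 0 (C (ε * ν, β)) Y = 0 := by
    refine Complex.ext hz2 ?_
    rw [hk.pairing_eq hR]
    exact im_integral_mul_zeroExt hstar 0 _
  have hav : (ν : ℂ) = (gam (ε * ν) β : ℂ) * averageF Y := by
    refine Complex.ext ?_ ?_
    · rw [Complex.re_ofReal_mul, Complex.ofReal_re]; exact sub_eq_zero.1 hz1
    · rw [Complex.im_ofReal_mul, Complex.ofReal_im, im_averageF hstar, mul_zero]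
  exact ⟨Y, hk.isResolventVector_of_reduced hf hR heven hp hu' hY,
    ⟨hav, by rw [radiation_eq heven, ← hk.pairing_eq hR, hp]⟩,
    hk.isModeData hf hR hν rfl heven hp hav hY⟩

end IsKernelTriple

end

end RayleighBloch
-- Assembly of the main theorem
theorem mainTheorem1 (f : ℝ × ℝ → ℝ) (R : ℝ) (hR : 0 < R)
    (hf : RayleighBloch.IsPerturbation f R)
    (β₀₀ : ℝ) (hκ : √(1 - 2 * β₀₀) ∈ Set.Ioo (0 : ℝ) 1)
    (hzero : RayleighBloch.fourierCoefHat f 1 (√(1 - 2 * β₀₀)) = 0)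
    (hderiv : deriv (RayleighBloch.fourierCoefHat f 1) (√(1 - 2 * β₀₀)) ≠ 0) :
    ∃ (ν₀₀ ε₀ δ : ℝ) (βtr νtr : ℝ → ℝ),
      (ν₀₀ : ℂ) = (1 - (β₀₀ : ℂ)) ^ 2 / (4 * (Real.pi : ℂ)) *
        RayleighBloch.fourierCoefHat f 0 0 ∧
      0 < ε₀ ∧ 0 < δ ∧
      AnalyticOnNhd ℝ βtr (Set.Ioo (-ε₀) ε₀) ∧
      AnalyticOnNhd ℝ νtr (Set.Ioo (-ε₀) ε₀) ∧
      (fun ε => βtr ε - β₀₀) =O[𝓝 0] (fun ε : ℝ => ε) ∧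
      (fun ε => νtr ε - ν₀₀) =O[𝓝 0] (fun ε : ℝ => ε) ∧
      ∀ ε ∈ Set.Ioo 0 ε₀,
        -- the parameters are admissible and the frequency lies between the first two cut-offs
        βtr ε ∈ Set.Ioo (0 : ℝ) (1 / 2) ∧ 0 < νtr ε ∧
        (βtr ε) ^ 2 < RayleighBloch.omegaSq (ε * νtr ε) (βtr ε) ∧
        RayleighBloch.omegaSq (ε * νtr ε) (βtr ε) < (1 - βtr ε) ^ 2 ∧
        -- local uniqueness of the solution of the trapping system
        (∀ β ν : ℝ, |β - β₀₀| < δ → |ν - ν₀₀| < δ →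
          ∀ Y : RayleighBloch.VecSpace R,
            RayleighBloch.IsResolventVector f R ε (ε * ν) β Y →
            RayleighBloch.TrappingSystem ε ν β Y → β = βtr ε ∧ ν = νtr ε) ∧
        -- the trapped mode
        ∃ Y : RayleighBloch.VecSpace R,
          RayleighBloch.IsResolventVector f R ε (ε * νtr ε) (βtr ε) Y ∧
          RayleighBloch.TrappingSystem ε (νtr ε) (βtr ε) Y ∧
          (∀ p : ℝ × ℝ, Summable (RayleighBloch.modeTerm (ε * νtr ε) (βtr ε) Y p)) ∧
          RayleighBloch.IsFiniteEnergySolution f ε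
            (RayleighBloch.omegaSq (ε * νtr ε) (βtr ε)) (βtr ε)
            (RayleighBloch.mode (ε * νtr ε) (βtr ε) Y) ∧
          (∃ C c : ℝ, 0 < c ∧ ∀ x y : ℝ,
            ‖RayleighBloch.mode (ε * νtr ε) (βtr ε) Y (x, y)‖ ≤ C * Real.exp (-(c * |x|))) ∧
          ∃ p : ℝ × ℝ, RayleighBloch.mode (ε * νtr ε) (βtr ε) Y p ≠ 0 := by
  have hst := hf.isStripFunction
  obtain ⟨hκ0, hκ1⟩ := hκ
  have hβ1 : β₀₀ < 1 / 2 := by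
    have := Real.sqrt_pos.1 hκ0
    linarith
  have hβ0 : 0 < β₀₀ := by
    by_contra! h
    exact absurd hκ1 (not_lt.2 (Real.one_le_sqrt.2 (by linarith)))
  set g := RayleighBloch.sourceVec hst
  set F := RayleighBloch.reAverage hR.le
  set L := RayleighBloch.kernelOpL hR.le (RayleighBloch.coefMap hst)
  set ν₀₀ : ℝ := RayleighBloch.gam 0 β₀₀ * F g with hν₀₀
  have hFg : F g = ∫ x : ℝ, ∫ y in (0 : ℝ)..(2 * Real.pi), f (x, y) := by
    rw [RayleighBloch.reAverage_apply, RayleighBloch.averageF_sourceVec,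
      RayleighBloch.IsPerturbation.fourierCoefHat_zero_zero, Complex.ofReal_re]
  have hν : 0 < ν₀₀ := by
    have h1 : 0 < RayleighBloch.gam 0 β₀₀ := by
      have := Real.pi_pos
      have h2 : 0 < 1 - β₀₀ := by linarith
      rw [RayleighBloch.gam, RayleighBloch.omegaSq]
      simp only [ne_eq, OfNat.ofNat_ne_zero, not_false_eq_true, zero_pow, sub_zero]
      positivity
    rw [hν₀₀, hFg]
    exact mul_pos h1 hf.volume_pos
  obtain ⟨H, C, K, hH, hC, hCe, hP⟩ := RayleighBloch.exists_kernelTriples hR.le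
    (RayleighBloch.coefMap hst) hβ0 hβ1 hν
  obtain ⟨ρ', hρ', hρ⟩ :=
    RayleighBloch.hasDerivAt_rePairing_sourceVec hf hR.le hβ1 hderiv hCe
  have hρ0 : RayleighBloch.rePairing hR.le (C (0, β₀₀)) g = 0 := by
    rw [RayleighBloch.rePairing_apply, RayleighBloch.pairing_sourceVec hf hR.le hCe.self_of_nhds,
      RayleighBloch.waveNumber_zero_zero, hzero, Complex.zero_re]
  obtain ⟨ε₀, δ, φ, hε₀, hδ, hφ, hφ0, hall⟩ := RayleighBloch.exists_reduced_branch
    (V := RayleighBloch.VecSpace R) (L := L) (F := F) hH hC hρ0 hρ hρ' hP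
  have hφ1 : AnalyticOnNhd ℝ (fun ε => (φ ε).1) (Set.Ioo (-ε₀) ε₀) := fun ε hε =>
    (ContinuousLinearMap.fst ℝ ℝ ℝ).analyticAt _ |>.comp (hφ ε hε)
  have hφ2 : AnalyticOnNhd ℝ (fun ε => (φ ε).2) (Set.Ioo (-ε₀) ε₀) := fun ε hε =>
    (ContinuousLinearMap.snd ℝ ℝ ℝ).analyticAt _ |>.comp (hφ ε hε)
  have h0mem : (0 : ℝ) ∈ Set.Ioo (-ε₀) ε₀ := ⟨by linarith, hε₀⟩
  -- Differentiability of the analytic branch at `0` already gives the `O(ε)` estimates.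
  have hO1 := (hφ1 0 h0mem).differentiableAt.isBigO_sub
  have hO2 := (hφ2 0 h0mem).differentiableAt.isBigO_sub
  simp only [hφ0, sub_zero] at hO1 hO2
  refine ⟨ν₀₀, ε₀, δ, fun ε => (φ ε).2, fun ε => (φ ε).1, ?_, hε₀, hδ, hφ2, hφ1, hO2, hO1,
    fun ε hε => ?_⟩
  · rw [RayleighBloch.IsPerturbation.fourierCoefHat_zero_zero, ← hFg, hν₀₀, RayleighBloch.gam,
      RayleighBloch.omegaSq]
    push_cast
    ring
  · obtain ⟨hz, ⟨hνε, hker, hu, hu'⟩, huniq⟩ := hall ε ⟨by linarith [hε.1], hε.2⟩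
    have hk := hker hε.1
    obtain ⟨Y, hY, hsys, hmode⟩ := hk.exists_modeData hf hR.le hνε.ne' hu hu' hz
    refine ⟨⟨hk.beta_pos, hk.beta_lt⟩, hνε, ?_, ?_, fun β ν hβd hνd Y' hY' hs' => ?_, Y, hY, hsys,
      hmode.summable_modeTerm, hmode.isFiniteEnergySolution, ?_, ?_⟩
    · have := hk.wave_pos
      simp only [RayleighBloch.omegaSq] at this ⊢
      linarith
    · have := pow_pos hk.mu_pos 2
      simp only [RayleighBloch.omegaSq] at this ⊢
      linarith
    -- The distance on `ℝ × ℝ` is the maximum, so the `δ`-square is the ball of local uniqueness.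
    -- Any solution there solves the reduced system and so lies on the branch.
    · obtain ⟨⟨-, hker', huv, -⟩, hv⟩ := huniq (ν, β) (by
        rw [Prod.dist_eq]
        exact max_lt hνd hβd)
      have := hv ((hker' hε.1).reducedMap_eq_zero hf hR.le huv hY' hs')
      exact ⟨congrArg Prod.snd this, congrArg Prod.fst this⟩
    · obtain ⟨C', -, hC'⟩ := hmode.exists_norm_mode_le
      exact ⟨C', _, hmode.mu_pos, fun x y => (hC' (x, y)).1⟩
    -- A vanishing mode would give `F = 0`, hence `ν = γF = 0`.
    · by_contra! hall0
      have h1 := hsys.1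
      rw [hmode.averageF_eq_zero hall0, mul_zero] at h1
      exact hνε.ne' (by exact_mod_cast h1)
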